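/- **Theorem.** Let $D\subset\mathbb{Q}$ be a finite domain and let $\Gamma$ be a finite constraint language over $D$, i.e. a finite set of relations $R\subseteq D^{k_R}$. Suppose that $\Gamma$ is closed under a semilattice polymorphism: there is an associative, commutative and idempotent operation $\psi:D\times D\to D$ which, applied coordinatewise to any two tuples of any $R\in\Gamma$, gives again a tuple of $R$. For each $R\in\Gamma$ fix a polynomial $f_R\in\mathbb{Q}[z_1,\dots,z_{k_R}]$ such that for $v\in D^{k_R}$ one has $f_R(v)=0$ if and only if $v\in R$, and let $f_D(z)=\prod_{\rho\in D}(z-\rho)$. An instance $\mathcal{C}$ of $\mathrm{CSP}(\Gamma)$ on variables $x_1,\dots,x_n$ is a finite set of constraints $R(x_{i_1},\dots,x_{i_{k_R}})$ with $R\in\Gamma$. Its solution set is $Sol(\mathcal{C})\subseteq D^n$; its combinatorial ideal $I_{\mathcal{C}}\subseteq\mathbb{Q}[x_1,\dots,x_n]$ is the vanishing ideal of $Sol(\mathcal{C})$; its polynomials are $\mathcal{F}_{\mathcal C}=\{f_R(x_{i_1},\dots,x_{i_{k_R}}): R(x_{i_1},\dots,x_{i_{k_R}})\in\mathcal{C}\}\cup\{f_D(x_1),\dots,f_D(x_n)\}$.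 A polynomial calculus (PC) derivation of $r$ from $\mathcal{F}_{\mathcal C}$ is a finite sequence of polynomials ending in $r$, each of which is an element of $\mathcal{F}_{\mathcal C}$, or a linear combination of two earlier ones, or a variable times an earlier one. Its degree is the maximum degree of its polynomials and its size is the length of their binary encoding. Then there are an algorithm and a constant $K$, both depending only on $D$, $\Gamma$ and the polynomials $f_R$, such that the following holds for all $n,d\in\mathbb{N}$ and every instance $\mathcal{C}$ of $\mathrm{CSP}(\Gamma)$ on $n$ variables. On input $(\mathcal{C},d)$ the algorithm outputs, within time $\max(n,2)^{K\max(d,1)}$, the $d$-truncated reduced Gröbner basis $\mathcal{G}_d$ of $I_{\mathcal{C}}$ with respect to the graded lexicographic order with $x_1>\dots>x_n$ (that is, the elements of degree at most $d$ of the reduced Gröbner basis of $I_{\mathcal{C}}$), together with, for every $g\in\mathcal{G}_d$, a PC derivation of $g$ from $\mathcal{F}_{\mathcal C}$ of degree at most $K\max(d,1)$ and size at most $\max(n,2)^{K\max(d,1)}$. In particular, for $n\ge 2$ and $d\ge 1$, PC of degree $O(d)$ computes $\mathcal{G}_d$ in time $n^{O(d)}$. Running time is measured by the logarithmic-cost model: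 programs with branching and while loops on binary trees with rational leaves, where the elementary steps (including rational arithmetic and comparison) are charged the square of the bit length of operand and result; this agrees with Turing machine time up to a polynomial. -/

import Mathlib

/-! ## A machine model with a step count

Programs act on finite binary trees whose leaves are rational numbers.  Every elementary step is
charged the square of the bit length of its operand and its result (logarithmic cost), so running
times agree, up to a polynomial, with those of Turing machines. -/

/-- Binary trees with rational leaves. -/
inductive Data : Type
  | atom (q : ℚ)
  | pair (a b : Data)
  deriving DecidableEq

namespace Data

/-- The bit length: leaves are reduced fractions with numerator and denominator in binary. -/
def size : Data → ℕ
  | atom q => Nat.size q.num.natAbs + Nat.size q.den + 1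
  | pair a b => a.size + b.size + 1

/-- A list as a right comb, ended by the leaf `0`. -/
def ofList : List Data → Data
  | [] => atom 0
  | x :: xs => pair x (ofList xs)

/-- A natural number as a leaf. -/
def ofNat (k : ℕ) : Data := atom (k : ℚ)

/-- A truth value as a leaf; in tests, the leaf `0` is false and everything else is true. -/
def ofBool (b : Bool) : Data := if b then atom 1 else atom 0

/-- The first component (`0` on leaves). -/
def fst : Data → Data
  | atom _ => atom 0
  | pair a _ => a

/-- The second component (`0` on leaves). -/
def snd : Data → Data
  | atom _ => atom 0
  | pair _ b => b

/-- The rational number at a leaf (`0` on pairs). -/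
def val : Data → ℚ
  | atom q => q
  | pair _ _ => 0

/-- Whether a tree is a leaf. -/
def isAtom : Data → Bool
  | atom _ => true
  | pair _ _ => false

end Data

/-- The elementary operations.  The binary ones act on the two components of a pair. -/
inductive Op : Type
  | id
  | const (c : Data)
  | fst
  | snd
  | isAtom
  | eq
  | le
  | add
  | sub
  | mul
  | div

/-- The result of an elementary operation. -/
def Op.apply : Op → Data → Data
  | .id, x => x
  | .const c, _ => c
  | .fst, x => x.fst
  | .snd, x => x.snd
  | .isAtom, x => Data.ofBool x.isAtom
  | .eq, x => Data.ofBool (decide (x.fst = x.snd))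
  | .le, x => Data.ofBool (decide (x.fst.val ≤ x.snd.val))
  | .add, x => Data.atom (x.fst.val + x.snd.val)
  | .sub, x => Data.atom (x.fst.val - x.snd.val)
  | .mul, x => Data.atom (x.fst.val * x.snd.val)
  | .div, x => Data.atom (x.fst.val / x.snd.val)

/-- Programs: elementary operations, composition (`comp p q` runs `p` first), pairing,
branching, and while loops. -/
inductive Prog : Type
  | op (o : Op)
  | comp (p q : Prog)
  | pair (p q : Prog)
  | cond (c p q : Prog)
  | loop (c p : Prog)

/-- `Runs P x y t`: the program `P`, started on `x`, halts with output `y` after time `t`. -/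
inductive Runs : Prog → Data → Data → ℕ → Prop
  | op (o : Op) (x : Data) :
      Runs (.op o) x (o.apply x) ((1 + x.size + (o.apply x).size) ^ 2)
  | comp {p q : Prog} {x y z : Data} {s t : ℕ} :
      Runs p x y s → Runs q y z t → Runs (.comp p q) x z (s + t + 1)
  | pair {p q : Prog} {x y z : Data} {s t : ℕ} :
      Runs p x y s → Runs q x z t → Runs (.pair p q) x (.pair y z) (s + t + x.size + 1)
  | condTrue {c p q : Prog} {x b y : Data} {s t : ℕ} :
      Runs c x b s → b ≠ .atom 0 → Runs p x y t → Runs (.cond c p q) x y (s + t + x.size + 1)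
  | condFalse {c p q : Prog} {x y : Data} {s t : ℕ} :
      Runs c x (.atom 0) s → Runs q x y t → Runs (.cond c p q) x y (s + t + x.size + 1)
  | loopStop {c p : Prog} {x : Data} {s : ℕ} :
      Runs c x (.atom 0) s → Runs (.loop c p) x x (s + x.size + 1)
  | loopStep {c p : Prog} {x b y z : Data} {s t u : ℕ} :
      Runs c x b s → b ≠ .atom 0 → Runs p x y t → Runs (.loop c p) y z u →
      Runs (.loop c p) x z (s + t + u + x.size + 1)

/-! ## Constraint satisfaction problems -/

/-- A finite constraint language over the domain `D`: a finite list of relations on `D`. -/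
structure ConstraintLanguage (D : Finset ℚ) where
  /-- the number of relations -/
  num : ℕ
  /-- the arity of each relation -/
  arity : Fin num → ℕ
  /-- the relations, as sets of tuples of domain elements -/
  rel : (j : Fin num) → Set (Fin (arity j) → D)

/-- A semilattice operation: associative, commutative, idempotent. -/
structure IsSemilatticeOp {α : Type*} (ψ : α → α → α) : Prop where
  assoc : ∀ a b c, ψ (ψ a b) c = ψ a (ψ b c)
  comm : ∀ a b, ψ a b = ψ b a
  idem : ∀ a, ψ a a = a

/-- The binary operation `ψ` preserves every relation of the language. -/
def ConstraintLanguage.IsPolymorphism {D : Finset ℚ} (Γ : ConstraintLanguage D)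
    (ψ : D → D → D) : Prop :=
  ∀ j, ∀ s ∈ Γ.rel j, ∀ t ∈ Γ.rel j, (fun i => ψ (s i) (t i)) ∈ Γ.rel j

/-- The language is closed under some semilattice polymorphism. -/
def ConstraintLanguage.IsSemilatticeClosed {D : Finset ℚ} (Γ : ConstraintLanguage D) : Prop :=
  ∃ ψ : D → D → D, IsSemilatticeOp ψ ∧ Γ.IsPolymorphism ψ

/-- A constraint `R(x_{i_1}, …, x_{i_k})` on the variables `x_0, …, x_{n-1}`. -/
structure Constraint {D : Finset ℚ} (Γ : ConstraintLanguage D) (n : ℕ) where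
  /-- which relation of the language -/
  idx : Fin Γ.num
  /-- the variables it is applied to, possibly with repetitions -/
  scope : Fin (Γ.arity idx) → Fin n

/-- An instance of `CSP(Γ)` on `n` variables: a finite set of constraints, listed in any order. -/
structure CSPInstance {D : Finset ℚ} (Γ : ConstraintLanguage D) (n : ℕ) where
  /-- the constraints -/
  constraints : List (Constraint Γ n)
  /-- no constraint is listed twice -/
  nodup : constraints.Nodup

/-- The set of solutions of an instance. -/
def CSPInstance.sol {D : Finset ℚ} {Γ : ConstraintLanguage D} {n : ℕ} (I : CSPInstance Γ n) :
    Set (Fin n → D) :=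
  {φ | ∀ c ∈ I.constraints, (fun i => φ (c.scope i)) ∈ Γ.rel c.idx}

/-- The combinatorial ideal: the vanishing ideal of the set of solutions. -/
noncomputable def CSPInstance.ideal {D : Finset ℚ} {Γ : ConstraintLanguage D} {n : ℕ}
    (I : CSPInstance Γ n) : Ideal (MvPolynomial (Fin n) ℚ) :=
  MvPolynomial.vanishingIdeal ℚ ((fun (φ : Fin n → D) (i : Fin n) => (φ i : ℚ)) '' I.sol)

/-- Polynomials that define the relations of the language: for tuples over `D`,
`poly j` vanishes exactly on `rel j`. -/
structure DefiningPolys {D : Finset ℚ} (Γ : ConstraintLanguage D) where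
  /-- the polynomial of each relation -/
  poly : (j : Fin Γ.num) → MvPolynomial (Fin (Γ.arity j)) ℚ
  /-- its zeros in `D ^ k` are the tuples of the relation -/
  eval_eq_zero_iff : ∀ (j : Fin Γ.num) (v : Fin (Γ.arity j) → D),
    MvPolynomial.eval (fun i => (v i : ℚ)) (poly j) = 0 ↔ v ∈ Γ.rel j

/-- The domain polynomial `∏_{ρ ∈ D} (x_i - ρ)`. -/
noncomputable def domainPoly (D : Finset ℚ) {n : ℕ} (i : Fin n) : MvPolynomial (Fin n) ℚ :=
  ∏ ρ ∈ D, (MvPolynomial.X i - MvPolynomial.C ρ)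

/-- The polynomials of an instance: those of its constraints and the domain polynomials. -/
noncomputable def CSPInstance.axiomPolys {D : Finset ℚ} {Γ : ConstraintLanguage D} {n : ℕ}
    (I : CSPInstance Γ n) (f : DefiningPolys Γ) : Set (MvPolynomial (Fin n) ℚ) :=
  {p | ∃ c ∈ I.constraints, p = MvPolynomial.rename c.scope (f.poly c.idx)} ∪
    Set.range (domainPoly D)

/-! ## Polynomial calculus -/

/-- `π` is a polynomial calculus derivation of `r = 0` from the equations `p = 0`, `p ∈ F`: a
sequence ending in `r` each of whose entries is in `F`, or a linear combination of two earlier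
entries, or a variable times an earlier entry. -/
def IsPCDerivation {n : ℕ} (F : Set (MvPolynomial (Fin n) ℚ))
    (π : List (MvPolynomial (Fin n) ℚ)) (r : MvPolynomial (Fin n) ℚ) : Prop :=
  π.getLast? = some r ∧
  ∀ i : Fin π.length,
    π.get i ∈ F ∨
    (∃ j k : Fin π.length, j < i ∧ k < i ∧ ∃ a b : ℚ,
      π.get i = MvPolynomial.C a * π.get j + MvPolynomial.C b * π.get k) ∨
    (∃ j : Fin π.length, j < i ∧ ∃ v : Fin n, π.get i = MvPolynomial.X v * π.get j)

/-! ## Gröbner bases for the graded lexicographic order with `x_0 > x_1 > ⋯` -/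

/-- `G` is the reduced Gröbner basis of the ideal `I`. -/
structure IsReducedGroebnerBasis {n : ℕ} (I : Ideal (MvPolynomial (Fin n) ℚ))
    (G : Finset (MvPolynomial (Fin n) ℚ)) : Prop where
  span_eq : Ideal.span (G : Set (MvPolynomial (Fin n) ℚ)) = I
  /-- the leading monomial of a nonzero element of `I` is divisible by one of an element of `G` -/
  exists_dvd : ∀ p ∈ I, p ≠ 0 →
    ∃ g ∈ G, MonomialOrder.degLex.degree g ≤ MonomialOrder.degLex.degree p
  monic : ∀ g ∈ G, MonomialOrder.degLex.leadingCoeff g = 1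
  /-- no monomial of an element is divisible by the leading monomial of another one -/
  reduced : ∀ g ∈ G, ∀ h ∈ G, h ≠ g → ∀ α ∈ g.support, ¬ MonomialOrder.degLex.degree h ≤ α

/-- `L` lists, without repetition, the `d`-truncated reduced Gröbner basis of `I`: the elements of
degree at most `d` of the reduced Gröbner basis. -/
def IsTruncatedReducedGroebnerBasis {n : ℕ} (I : Ideal (MvPolynomial (Fin n) ℚ)) (d : ℕ)
    (L : List (MvPolynomial (Fin n) ℚ)) : Prop :=
  L.Nodup ∧ ∃ G : Finset (MvPolynomial (Fin n) ℚ), IsReducedGroebnerBasis I G ∧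
    ∀ g, g ∈ L ↔ g ∈ G ∧ g.totalDegree ≤ d

/-! ## Encodings of inputs and outputs -/

/-- The exponent vectors of a polynomial in decreasing graded lexicographic order. -/
noncomputable def sortedSupport {n : ℕ} (p : MvPolynomial (Fin n) ℚ) : List (Fin n →₀ ℕ) :=
  ((p.support.map MonomialOrder.degLex.toSyn.toEquiv.toEmbedding).sort (· ≥ ·)).map
    MonomialOrder.degLex.toSyn.symm

/-- A polynomial as the list of its terms, each a coefficient with an exponent vector. -/
noncomputable def encodePoly {n : ℕ} (p : MvPolynomial (Fin n) ℚ) : Data :=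
  Data.ofList ((sortedSupport p).map fun α =>
    .pair (.atom (p.coeff α)) (Data.ofList (List.ofFn fun i => Data.ofNat (α i))))

/-- A list of polynomials. -/
noncomputable def encodePolyList {n : ℕ} (π : List (MvPolynomial (Fin n) ℚ)) : Data :=
  Data.ofList (π.map encodePoly)

/-- A constraint as its relation number with the list of its variables. -/
def Constraint.encode {D : Finset ℚ} {Γ : ConstraintLanguage D} {n : ℕ} (c : Constraint Γ n) :
    Data :=
  .pair (Data.ofNat c.idx) (Data.ofList (List.ofFn fun i => Data.ofNat (c.scope i)))

/-- The input: the number of variables, the degree `d`, and the list of constraints. -/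
def CSPInstance.encode {D : Finset ℚ} {Γ : ConstraintLanguage D} {n : ℕ} (I : CSPInstance Γ n)
    (d : ℕ) : Data :=
  .pair (Data.ofNat n) (.pair (Data.ofNat d) (Data.ofList (I.constraints.map Constraint.encode)))

/-- The output: a list of polynomials, each with a derivation. -/
noncomputable def encodeOutput {n : ℕ}
    (out : List (MvPolynomial (Fin n) ℚ × List (MvPolynomial (Fin n) ℚ))) : Data :=
  Data.ofList (out.map fun e => .pair (encodePoly e.1) (encodePolyList e.2))

/-! Read ψ as the meet of a semilattice order on D, so that every relation is closed under
coordinatewise meets. For a list S of at most d pairs (i, a), `upperProd ν S` is a polynomial whose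
values on D^n are those of the indicator of "x_i ≥ a for all (i, a) in S". By Möbius inversion every
polynomial of degree at most d agrees on D^n with a linear combination of such indicators
(`exists_eq_sum_upperProd`). If some solution lies above S, there is a least one, m_S, and on the
solution set the indicator of S is the indicator of the solutions above m_S. For distinct m these
functions are linearly independent, by triangularity. Hence a polynomial of degree at most d that
vanishes on all solutions is, on D^n, a combination of indicators with no solution above S and of
differences of indicators with the same m_S. It remains to derive these in degree O(d).

This is arc consistency carried out inside polynomial calculus. Let V be a space of derivable
polynomials that contains the low-degree polynomials vanishing on D^n and the low-degree multiples
of the constraint polynomials, and that is closed under low-degree multiples of those products "x_i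
= a and x above S" which it contains (`IsPropagated`). Suppose that the indicator of S is not in V,
and call a value a admissible for x_i if the product "x_i = a and x above S" is not in V. Every
admissible value extends, in each constraint, to a tuple of admissible values (`exists_tuple`). By
closure under meets, the coordinatewise meets of the admissible values form a solution. It is m_S,
and V contains 1_S (1 - 1_T) whenever T lies below m_S (`exists_least`). So the indicators of S and
S' with m_S = m_S' are both congruent to their product modulo V, and `mem_of_forall_solution`
follows.

To find such a V, let U consist of the products of at most d + 1 one-variable indicators; there are
n^O(d) of them. In rounds, linear algebra decides which members of U lie in the span of the monomial
multiples, with monomials of degree at most k = O(d), of the axioms and of the members of U found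
before. A found member is reused with its own degree, so degrees do not accumulate. A round that is
not stable finds a new member, so |U| rounds suffice (`roundStep_rounds`). In the reduced echelon
basis of the final span, the elements of degree at most d whose leading monomial is divisible by no
other one are exactly the truncated reduced Gröbner basis
(`isTruncatedReducedGroebnerBasis_filter_keep`). All intermediate polynomials are linear
combinations or multiples by a variable of earlier ones, so their log is a derivation
(`pcLog_saturate`).

The running time is handled by the relation `Computes`, closed under branching, loops and folds
whose states stay small. The delicate point is the growth of coefficients during elimination: a
reduced echelon basis is determined by its span, and Cramer's rule bounds its entries by
determinants of the original data (`IsEchelon.ratHeight_coeff_le`). -/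

/-! ## Polynomially bounded families -/

/-- `f` is bounded by a fixed power of `T + 2`. -/
def PolyBdd {ι : Type} (T f : ι → ℕ) : Prop := ∃ c, ∀ i, f i ≤ (T i + 2) ^ c

namespace PolyBdd

variable {ι κ : Type} {T T' f g : ι → ℕ}

lemma mono (hf : PolyBdd T f) (h : ∀ i, g i ≤ f i) : PolyBdd T g :=
  let ⟨c, hc⟩ := hf
  ⟨c, fun i => (h i).trans (hc i)⟩

/-- The base `T + 2` is at least 2 whatever `T` is, so constants are covered by `a ≤ 2 ^ a`. -/
lemma const (a : ℕ) : PolyBdd T fun _ => a :=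
  ⟨a, fun i => Nat.lt_two_pow_self.le.trans (Nat.pow_le_pow_left (by omega) a)⟩

lemma self : PolyBdd T T := ⟨1, fun i => by simp⟩

lemma add (hf : PolyBdd T f) (hg : PolyBdd T g) : PolyBdd T fun i => f i + g i := by
  obtain ⟨a, ha⟩ := hf
  obtain ⟨b, hb⟩ := hg
  refine ⟨a + b + 1, fun i => ?_⟩
  have h1 : (T i + 2) ^ a ≤ (T i + 2) ^ (a + b) := Nat.pow_le_pow_right (by omega) (by omega)
  have h2 : (T i + 2) ^ b ≤ (T i + 2) ^ (a + b) := Nat.pow_le_pow_right (by omega) (by omega)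
  have := ha i
  have := hb i
  rw [pow_succ]
  nlinarith [Nat.zero_le (T i * (T i + 2) ^ (a + b))]

lemma mul (hf : PolyBdd T f) (hg : PolyBdd T g) : PolyBdd T fun i => f i * g i := by
  obtain ⟨a, ha⟩ := hf
  obtain ⟨b, hb⟩ := hg
  exact ⟨a + b, fun i => by rw [pow_add]; exact Nat.mul_le_mul (ha i) (hb i)⟩

lemma pow (hf : PolyBdd T f) (k : ℕ) : PolyBdd T fun i => f i ^ k := by
  obtain ⟨a, ha⟩ := hf
  exact ⟨a * k, fun i => by rw [pow_mul]; exact Nat.pow_le_pow_left (ha i) k⟩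

lemma reindex (hf : PolyBdd T f) (σ : κ → ι) : PolyBdd (fun j => T (σ j)) fun j => f (σ j) :=
  let ⟨c, hc⟩ := hf
  ⟨c, fun j => hc (σ j)⟩

end PolyBdd

/-! ## Families computed in polynomial time -/

/-- Every step is charged for what it reads and writes. A time bound is therefore also a size bound;
in the end it bounds the size of the derivations. -/
lemma Runs.size_le {P : Prog} {x y : Data} {t : ℕ} (h : Runs P x y t) :
    x.size ≤ t ∧ y.size ≤ t := by
  induction h with
  | op o x => constructor <;> nlinarith [Nat.zero_le x.size, Nat.zero_le (o.apply x).size]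
  | comp _ _ h1 h2 => omega
  | pair _ _ h1 h2 => simp only [Data.size]; omega
  | condTrue _ _ _ h1 h2 => omega
  | condFalse _ _ h1 h2 => omega
  | loopStop _ h1 => omega
  | loopStep _ _ _ _ h1 h2 h3 => omega

/-- One program turns `x i` into `y i`, for all `i`, in time polynomial in `T i`. -/
def Computes {ι : Type} (T : ι → ℕ) (x y : ι → Data) : Prop :=
  ∃ (P : Prog) (τ : ι → ℕ), PolyBdd T τ ∧ ∀ i, Runs P (x i) (y i) (τ i)

namespace Computes

variable {ι κ : Type} {T : ι → ℕ} {x y z w : ι → Data}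

lemma of_exists (P : Prog) {τ : ι → ℕ} (hτ : PolyBdd T τ)
    (h : ∀ i, ∃ t ≤ τ i, Runs P (x i) (y i) t) : Computes T x y := by
  choose t ht hr using h
  exact ⟨P, t, hτ.mono ht, hr⟩

lemma size_left (h : Computes T x y) : PolyBdd T fun i => (x i).size :=
  let ⟨_, _, hτ, hr⟩ := h
  hτ.mono fun i => (hr i).size_le.1

lemma size_right (h : Computes T x y) : PolyBdd T fun i => (y i).size :=
  let ⟨_, _, hτ, hr⟩ := h
  hτ.mono fun i => (hr i).size_le.2

lemma congr (h : Computes T x y) (e : ∀ i, y i = z i) : Computes T x z :=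
  (funext e : y = z) ▸ h

lemma reindex (h : Computes T x y) (σ : κ → ι) :
    Computes (fun j => T (σ j)) (fun j => x (σ j)) fun j => y (σ j) :=
  let ⟨P, _, hτ, hr⟩ := h
  ⟨P, _, hτ.reindex σ, fun j => hr (σ j)⟩

lemma op (o : Op) (hx : PolyBdd T fun i => (x i).size)
    (hy : PolyBdd T fun i => (o.apply (x i)).size) : Computes T x fun i => o.apply (x i) :=
  ⟨.op o, _, (((PolyBdd.const 1).add hx).add hy).pow 2, fun i => .op o (x i)⟩

lemma comp (h1 : Computes T x y) (h2 : Computes T y z) : Computes T x z :=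
  let ⟨P, _, hτ, hr⟩ := h1
  let ⟨Q, _, hτ', hr'⟩ := h2
  ⟨.comp P Q, _, (hτ.add hτ').add (.const 1), fun i => .comp (hr i) (hr' i)⟩

lemma pair (h1 : Computes T x y) (h2 : Computes T x z) :
    Computes T x fun i => .pair (y i) (z i) :=
  let ⟨P, _, hτ, hr⟩ := h1
  let ⟨Q, _, hτ', hr'⟩ := h2
  ⟨.pair P Q, _, ((hτ.add hτ').add h1.size_left).add (.const 1), fun i => .pair (hr i) (hr' i)⟩

lemma id (hx : PolyBdd T fun i => (x i).size) : Computes T x x :=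
  Computes.op .id hx hx

lemma const (hx : PolyBdd T fun i => (x i).size) (c : Data) : Computes T x fun _ => c :=
  Computes.op (.const c) hx (PolyBdd.const c.size)

lemma applyOp (h : Computes T x y) (o : Op) (hy : PolyBdd T fun i => (o.apply (y i)).size) :
    Computes T x fun i => o.apply (y i) :=
  h.comp (Computes.op o h.size_right hy)

end Computes

namespace Data

lemma one_le_size (a : Data) : 1 ≤ a.size := by cases a <;> simp [size]

lemma size_fst_le (a : Data) : a.fst.size ≤ a.size + 2 := by
  cases a with
  | atom q => simp [fst, size]
  | pair a b => simp only [fst, size]; omega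

lemma size_snd_le (a : Data) : a.snd.size ≤ a.size + 2 := by
  cases a with
  | atom q => simp [snd, size]
  | pair a b => simp only [snd, size]; omega

lemma size_ofBool_le (b : Bool) : (ofBool b).size ≤ 3 := by
  cases b <;> simp [ofBool, size, show Nat.size 1 = 1 from rfl]

lemma size_ofList (l : List Data) : (ofList l).size = (l.map fun a => a.size + 1).sum + 2 := by
  induction l with
  | nil => simp [ofList, size]
  | cons a l ih => simp only [ofList, size, ih, List.map_cons, List.sum_cons]; omega

lemma ofList_injective : Function.Injective ofList := by
  intro l
  induction l with
  | nil => intro l' h; cases l' <;> simp_all [ofList]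
  | cons a l ih => 
    intro l' h
    cases l' with
    | nil => simp [ofList] at h
    | cons b l' => 
      simp only [ofList, Data.pair.injEq] at h
      rw [h.1, ih h.2]

@[simp] lemma ofBool_eq_zero {b : Bool} : ofBool b = atom 0 ↔ b = false := by
  cases b <;> simp [ofBool]

end Data

/-! ### Branching and while loops in polynomial time. -/

namespace Computes

variable {ι κ : Type} {T : ι → ℕ} {x y z w : ι → Data}

lemma fst (h : Computes T x y) : Computes T x fun i => (y i).fst :=
  h.applyOp .fst ((h.size_right.add (.const 2)).mono fun i => (y i).size_fst_le)

lemma snd (h : Computes T x y) : Computes T x fun i => (y i).snd :=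
  h.applyOp .snd ((h.size_right.add (.const 2)).mono fun i => (y i).size_snd_le)

lemma isAtom (h : Computes T x y) : Computes T x fun i => Data.ofBool (y i).isAtom :=
  h.applyOp .isAtom ((PolyBdd.const 3).mono fun _ => Data.size_ofBool_le _)

lemma decideEq (h1 : Computes T x y) (h2 : Computes T x z) :
    Computes T x fun i => Data.ofBool (decide (y i = z i)) :=
  (h1.pair h2).applyOp .eq ((PolyBdd.const 3).mono fun _ => Data.size_ofBool_le _)

lemma decideLe (h1 : Computes T x y) (h2 : Computes T x z) :
    Computes T x fun i => Data.ofBool (decide ((y i).val ≤ (z i).val)) :=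
  (h1.pair h2).applyOp .le ((PolyBdd.const 3).mono fun _ => Data.size_ofBool_le _)

/-- A value computed from part of the context is computed from the whole context. -/
lemma ite {p : ι → Prop} [∀ i, Decidable (p i)]
    (hp : Computes T x fun i => Data.ofBool (decide (p i)))
    (h1 : Computes (fun i : {i // p i} => T i) (fun i => x i) fun i => y i)
    (h2 : Computes (fun i : {i // ¬ p i} => T i) (fun i => x i) fun i => z i) :
    Computes T x fun i => if p i then y i else z i := by
  obtain ⟨P, τ, hτ, hr⟩ := hp
  obtain ⟨P1, τ1, ⟨c1, hτ1⟩, hr1⟩ := h1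
  obtain ⟨P2, τ2, ⟨c2, hτ2⟩, hr2⟩ := h2
  -- The running times of the branches exist only on the two subtypes; their polynomial bounds make
  -- sense for all `i`, so the sum of both bounds is used.
  refine of_exists (.cond P P1 P2) (τ := fun i => τ i + ((T i + 2) ^ c1 + (T i + 2) ^ c2) + τ i + 1)
    (((hτ.add (.add ⟨c1, fun i => le_rfl⟩ ⟨c2, fun i => le_rfl⟩)).add hτ).add (.const 1))
    fun i => ?_
  have hx := (hr i).size_le.1
  by_cases h : p i
  · have hb := hr i
    simp only [decide_eq_true h] at hb
    refine ⟨_, ?_, by rw [if_pos h]; exact .condTrue hb (by simp) (hr1 ⟨i, h⟩)⟩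
    have := hτ1 ⟨i, h⟩
    simp only at this ⊢
    omega
  · have hb := hr i
    simp only [decide_eq_false h] at hb
    refine ⟨_, ?_, by rw [if_neg h]; exact .condFalse hb (hr2 ⟨i, h⟩)⟩
    have := hτ2 ⟨i, h⟩
    simp only at this ⊢
    omega

lemma not {b : ι → Bool} (h : Computes T x fun i => Data.ofBool (b i)) :
    Computes T x fun i => Data.ofBool (!b i) := by
  have h' : Computes T x fun i => if b i = true then Data.ofBool false else Data.ofBool true :=
    ite (h.congr fun i => by simp) (const (h.size_left.reindex Subtype.val) _)
      (const (h.size_left.reindex Subtype.val) _)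
  exact h'.congr fun i => by cases b i <;> simp

lemma and {b c : ι → Bool} (h : Computes T x fun i => Data.ofBool (b i))
    (h2 : Computes T x fun i => Data.ofBool (c i)) :
    Computes T x fun i => Data.ofBool (b i && c i) := by
  have h' : Computes T x fun i => if b i = true then Data.ofBool (c i) else Data.ofBool false :=
    ite (h.congr fun i => by simp) (h2.reindex Subtype.val)
      (const (h.size_left.reindex Subtype.val) _)
  exact h'.congr fun i => by cases b i <;> simp

/-- A while loop that passes through the states `s i 0, …, s i (k i)`. -/
lemma whileLoop {k : ι → ℕ} {s test : ι → ℕ → Data} (hk : PolyBdd T k)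
    (htest : Computes (fun j : {p : ι × ℕ // p.2 ≤ k p.1} => T j.1.1) (fun j => s j.1.1 j.1.2)
      fun j => test j.1.1 j.1.2)
    (h1 : ∀ i, ∀ j < k i, test i j ≠ .atom 0) (h0 : ∀ i, test i (k i) = .atom 0)
    (hstep : Computes (fun j : {p : ι × ℕ // p.2 < k p.1} => T j.1.1) (fun j => s j.1.1 j.1.2)
      fun j => s j.1.1 (j.1.2 + 1)) :
    Computes T (fun i => s i 0) fun i => s i (k i) := by
  obtain ⟨P, τ, ⟨c, hτ⟩, hr⟩ := htest
  obtain ⟨Q, τ', ⟨c', hτ'⟩, hr'⟩ := hstep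
  -- Induction on the number `m` of iterations that remain, starting from the final state.
  have key : ∀ i m, m ≤ k i → ∃ t ≤ (m + 1) * (2 * (T i + 2) ^ c + (T i + 2) ^ c' + 1),
      Runs (.loop P Q) (s i (k i - m)) (s i (k i)) t := by
    intro i m
    induction m with
    | zero =>
      intro _
      have hb : Runs P (s i (k i)) (test i (k i)) _ := hr ⟨(i, k i), le_rfl⟩
      have hb1 : _ ≤ (T i + 2) ^ c := hτ ⟨(i, k i), le_rfl⟩
      have hb2 := hb.size_le.1
      rw [h0] at hb
      simp only [Nat.sub_zero]
      exact ⟨_, by omega, .loopStop hb⟩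
    | succ m ih =>
      intro hm
      obtain ⟨t, ht, hrt⟩ := ih (by omega)
      have hb := hr ⟨(i, k i - (m + 1)), Nat.sub_le _ _⟩
      have hb1 := hτ ⟨(i, k i - (m + 1)), Nat.sub_le _ _⟩
      have hb2 := hb.size_le.1
      have hs := hr' ⟨(i, k i - (m + 1)), by simp only; omega⟩
      have hs1 := hτ' ⟨(i, k i - (m + 1)), by simp only; omega⟩
      simp only [show k i - (m + 1) + 1 = k i - m by omega] at hs hs1 hb hb1 hb2
      refine ⟨_, ?_, .loopStep hb (h1 i _ (by omega)) hs hrt⟩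
      rw [Nat.succ_mul]
      omega
  refine of_exists (.loop P Q)
    (τ := fun i => (k i + 1) * (2 * (T i + 2) ^ c + (T i + 2) ^ c' + 1))
    ((hk.add (.const 1)).mul ((((PolyBdd.const 2).mul ⟨c, fun _ => le_rfl⟩).add
      ⟨c', fun _ => le_rfl⟩).add (.const 1))) fun i => ?_
  simpa using key i (k i) le_rfl

end Computes

/-! ## Folds -/

namespace Data

lemma size_ofList_le_of_sublist {l l' : List Data} (h : l.Sublist l') :
    (ofList l).size ≤ (ofList l').size := by
  simp only [size_ofList]
  have := (h.map fun a => a.size + 1).sum_le_sum (by simp)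
  omega

lemma length_le_size (l : List Data) : l.length ≤ (ofList l).size := by
  induction l with
  | nil => simp
  | cons a l ih => simp only [ofList, size, List.length_cons]; omega

lemma size_le_of_mem {l : List Data} {a : Data} (h : a ∈ l) : a.size ≤ (ofList l).size := by
  induction l with
  | nil => simp at h
  | cons b l ih =>
    simp only [ofList, size]
    rcases List.mem_cons.1 h with rfl | h
    · omega
    · have := ih h; omega

lemma size_ofList_append (l l' : List Data) :
    (ofList (l ++ l')).size + 2 = (ofList l).size + (ofList l').size := by
  simp only [size_ofList, List.map_append, List.sum_append]; omega

lemma size_ofList_le_of_forall {l : List Data} {b : ℕ} (h : ∀ a ∈ l, a.size ≤ b) :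
    (ofList l).size ≤ l.length * (b + 1) + 2 := by
  induction l with
  | nil => simp [size_ofList]
  | cons a l ih =>
    have h1 := h a (by simp)
    have h2 := ih fun c hc => h c (by simp [hc])
    simp only [ofList, size, List.length_cons, Nat.succ_mul]
    omega

end Data

/-- The encoding of a list. -/
abbrev encList {α : Type} (e : α → Data) (l : List α) : Data := Data.ofList (l.map e)

namespace Computes

variable {ι κ : Type} {T : ι → ℕ} {x y z w : ι → Data}

section fold

variable {α β γ : ι → Type} {ea : ∀ i, α i → Data} {eb : ∀ i, β i → Data} {ec : ∀ i, γ i → Data}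
  {l l' : ∀ i, List (α i)} {b : ∀ i, β i} {f : ∀ i, β i → α i → β i}

/-- A while loop on the triple of remaining list, context and accumulator. Iterating a
polynomial-time step may blow up the accumulator, hence the separate bound `hsize`. The step need
only be computed on reachable states, those whose accumulator is the fold of a prefix. -/
lemma foldl (hl : Computes T x fun i => encList (ea i) (l i)) (hb : Computes T x fun i => eb i (b i))
    (hsize : PolyBdd (fun j : {j : Σ i, List (α i) // j.2 <+: l j.1} => T j.1.1)
      fun j => (eb _ (j.1.2.foldl (f _) (b _))).size)
    (hstep : Computes (fun j : {j : Σ i, β i × α i // ∃ l1 l2, l j.1 = l1 ++ j.2.2 :: l2 ∧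
        j.2.1 = l1.foldl (f j.1) (b j.1)} => T j.1.1)
      (fun j => .pair (x j.1.1) (.pair (eb _ j.1.2.1) (ea _ j.1.2.2)))
      fun j => eb _ (f _ j.1.2.1 j.1.2.2)) :
    Computes T x fun i => eb i ((l i).foldl (f i) (b i)) := by
  let s : ι → ℕ → Data := fun i j => .pair (encList (ea i) ((l i).drop j))
    (.pair (x i) (eb i (((l i).take j).foldl (f i) (b i))))
  let k : ι → ℕ := fun i => (l i).length
  let κ := {p : ι × ℕ // p.2 ≤ k p.1}
  let κ' := {p : ι × ℕ // p.2 < k p.1}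
  have hk : PolyBdd T k := hl.size_right.mono fun i => by
    simpa using Data.length_le_size ((l i).map (ea i))
  have hs : PolyBdd (fun j : κ => T j.1.1) fun j => (s j.1.1 j.1.2).size := by
    have h1 := (hl.size_right).reindex fun j : κ => j.1.1
    have h2 := (hl.size_left).reindex fun j : κ => j.1.1
    have h3 := hsize.reindex fun j : κ => ⟨⟨j.1.1, (l j.1.1).take j.1.2⟩, List.take_prefix _ _⟩
    refine (((h1.add h2).add h3).add (.const 2)).mono fun j => ?_
    have := Data.size_ofList_le_of_sublist
      ((List.drop_sublist j.1.2 (l j.1.1)).map (ea j.1.1))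
    simp only [s, Data.size, encList] at this ⊢
    omega
  have hs' : PolyBdd (fun j : κ' => T j.1.1) fun j => (s j.1.1 j.1.2).size :=
    hs.reindex fun j : κ' => ⟨j.1, j.2.le⟩
  have hcons : ∀ i j (hj : j < k i), s i j = .pair (.pair (ea i ((l i)[j]'hj))
      (encList (ea i) ((l i).drop (j + 1))))
      (.pair (x i) (eb i (((l i).take j).foldl (f i) (b i)))) := fun i j hj => by
    simp only [s, encList, List.drop_eq_getElem_cons hj, List.map_cons, Data.ofList]
  have main := Computes.whileLoop (T := T) (k := k) (s := s)
    (test := fun i j => Data.ofBool (!(s i j).fst.isAtom)) hk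
    ((id hs).fst.isAtom.not) ?_ ?_ ?_
  · refine ((hl.pair ((id hl.size_left).pair hb)).comp
      (main.congr fun i => rfl)).snd.snd.congr fun i => ?_
    simp [s, k, Data.snd]
  · intro i j hj
    simp [hcons i j hj, Data.fst, Data.isAtom]
  · intro i
    simp [s, k, encList, Data.ofList, Data.fst, Data.isAtom]
  · have hi := id hs'
    let σ : κ' → {j : Σ i, β i × α i // ∃ l1 l2, l j.1 = l1 ++ j.2.2 :: l2 ∧
        j.2.1 = l1.foldl (f j.1) (b j.1)} := fun j =>
      ⟨⟨j.1.1, (((l j.1.1).take j.1.2).foldl (f j.1.1) (b j.1.1), (l j.1.1)[j.1.2]'j.2)⟩,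
        (l j.1.1).take j.1.2, (l j.1.1).drop (j.1.2 + 1), by simp, rfl⟩
    have hst := hstep.reindex σ
    have hctx : Computes (fun j : κ' => T j.1.1) (fun j => s j.1.1 j.1.2)
        fun j => .pair (x j.1.1) (.pair (eb _ (σ j).1.2.1) (ea _ (σ j).1.2.2)) := by
      refine (hi.snd.fst.pair (hi.snd.snd.pair hi.fst.fst)).congr fun j => ?_
      simp only [hcons _ _ j.2, Data.fst, Data.snd, σ]
    refine (hi.fst.snd.pair (hi.snd.fst.pair (hctx.comp hst))).congr fun j => ?_
    simp only [hcons _ _ j.2, Data.fst, Data.snd, σ]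
    simp only [s, ← List.take_append_getElem j.2, List.foldl_append, List.foldl_cons,
      List.foldl_nil]

lemma cons {a : ∀ i, α i} (ha : Computes T x fun i => ea i (a i))
    (hl : Computes T x fun i => encList (ea i) (l i)) :
    Computes T x fun i => encList (ea i) (a i :: l i) :=
  ha.pair hl

lemma nil (hx : PolyBdd T fun i => (x i).size) :
    Computes T x fun i => encList (ea i) [] :=
  const hx _

lemma reverseAux (hl : Computes T x fun i => encList (ea i) (l i))
    (hl' : Computes T x fun i => encList (ea i) (l' i)) :
    Computes T x fun i => encList (ea i) ((l i).reverse ++ l' i) := by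
  have key : ∀ i (m m' : List (α i)), m.foldl (fun acc a => a :: acc) m' = m.reverse ++ m' := by
    intro i m
    induction m with
    | nil => simp
    | cons a m ih => intro m'; simp [ih]
  have h := foldl (eb := fun i => encList (ea i)) (f := fun i acc a => a :: acc) hl hl' ?_ ?_
  · exact h.congr fun i => by simp only [key]
  · refine ((hl.size_right.add hl'.size_right).reindex
      fun j : {j : Σ i, List (α i) // j.2 <+: l j.1} => j.1.1).mono fun j => ?_
    have h1 := Data.size_ofList_append (j.1.2.reverse.map (ea j.1.1)) ((l' j.1.1).map (ea j.1.1))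
    have h2 := Data.size_ofList_le_of_sublist (j.2.sublist.map (ea j.1.1))
    have h3 : (Data.ofList (j.1.2.reverse.map (ea j.1.1))).size =
        (Data.ofList (j.1.2.map (ea j.1.1))).size := by
      simp [Data.size_ofList, List.map_reverse, List.sum_reverse]
    simp only [key, encList, List.map_append]
    omega
  · have hi := id (T := fun j : {j : Σ i, List (α i) × α i // ∃ l1 l2, l j.1 = l1 ++ j.2.2 :: l2 ∧
        j.2.1 = l1.foldl (fun acc a => a :: acc) (l' j.1)} => T j.1.1)
      (x := fun j => .pair (x j.1.1) (.pair (encList (ea _) j.1.2.1) (ea _ j.1.2.2))) ?_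
    · exact hi.snd.snd.pair hi.snd.fst
    · refine ((((hl.size_right.add hl'.size_right).add hl.size_left).add (.const 2)).reindex
        fun j : {j : Σ i, List (α i) × α i // ∃ l1 l2, l j.1 = l1 ++ j.2.2 :: l2 ∧
          j.2.1 = l1.foldl (fun acc a => a :: acc) (l' j.1)} => j.1.1).mono fun j => ?_
      obtain ⟨⟨i, m, a⟩, l1, l2, h1, h2⟩ := j
      simp only at h1 h2
      rw [key] at h2
      simp only [h1, h2, encList, Data.size_ofList, Data.size, List.map_append, List.map_reverse,
        List.sum_append, List.sum_reverse, List.map_cons, List.sum_cons]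
      omega

lemma reverse (hl : Computes T x fun i => encList (ea i) (l i)) :
    Computes T x fun i => encList (ea i) (l i).reverse := by
  simpa using reverseAux hl (nil hl.size_left)

lemma append (hl : Computes T x fun i => encList (ea i) (l i))
    (hl' : Computes T x fun i => encList (ea i) (l' i)) :
    Computes T x fun i => encList (ea i) (l i ++ l' i) := by
  simpa using reverseAux hl.reverse hl'

end fold

end Computes

/-- A fold that also concatenates the lists produced by its steps. -/
def foldlLog {α β γ : Type} (f : β → α → β × List γ) (b : β) (l : List α) : β × List γ :=
  l.foldl (fun s a => ((f s.1 a).1, s.2 ++ (f s.1 a).2)) (b, [])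

/-- The encoding of a value with a list. -/
abbrev encPair {β γ : Type} (eb : β → Data) (ec : γ → Data) (s : β × γ) : Data :=
  .pair (eb s.1) (ec s.2)

section foldlLog

variable {α β γ : Type} (f : β → α → β × List γ) (b : β)

@[simp] lemma foldlLog_nil : foldlLog f b [] = (b, []) := rfl

lemma foldlLog_concat (l : List α) (a : α) :
    foldlLog f b (l ++ [a]) = ((f (foldlLog f b l).1 a).1,
      (foldlLog f b l).2 ++ (f (foldlLog f b l).1 a).2) := by
  simp [foldlLog]

lemma foldlLog_fst (l : List α) :
    (foldlLog f b l).1 = l.foldl (fun s a => (f s a).1) b := by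
  induction l using List.reverseRecOn with
  | nil => rfl
  | append_singleton l a ih => simp [foldlLog_concat, ih]

end foldlLog

namespace Computes

variable {ι κ : Type} {T : ι → ℕ} {x y z w : ι → Data}
  {α β γ : ι → Type} {ea : ∀ i, α i → Data} {eb : ∀ i, β i → Data} {ec : ∀ i, γ i → Data}
  {l l' : ∀ i, List (α i)} {b : ∀ i, β i} {f : ∀ i, β i → α i → β i × List (γ i)}

/-- The log grows by at most one step's output per element, so it stays polynomial automatically and
only the state needs a size hypothesis. -/
lemma foldlLog (hl : Computes T x fun i => encList (ea i) (l i))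
    (hb : Computes T x fun i => eb i (b i))
    (hsize : PolyBdd (fun j : {j : Σ i, List (α i) // j.2 <+: l j.1} => T j.1.1)
      fun j => (eb _ (j.1.2.foldl (fun s a => (f _ s a).1) (b _))).size)
    (hstep : Computes (fun j : {j : Σ i, β i × α i // ∃ l1 l2, l j.1 = l1 ++ j.2.2 :: l2 ∧
        j.2.1 = l1.foldl (fun s a => (f _ s a).1) (b j.1)} => T j.1.1)
      (fun j => .pair (x j.1.1) (.pair (eb _ j.1.2.1) (ea _ j.1.2.2)))
      fun j => encPair (eb _) (encList (ec _)) (f _ j.1.2.1 j.1.2.2)) :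
    Computes T x fun i => encPair (eb i) (encList (ec i)) (foldlLog (f i) (b i) (l i)) := by
  obtain ⟨c, hc⟩ := hstep.size_right
  have hlog : ∀ i (m : List (α i)), m <+: l i →
      (encList (ec i) (_root_.foldlLog (f i) (b i) m).2).size ≤ m.length * (T i + 2) ^ c + 2 := by
    intro i m
    induction m using List.reverseRecOn with
    | nil => intro _; simp [Data.size_ofList]
    | append_singleton m a ih =>
      intro hm
      have h1 := ih ((List.prefix_append m [a]).trans hm)
      obtain ⟨t, ht⟩ := hm
      have h2 := hc ⟨⟨i, m.foldl (fun s a => (f i s a).1) (b i), a⟩, m, t, by simp [← ht], rfl⟩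
      simp only [foldlLog_concat, foldlLog_fst, Data.size] at h2 ⊢
      have h3 := Data.size_ofList_append ((_root_.foldlLog (f i) (b i) m).2.map (ec i))
        ((f i (m.foldl (fun s a => (f i s a).1) (b i)) a).2.map (ec i))
      simp only [encList, List.map_append, List.length_append, List.length_singleton,
        Nat.add_mul, one_mul] at h1 h2 h3 ⊢
      omega
  have hlen : PolyBdd T fun i => (l i).length := hl.size_right.mono fun i => by
    simpa using Data.length_le_size ((l i).map (ea i))
  have hsz : PolyBdd (fun j : {j : Σ i, List (α i) // j.2 <+: l j.1} => T j.1.1)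
      fun j => (encPair (eb _) (encList (ec _)) (_root_.foldlLog (f _) (b _) j.1.2)).size := by
    refine ((hsize.add (((hlen.mul ⟨c, fun _ => le_rfl⟩).add (.const 2)).reindex
      fun j : {j : Σ i, List (α i) // j.2 <+: l j.1} => j.1.1)).add (.const 1)).mono fun j => ?_
    have h1 := hlog j.1.1 j.1.2 j.2
    have h2 := Nat.mul_le_mul_right ((T j.1.1 + 2) ^ c) j.2.length_le
    simp only [Data.size, foldlLog_fst]
    omega
  refine foldl (eb := fun i => encPair (eb i) (encList (ec i)))
    (f := fun i s a => ((f i s.1 a).1, s.2 ++ (f i s.1 a).2)) (b := fun i => (b i, [])) hl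
    (hb.pair (nil hl.size_left)) hsz ?_
  let κ := {j : Σ i, (β i × List (γ i)) × α i // ∃ l1 l2, l j.1 = l1 ++ j.2.2 :: l2 ∧
      j.2.1 = _root_.foldlLog (f j.1) (b j.1) l1}
  change Computes (fun j : κ => T j.1.1) _ _
  let σ : κ → {j : Σ i, β i × α i // ∃ l1 l2, l j.1 = l1 ++ j.2.2 :: l2 ∧
        j.2.1 = l1.foldl (fun s a => (f _ s a).1) (b j.1)} := fun j =>
    ⟨⟨j.1.1, j.1.2.1.1, j.1.2.2⟩, by
      obtain ⟨l1, l2, h1, h2⟩ := j.2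
      exact ⟨l1, l2, h1, by simp only [h2, foldlLog_fst]⟩⟩
  have hst := hstep.reindex σ
  have hi := id (T := fun j : κ => T j.1.1)
    (x := fun j => .pair (x j.1.1) (.pair (encPair (eb _) (encList (ec _)) j.1.2.1)
      (ea _ j.1.2.2))) ?_
  · have hctx : Computes (fun j : κ => T j.1.1) (fun j => .pair (x j.1.1)
        (.pair (encPair (eb _) (encList (ec _)) j.1.2.1) (ea _ j.1.2.2)))
        fun j => .pair (x (σ j).1.1) (.pair (eb _ (σ j).1.2.1) (ea _ (σ j).1.2.2)) :=
      hi.fst.pair (hi.snd.fst.fst.pair hi.snd.snd)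
    have hres := hctx.comp hst
    exact hres.fst.pair (append (l := fun j : κ => j.1.2.1.2) hi.snd.fst.snd hres.snd)
  · have g1 := (hl.size_left.add (hl.size_right)).reindex fun j : κ => j.1.1
    let τ : κ → {j : Σ i, List (α i) // j.2 <+: l j.1} := fun j =>
      ⟨⟨j.1.1, j.2.choose⟩, by
        obtain ⟨l2, h1, -⟩ := j.2.choose_spec
        exact ⟨_, h1.symm⟩⟩
    have g2 := hsz.reindex τ
    refine ((g1.add g2).add (.const 2)).mono fun j => ?_
    obtain ⟨l2, h1, h2⟩ := j.2.choose_spec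
    have h3 : (ea j.1.1 j.1.2.2).size ≤ (encList (ea j.1.1) (l j.1.1)).size :=
      Data.size_le_of_mem (List.mem_map_of_mem (by rw [h1]; simp))
    simp only [τ, ← h2, Data.size] at h3 ⊢
    omega

/-- A logged fold with trivial state: the log is the result. `map` and `filter` are special cases.
-/
lemma flatMap {f : ∀ i, α i → List (γ i)} (hl : Computes T x fun i => encList (ea i) (l i))
    (hstep : Computes (fun j : {j : Σ i, α i // j.2 ∈ l j.1} => T j.1.1)
      (fun j => .pair (x j.1.1) (ea _ j.1.2)) fun j => encList (ec _) (f _ j.1.2)) :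
    Computes T x fun i => encList (ec i) ((l i).flatMap (f i)) := by
  have key : ∀ i (m : List (α i)),
      (_root_.foldlLog (fun (s : Unit) a => (s, f i a)) () m).2 = m.flatMap (f i) := by
    intro i m
    induction m using List.reverseRecOn with
    | nil => rfl
    | append_singleton m a ih => simp [foldlLog_concat, ih]
  have h := foldlLog (β := fun _ => Unit) (eb := fun _ _ => .atom 0) (ec := ec)
    (b := fun _ => ()) (f := fun i s a => (s, f i a)) hl (const hl.size_left _)
    (PolyBdd.const _) ?_
  · exact h.snd.congr fun i => by simp only [Data.snd, key]
  let κ := {j : Σ i, Unit × α i // ∃ l1 l2, l j.1 = l1 ++ j.2.2 :: l2 ∧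
    j.2.1 = l1.foldl (fun s _ => s) ()}
  change Computes (fun j : κ => T j.1.1) _ _
  have hst := hstep.reindex fun j : κ => ⟨⟨j.1.1, j.1.2.2⟩, by
    obtain ⟨l1, l2, h1, -⟩ := j.2
    simp [h1]⟩
  have hi := id (T := fun j : κ => T j.1.1) (x := fun j => .pair (x j.1.1)
    (.pair (.atom 0) (ea _ j.1.2.2))) ((hst.size_left.add (.const 3)).mono fun j => by
      simp [Data.size]; omega)
  exact hi.snd.fst.pair ((hi.fst.pair hi.snd.snd).comp hst)

lemma map {f : ∀ i, α i → γ i} (hl : Computes T x fun i => encList (ea i) (l i))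
    (hstep : Computes (fun j : {j : Σ i, α i // j.2 ∈ l j.1} => T j.1.1)
      (fun j => .pair (x j.1.1) (ea _ j.1.2)) fun j => ec _ (f _ j.1.2)) :
    Computes T x fun i => encList (ec i) ((l i).map (f i)) := by
  refine (flatMap (ec := ec) (f := fun i a => [f i a]) hl ?_).congr fun i => by
    rw [List.map_eq_flatMap]
  exact cons (l := fun j : {j : Σ i, α i // j.2 ∈ l j.1} => []) hstep (nil hstep.size_left)

lemma filter {p : ∀ i, α i → Bool} (hl : Computes T x fun i => encList (ea i) (l i))
    (hstep : Computes (fun j : {j : Σ i, α i // j.2 ∈ l j.1} => T j.1.1)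
      (fun j => .pair (x j.1.1) (ea _ j.1.2)) fun j => Data.ofBool (p _ j.1.2)) :
    Computes T x fun i => encList (ea i) ((l i).filter (p i)) := by
  refine (flatMap (ec := ea) (f := fun i a => if p i a then [a] else []) hl ?_).congr fun i => by
    congr 2
    induction l i with
    | nil => rfl
    | cons a m ih => 
      rw [List.flatMap_cons, ih]
      by_cases h : p i a <;> simp [h]
  have hi := id hstep.size_left
  have h' : Computes (fun j : {j : Σ i, α i // j.2 ∈ l j.1} => T j.1.1)
      (fun j => .pair (x j.1.1) (ea _ j.1.2)) fun j => if p _ j.1.2 = true then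
        encList (ea j.1.1) [j.1.2] else encList (ea j.1.1) [] := by
    refine ite (hstep.congr fun j => by simp) ?_ ?_
    · exact (cons (l := fun j : {j : Σ i, α i // j.2 ∈ l j.1} => []) hi.snd
        (nil hstep.size_left)).reindex Subtype.val
    · exact (nil (ea := fun j : {j : Σ i, α i // j.2 ∈ l j.1} => ea j.1.1)
        hstep.size_left).reindex Subtype.val
  exact h'.congr fun j => by split_ifs <;> rfl

end Computes

/-! ## Heights of rational numbers -/

/-- The height of a rational number. -/
def ratHeight (q : ℚ) : ℕ := max q.num.natAbs q.den

lemma ratHeight_div_le (a b : ℤ) (hb : b ≠ 0) :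
    ratHeight ((a : ℚ) / b) ≤ max a.natAbs b.natAbs := by
  have h : (a : ℚ) / b = Rat.divInt a b := (Rat.divInt_eq_div a b).symm
  rw [h]
  refine max_le_max ?_ ?_
  · rcases eq_or_ne a 0 with rfl | ha
    · simp
    · exact Nat.le_of_dvd (Int.natAbs_pos.2 ha) (Int.natAbs_dvd_natAbs.2 (Rat.num_dvd a hb))
  · exact Nat.le_of_dvd (Int.natAbs_pos.2 hb)
      (by simpa using Int.natAbs_dvd_natAbs.2 (Rat.den_dvd a b))

lemma ratHeight_mul_le (a b : ℚ) : ratHeight (a * b) ≤ ratHeight a * ratHeight b := by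
  have h : a * b = ((a.num * b.num : ℤ) : ℚ) / ((a.den * b.den : ℤ) : ℚ) := by
    conv_lhs => rw [← Rat.num_div_den a, ← Rat.num_div_den b]
    push_cast
    rw [div_mul_div_comm]
  rw [h]
  refine (ratHeight_div_le _ _ (by positivity)).trans (max_le ?_ ?_)
  · rw [Int.natAbs_mul]; exact Nat.mul_le_mul (le_max_left _ _) (le_max_left _ _)
  · rw [Int.natAbs_mul]; exact Nat.mul_le_mul (le_max_right _ _) (le_max_right _ _)

lemma ratHeight_add_le (a b : ℚ) : ratHeight (a + b) ≤ 2 * (ratHeight a * ratHeight b) := by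
  have h : a + b = ((a.num * b.den + a.den * b.num : ℤ) : ℚ) / ((a.den * b.den : ℤ) : ℚ) := by
    conv_lhs => rw [← Rat.num_div_den a, ← Rat.num_div_den b]
    push_cast
    rw [div_add_div _ _ (by positivity) (by positivity)]
  rw [h]
  have h1 : a.num.natAbs * b.den ≤ ratHeight a * ratHeight b :=
    Nat.mul_le_mul (le_max_left _ _) (le_max_right _ _)
  have h2 : a.den * b.num.natAbs ≤ ratHeight a * ratHeight b :=
    Nat.mul_le_mul (le_max_right _ _) (le_max_left _ _)
  have h3 : a.den * b.den ≤ ratHeight a * ratHeight b :=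
    Nat.mul_le_mul (le_max_right _ _) (le_max_right _ _)
  refine (ratHeight_div_le _ _ (by positivity)).trans (max_le ?_ ?_)
  · refine (Int.natAbs_add_le _ _).trans ?_
    simp only [Int.natAbs_mul, Int.natAbs_natCast]
    omega
  · simp only [Int.natAbs_mul, Int.natAbs_natCast]
    omega

lemma ratHeight_inv_le (a : ℚ) : ratHeight a⁻¹ ≤ ratHeight a := by
  rcases eq_or_ne a 0 with rfl | ha
  · simp
  have h : a⁻¹ = ((a.den : ℤ) : ℚ) / (a.num : ℚ) := by
    conv_lhs => rw [← Rat.num_div_den a]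
    rw [inv_div]; rfl
  rw [h]
  refine (ratHeight_div_le _ _ (by simpa using ha)).trans ?_
  simp [ratHeight, max_comm]

namespace Data

/-- With `ratHeight_lt`, bit length and logarithm of the height bound each other up to constants, so
height estimates for sums and products become size estimates. -/
lemma size_atom_le (q : ℚ) : (atom q).size ≤ 2 * Nat.size (ratHeight q) + 1 := by
  have h1 := Nat.size_le_size (le_max_left q.num.natAbs q.den)
  have h2 := Nat.size_le_size (le_max_right q.num.natAbs q.den)
  simp only [size, ratHeight]
  omega

lemma ratHeight_lt (q : ℚ) : ratHeight q < 2 ^ (atom q).size := by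
  refine max_lt ?_ ?_ <;> rw [← Nat.size_le] <;> simp only [size] <;> omega

lemma size_atom_le_of_ratHeight_lt {q : ℚ} {k : ℕ} (h : ratHeight q < 2 ^ k) :
    (atom q).size ≤ 2 * k + 1 := by
  have := Nat.size_le.2 h
  have := size_atom_le q
  omega

lemma size_atom_mul_le (a b : ℚ) :
    (atom (a * b)).size ≤ 2 * ((atom a).size + (atom b).size) + 1 := by
  refine size_atom_le_of_ratHeight_lt ((ratHeight_mul_le a b).trans_lt ?_)
  rw [pow_add]
  exact Nat.mul_lt_mul'' (ratHeight_lt a) (ratHeight_lt b)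

lemma size_atom_add_le (a b : ℚ) :
    (atom (a + b)).size ≤ 2 * ((atom a).size + (atom b).size + 1) + 1 := by
  refine size_atom_le_of_ratHeight_lt ((ratHeight_add_le a b).trans_lt ?_)
  rw [pow_succ, pow_add]
  have := Nat.mul_lt_mul'' (ratHeight_lt a) (ratHeight_lt b)
  omega

lemma size_atom_inv_le (a : ℚ) : (atom a⁻¹).size ≤ 2 * (atom a).size + 1 :=
  size_atom_le_of_ratHeight_lt ((ratHeight_inv_le a).trans_lt (ratHeight_lt a))

lemma size_ofNat (k : ℕ) : (ofNat k).size = Nat.size k + 2 := by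
  simp [ofNat, size, show Nat.size 1 = 1 from rfl]

lemma ofNat_injective : Function.Injective ofNat := fun a b h => by
  simpa [ofNat] using h

end Data

/-! ### Arithmetic, ranges and list operations in polynomial time. -/

namespace Computes

variable {ι κ : Type} {T : ι → ℕ} {x : ι → Data} {a b : ι → ℚ} {m n : ι → ℕ}

lemma add (ha : Computes T x fun i => .atom (a i)) (hb : Computes T x fun i => .atom (b i)) :
    Computes T x fun i => .atom (a i + b i) :=
  (ha.pair hb).applyOp .add (((((PolyBdd.const 2).mul ((ha.size_right.add hb.size_right).add
    (.const 1))).add (.const 1))).mono fun i => Data.size_atom_add_le (a i) (b i))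

lemma mul (ha : Computes T x fun i => .atom (a i)) (hb : Computes T x fun i => .atom (b i)) :
    Computes T x fun i => .atom (a i * b i) :=
  (ha.pair hb).applyOp .mul (((((PolyBdd.const 2).mul (ha.size_right.add hb.size_right)).add
    (.const 1))).mono fun i => Data.size_atom_mul_le (a i) (b i))

lemma inv (ha : Computes T x fun i => .atom (a i)) : Computes T x fun i => .atom (a i)⁻¹ :=
  (((const ha.size_left (.atom 1)).pair ha).applyOp .div
    ((((PolyBdd.const 2).mul ha.size_right).add (.const 1)).mono fun i => by
      simpa [Op.apply, Data.fst, Data.snd, Data.val] using Data.size_atom_inv_le (a i))).congr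
    fun i => by simp [Op.apply, Data.fst, Data.snd, Data.val]

lemma natAdd (hm : Computes T x fun i => .ofNat (m i)) (hn : Computes T x fun i => .ofNat (n i)) :
    Computes T x fun i => .ofNat (m i + n i) :=
  (hm.add hn).congr fun i => by simp [Data.ofNat]

lemma natMul (hm : Computes T x fun i => .ofNat (m i)) (hn : Computes T x fun i => .ofNat (n i)) :
    Computes T x fun i => .ofNat (m i * n i) :=
  (hm.mul hn).congr fun i => by simp [Data.ofNat]

lemma natLe (hm : Computes T x fun i => .ofNat (m i)) (hn : Computes T x fun i => .ofNat (n i)) :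
    Computes T x fun i => .ofBool (decide (m i ≤ n i)) :=
  (hm.decideLe hn).congr fun i => by simp [Data.ofNat, Data.val]

/-- Equality of encoded values is decided by comparing the encodings. -/
lemma eqEnc {α : ι → Type} [∀ i, DecidableEq (α i)] {e : ∀ i, α i → Data} {u v : ∀ i, α i}
    (he : ∀ i, Function.Injective (e i)) (hu : Computes T x fun i => e i (u i))
    (hv : Computes T x fun i => e i (v i)) :
    Computes T x fun i => .ofBool (decide (u i = v i)) :=
  (hu.decideEq hv).congr fun i => by simp [(he i).eq_iff]

/-- The loop counts down from `n` and prepends, so that the list comes out in increasing order. The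
hypothesis `hT` is needed because `n` may be exponential in its bit length. -/
lemma range (hn : Computes T x fun i => .ofNat (n i)) (hT : PolyBdd T n) :
    Computes T x fun i => encList Data.ofNat (List.range (n i)) := by
  let s : ι → ℕ → Data := fun i j => .pair (.ofNat (n i - j))
    (encList Data.ofNat (List.range' (n i - j) j))
  have hb : PolyBdd (fun j : {p : ι × ℕ // p.2 ≤ n p.1} => T j.1.1)
      fun j => (s j.1.1 j.1.2).size := by
    refine (((hT.add (.const 2)).add ((hT.mul (hT.add (.const 3))).add (.const 3))).reindex
      fun j : {p : ι × ℕ // p.2 ≤ n p.1} => j.1.1).mono fun j => ?_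
    obtain ⟨⟨i, j⟩, hj⟩ := j
    simp only at hj
    have h0 : ∀ k, Nat.size k ≤ k := fun k => Nat.size_le.2 Nat.lt_two_pow_self
    have h1 : (encList Data.ofNat (List.range' (n i - j) j)).size ≤
        ((List.range' (n i - j) j).map Data.ofNat).length * (n i + 2 + 1) + 2 := by
      refine Data.size_ofList_le_of_forall fun a ha => ?_
      obtain ⟨k, hk, rfl⟩ := List.mem_map.1 ha
      rw [List.mem_range'_1] at hk
      have := h0 k
      rw [Data.size_ofNat]
      omega
    have h2 := Nat.mul_le_mul_right (n i + 3) hj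
    rw [show n i + 2 + 1 = n i + 3 from rfl] at h1
    have h3 := h0 (n i - j)
    simp only [List.length_map, List.length_range'] at h1
    simp only [s, Data.size, Data.size_ofNat]
    omega
  have hi := id hb
  have main := whileLoop (T := T) (k := n) (s := s) (test := fun i j => (s i j).fst) hT hi.fst
    (fun i j hj => by simp [s, Data.fst, Data.ofNat, Nat.sub_eq_zero_iff_le]; omega)
    (fun i => by simp [s, Data.fst, Data.ofNat]) ?_
  · refine ((hn.pair (nil hn.size_left)).comp (main.congr fun i => rfl)).snd.congr fun i => ?_
    simp [s, Data.snd, List.range_eq_range']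
  · have hi := id (hb.reindex fun j : {p : ι × ℕ // p.2 < n p.1} => ⟨j.1, j.2.le⟩)
    have h1 : Computes (fun j : {p : ι × ℕ // p.2 < n p.1} => T j.1.1)
        (fun j => s j.1.1 j.1.2) fun j => .ofNat (n j.1.1 - (j.1.2 + 1)) :=
      (add (a := fun j : {p : ι × ℕ // p.2 < n p.1} => ((n j.1.1 - j.1.2 : ℕ) : ℚ)) hi.fst
        (const hi.size_left (.atom (-1)))).congr fun j => by
          have := j.2
          rw [Data.ofNat, Nat.cast_sub (by omega), Nat.cast_sub (by omega)]
          push_cast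
          ring_nf
    refine (h1.pair (h1.pair hi.snd)).congr fun j => ?_
    have := j.2
    simp only [s, Data.snd, List.range'_succ, encList, List.map_cons, Data.ofList]
    rw [show n j.1.1 - (j.1.2 + 1) + 1 = n j.1.1 - j.1.2 by omega]

section lists

variable {α β γ : ι → Type} {ea : ∀ i, α i → Data} {eb : ∀ i, β i → Data} {ec : ∀ i, γ i → Data}
  {l : ∀ i, List (α i)} {l' : ∀ i, List (β i)}

lemma mapIdx {f : ∀ i, ℕ → α i → γ i} (hl : Computes T x fun i => encList (ea i) (l i))
    (hstep : Computes (fun j : {j : Σ i, ℕ × α i // j.2.1 < (l j.1).length ∧ j.2.2 ∈ l j.1} => T j.1.1)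
      (fun j => .pair (x j.1.1) (.pair (.ofNat j.1.2.1) (ea _ j.1.2.2)))
      fun j => ec _ (f _ j.1.2.1 j.1.2.2)) :
    Computes T x fun i => encList (ec i) ((l i).mapIdx (f i)) := by
  have hfst : ∀ i (m : List (α i)), m.foldl (fun (s : ℕ) _ => s + 1) 0 = m.length := by
    intro i m
    induction m using List.reverseRecOn with
    | nil => rfl
    | append_singleton m a ih => simp [ih]
  have key : ∀ i (m : List (α i)),
      _root_.foldlLog (fun (k : ℕ) a => (k + 1, [f i k a])) 0 m = (m.length, m.mapIdx (f i)) := by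
    intro i m
    induction m using List.reverseRecOn with
    | nil => rfl
    | append_singleton m a ih => simp [foldlLog_concat, ih, List.mapIdx_append]
  have h := foldlLog (β := fun _ => ℕ) (eb := fun _ => Data.ofNat) (ec := ec)
    (b := fun _ => 0) (f := fun i k a => (k + 1, [f i k a])) hl (const hl.size_left _) ?_ ?_
  · exact h.snd.congr fun i => by simp only [Data.snd, key]
  · refine ((hl.size_right.add (.const 2)).reindex
      fun j : {j : Σ i, List (α i) // j.2 <+: l j.1} => j.1.1).mono fun j => ?_
    have h1 := Data.length_le_size ((l j.1.1).map (ea j.1.1))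
    have h2 := j.2.length_le
    have h3 : Nat.size j.1.2.length ≤ j.1.2.length := Nat.size_le.2 Nat.lt_two_pow_self
    simp only [hfst, Data.size_ofNat, List.length_map, encList] at h1 ⊢
    omega
  · let κ := {j : Σ i, ℕ × α i // ∃ l1 l2, l j.1 = l1 ++ j.2.2 :: l2 ∧
      j.2.1 = l1.foldl (fun s _ => s + 1) 0}
    change Computes (fun j : κ => T j.1.1) _ _
    have hst := hstep.reindex fun j : κ => ⟨j.1, by
      obtain ⟨l1, l2, h1, h2⟩ := j.2
      rw [hfst j.1.1] at h2
      simp [h1, h2]⟩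
    have hi := id hst.size_left
    have h1 : Computes (fun j : κ => T j.1.1)
        (fun j => .pair (x j.1.1) (.pair (.ofNat j.1.2.1) (ea _ j.1.2.2)))
        fun j => .ofNat (j.1.2.1 + 1) :=
      natAdd (n := fun _ => 1) hi.snd.fst (const hi.size_left (.ofNat 1))
    exact h1.pair (cons hst (nil hst.size_left))

/-- A fold over the first list whose state is the unread rest of the second; equal lengths guarantee
that this rest is never empty when it is read. -/
lemma zip (hl : Computes T x fun i => encList (ea i) (l i))
    (hl' : Computes T x fun i => encList (eb i) (l' i)) (hlen : ∀ i, (l i).length = (l' i).length) :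
    Computes T x fun i => encList (encPair (ea i) (eb i)) ((l i).zip (l' i)) := by
  let f : ∀ i, List (β i) → α i → List (β i) × List Data := fun i r a =>
    (r.tail, (r.take 1).map fun b => .pair (ea i a) (eb i b))
  have key : ∀ i (m : List (α i)) (m' : List (β i)), m.length ≤ m'.length →
      _root_.foldlLog (f i) m' m = (m'.drop m.length, (m.zip m').map (encPair (ea i) (eb i))) := by
    intro i m
    induction m using List.reverseRecOn with
    | nil => intro m' _; simp
    | append_singleton m a ih =>
      intro m' hm
      simp only [List.length_append, List.length_singleton] at hm
      obtain ⟨r, b, r', rfl, hr⟩ : ∃ r b r', m' = r ++ b :: r' ∧ m.length = r.length :=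
        ⟨m'.take m.length, m'[m.length], m'.drop (m.length + 1), by simp, by simp; omega⟩
      rw [foldlLog_concat, ih _ (by simp; omega), List.zip_append hr]
      have h2 : m.zip (r ++ b :: r') = m.zip r := by
        conv_lhs => rw [← List.append_nil m, List.zip_append hr]
        simp
      rw [h2, hr, List.drop_left]
      simp [f, hr]
  have hfst : ∀ i (m : List (α i)) (m' : List (β i)),
      m.foldl (fun s a => (f i s a).1) m' = m'.drop m.length := by
    intro i m
    induction m using List.reverseRecOn with
    | nil => simp
    | append_singleton m a ih => intro m'; simp [ih, f]
  have h := foldlLog (β := fun i => List (β i)) (eb := fun i => encList (eb i))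
    (ec := fun _ => _root_.id) (b := l') (f := f) hl hl' ?_ ?_
  · exact h.snd.congr fun i => by simp only [Data.snd, key _ _ _ (hlen i).le, encList, List.map_id_fun, _root_.id]
  · refine (hl'.size_right.reindex
      fun j : {j : Σ i, List (α i) // j.2 <+: l j.1} => j.1.1).mono fun j => ?_
    rw [hfst]
    exact Data.size_ofList_le_of_sublist ((List.drop_sublist _ _).map _)
  · let κ := {j : Σ i, List (β i) × α i // ∃ l1 l2, l j.1 = l1 ++ j.2.2 :: l2 ∧
      j.2.1 = l1.foldl (fun s a => (f _ s a).1) (l' j.1)}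
    change Computes (fun j : κ => T j.1.1) _ _
    have hne : ∀ j : κ, j.1.2.1 ≠ [] := by
      rintro ⟨⟨i, r, a⟩, l1, l2, h1, h2⟩
      simp only at h1 h2
      rw [hfst] at h2
      intro h
      have h3 := hlen i
      have h4 := List.drop_eq_nil_iff.1 (h2.symm.trans h)
      rw [h1] at h3
      simp at h3
      omega
    have hi := id (T := fun j : κ => T j.1.1)
      (x := fun j => .pair (x j.1.1) (.pair (encList (eb _) j.1.2.1) (ea _ j.1.2.2))) ?_
    · have htail : Computes (fun j : κ => T j.1.1)
        (fun j => .pair (x j.1.1) (.pair (encList (eb _) j.1.2.1) (ea _ j.1.2.2)))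
        fun j => encList (eb _) j.1.2.1.tail := hi.snd.fst.snd.congr fun j => by
          obtain ⟨b, r, h⟩ := List.exists_cons_of_ne_nil (hne j)
          simp [h, Data.fst, Data.snd, encList, Data.ofList]
      refine htail.pair (((hi.snd.snd.pair hi.snd.fst.fst).pair
        (const hi.size_left (.atom 0))).congr fun j => ?_)
      obtain ⟨b, r, h⟩ := List.exists_cons_of_ne_nil (hne j)
      simp [f, h, Data.fst, Data.snd, encList, Data.ofList]
    · refine ((((hl.size_right.add hl'.size_right).add hl.size_left).add (.const 2)).reindex
        fun j : κ => j.1.1).mono fun j => ?_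
      obtain ⟨⟨i, r, a⟩, l1, l2, h1, h2⟩ := j
      simp only at h1 h2
      have h3 := Data.size_ofList_le_of_sublist ((List.drop_sublist l1.length (l' i)).map (eb i))
      have h4 : (ea i a).size ≤ (encList (ea i) (l i)).size :=
        Data.size_le_of_mem (List.mem_map_of_mem (by rw [h1]; simp))
      rw [hfst] at h2
      simp only [h2, Data.size, encList] at h3 h4 ⊢
      omega

lemma isNil (hl : Computes T x fun i => encList (ea i) (l i)) :
    Computes T x fun i => .ofBool (l i).isEmpty :=
  hl.isAtom.congr fun i => by cases l i <;> rfl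

end lists

section natLists

variable {l l' : ι → List ℕ}

lemma natSum (hl : Computes T x fun i => encList Data.ofNat (l i)) :
    Computes T x fun i => .ofNat (l i).sum := by
  -- The bit length of a sum is at most the size of the encoded list, which keeps the partial sums
  -- of the fold small.
  have key : ∀ m : List ℕ, m.sum < 2 ^ (encList Data.ofNat m).size := by
    intro m
    induction m with
    | nil => simp
    | cons a m ih =>
      have h1 : a < 2 ^ Nat.size a := Nat.lt_size_self a
      simp only [encList, List.map_cons, Data.ofList, Data.size, Data.size_ofNat, List.sum_cons] at ih ⊢
      have h2 : 2 ^ (Nat.size a + 2 + (Data.ofList (m.map Data.ofNat)).size + 1) =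
        8 * (2 ^ Nat.size a * 2 ^ (Data.ofList (m.map Data.ofNat)).size) := by
        rw [show (8 : ℕ) = 2 ^ 3 from rfl, ← pow_add, ← pow_add]
        congr 1
        omega
      rw [h2]
      have h3 := Nat.le_mul_of_pos_right (2 ^ Nat.size a)
        (Nat.two_pow_pos (Data.ofList (m.map Data.ofNat)).size)
      have h4 := Nat.le_mul_of_pos_left (2 ^ (Data.ofList (m.map Data.ofNat)).size)
        (Nat.two_pow_pos (Nat.size a))
      omega
  have h := foldl (α := fun _ => ℕ) (β := fun _ => ℕ) (ea := fun _ => Data.ofNat)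
    (eb := fun _ => Data.ofNat) (b := fun _ => 0) (f := fun _ s a => s + a) hl
    (const hl.size_left _) ?_ ?_
  · exact h.congr fun i => by rw [List.sum_eq_foldl]
  · refine ((hl.size_right.add (.const 2)).reindex
      fun j : {j : Σ i, List ℕ // j.2 <+: l j.1} => j.1.1).mono fun j => ?_
    have h1 := Data.size_ofList_le_of_sublist (j.2.sublist.map Data.ofNat)
    have h2 := Nat.size_le.2 (key j.1.2)
    rw [List.sum_eq_foldl] at h2
    rw [Data.size_ofNat]
    simp only [encList] at h2 ⊢
    omega
  · let κ := {j : Σ _ : ι, ℕ × ℕ // ∃ l1 l2, l j.1 = l1 ++ j.2.2 :: l2 ∧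
      j.2.1 = l1.foldl (fun s a => s + a) 0}
    change Computes (fun j : κ => T j.1.1) _ _
    have hi := id (T := fun j : κ => T j.1.1)
      (x := fun j => .pair (x j.1.1) (.pair (.ofNat j.1.2.1) (.ofNat j.1.2.2))) ?_
    · exact natAdd (m := fun j : κ => j.1.2.1) hi.snd.fst hi.snd.snd
    · refine (((hl.size_left.add ((PolyBdd.const 2).mul hl.size_right)).add (.const 4)).reindex
        fun j : κ => j.1.1).mono fun j => ?_
      obtain ⟨⟨i, s, a⟩, l1, l2, h1, h2⟩ := j
      simp only at h1 h2
      have h3 : (Data.ofNat a).size ≤ (encList Data.ofNat (l i)).size :=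
        Data.size_le_of_mem (List.mem_map_of_mem (by rw [h1]; simp))
      have h4 := Nat.size_le.2 (key l1)
      have h5 := Data.size_ofList_le_of_sublist
        (((List.prefix_append l1 (a :: l2)).sublist).map Data.ofNat)
      rw [List.sum_eq_foldl, ← h2] at h4
      rw [← h1] at h5
      simp only [Data.size, Data.size_ofNat, encList] at h3 h4 h5 ⊢
      omega

end natLists

end Computes

/-- Lexicographic comparison through the first difference. -/
def listLexLt (l l' : List ℕ) : Bool :=
  match (l.zip l').filter (fun p => decide (p.1 ≠ p.2)) with
  | [] => false
  | p :: _ => decide (p.1 < p.2)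

namespace Computes

variable {ι : Type} {T : ι → ℕ} {x : ι → Data} {l l' : ι → List ℕ}

lemma zipFilter {p : ℕ × ℕ → Bool} (hl : Computes T x fun i => encList Data.ofNat (l i))
    (hl' : Computes T x fun i => encList Data.ofNat (l' i)) (hlen : ∀ i, (l i).length = (l' i).length)
    (hp : ∀ {κ : Type} {T : κ → ℕ} {x : κ → Data} {m n : κ → ℕ},
      Computes T x (fun i => .ofNat (m i)) → Computes T x (fun i => .ofNat (n i)) →
        Computes T x fun i => .ofBool (p (m i, n i))) :
    Computes T x fun i => encList (encPair Data.ofNat Data.ofNat) (((l i).zip (l' i)).filter p) := by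
  have hz := zip (ea := fun _ => Data.ofNat) (eb := fun _ => Data.ofNat) hl hl' hlen
  refine filter (α := fun _ => ℕ × ℕ) (ea := fun _ => encPair Data.ofNat Data.ofNat)
    (p := fun _ => p) hz ?_
  let κ := {j : Σ _ : ι, ℕ × ℕ // j.2 ∈ (l j.1).zip (l' j.1)}
  change Computes (fun j : κ => T j.1.1) _ _
  have hi := id (T := fun j : κ => T j.1.1)
      (x := fun j => .pair (x j.1.1) (encPair Data.ofNat Data.ofNat j.1.2)) ?_
  · exact hp (m := fun j : κ => j.1.2.1) (n := fun j : κ => j.1.2.2) hi.snd.fst hi.snd.snd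
  · refine (((hl.size_left.add hz.size_right).add (.const 1)).reindex
      fun j : κ => j.1.1).mono fun j => ?_
    have h3 : (encPair Data.ofNat Data.ofNat j.1.2).size ≤
      (encList (encPair Data.ofNat Data.ofNat) ((l j.1.1).zip (l' j.1.1))).size :=
        Data.size_le_of_mem (List.mem_map_of_mem j.2)
    simp only [Data.size] at h3 ⊢
    omega

lemma lexLt (hl : Computes T x fun i => encList Data.ofNat (l i))
    (hl' : Computes T x fun i => encList Data.ofNat (l' i)) (hlen : ∀ i, (l i).length = (l' i).length) :
    Computes T x fun i => .ofBool (listLexLt (l i) (l' i)) := by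
  have h := zipFilter (p := fun p => decide (p.1 ≠ p.2)) hl hl' hlen fun hm hn =>
    (eqEnc (e := fun _ => Data.ofNat) (fun _ => Data.ofNat_injective) hm hn).not.congr
      fun i => by simp
  -- The first remaining pair is the first difference. If there is none, both components read as the
  -- default 0, and the negated test `0 ≤ 0` correctly gives false.
  refine (h.fst.snd.decideLe h.fst.fst).not.congr fun i => ?_
  unfold listLexLt
  cases ((l i).zip (l' i)).filter (fun p => decide (p.1 ≠ p.2)) with
  | nil => simp [encList, Data.ofList, Data.fst, Data.snd, Data.val]
  | cons p t => simp [encList, Data.ofList, Data.fst, Data.snd, Data.val, Data.ofNat,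
      ← decide_not]

lemma listLe (hl : Computes T x fun i => encList Data.ofNat (l i))
    (hl' : Computes T x fun i => encList Data.ofNat (l' i)) (hlen : ∀ i, (l i).length = (l' i).length) :
    Computes T x fun i => .ofBool (decide (∀ p ∈ (l i).zip (l' i), p.1 ≤ p.2)) := by
  have h := zipFilter (p := fun p => !decide (p.1 ≤ p.2)) hl hl' hlen fun hm hn =>
    (natLe hm hn).not
  refine (isNil (ea := fun _ => encPair Data.ofNat Data.ofNat) h).congr fun i => ?_
  congr 1
  rw [Bool.eq_iff_iff]
  simp

end Computes

open MvPolynomial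
open Finsupp (single)
open MonomialOrder (degLex)
open scoped MonomialOrder

/-! ## Encodings of exponent vectors and polynomials -/

/-- The encoding of an exponent vector. -/
def encExp {n : ℕ} (α : Fin n →₀ ℕ) : Data := encList Data.ofNat (List.ofFn α)

/-- The encoding of the term of `p` with exponent `α`. -/
noncomputable def encTerm {n : ℕ} (p : MvPolynomial (Fin n) ℚ) (α : Fin n →₀ ℕ) : Data :=
  .pair (.atom (p.coeff α)) (encExp α)

/-- The encoding of a variable. -/
def encVar {n : ℕ} (i : Fin n) : Data := .ofNat i

section encodings

variable {n : ℕ}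

lemma encExp_injective : Function.Injective (encExp (n := n)) := fun a b h => by
  have h1 := List.map_injective_iff.2 Data.ofNat_injective (Data.ofList_injective h)
  exact DFunLike.coe_injective (List.ofFn_injective h1)

lemma encodePoly_eq (p : MvPolynomial (Fin n) ℚ) :
    encodePoly p = encList (encTerm p) (sortedSupport p) := by
  simp only [encodePoly, encList]
  congr 1
  refine List.map_congr_left fun α _ => ?_
  simp only [encTerm, encExp, encList, List.map_ofFn]
  rfl

lemma pairwise_sortedSupport (p : MvPolynomial (Fin n) ℚ) :
    (sortedSupport p).Pairwise fun a b => b ≺[degLex] a := by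
  rw [sortedSupport, List.pairwise_map]
  refine (Finset.sortedGT_sort _).pairwise.imp fun h => ?_
  simpa using h

lemma nodup_sortedSupport (p : MvPolynomial (Fin n) ℚ) : (sortedSupport p).Nodup :=
  (pairwise_sortedSupport p).imp fun h e => by simp [e] at h

@[simp] lemma mem_sortedSupport {p : MvPolynomial (Fin n) ℚ} {α : Fin n →₀ ℕ} :
    α ∈ sortedSupport p ↔ p.coeff α ≠ 0 := by
  simp only [sortedSupport, List.mem_map, Finset.mem_sort, Finset.mem_map, mem_support_iff]
  constructor
  · rintro ⟨_, ⟨β, hβ, rfl⟩, rfl⟩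
    simpa using hβ
  · intro h
    exact ⟨_, ⟨α, h, rfl⟩, by simp⟩

/-- A strictly decreasing list is determined by its members. This identifies the term lists produced
by the arithmetic programs with the canonical encodings. -/
lemma sortedSupport_eq {p : MvPolynomial (Fin n) ℚ} {l : List (Fin n →₀ ℕ)}
    (hl : l.Pairwise fun a b => b ≺[degLex] a) (hm : ∀ α, α ∈ l ↔ p.coeff α ≠ 0) :
    sortedSupport p = l := by
  have hn : l.Nodup := hl.imp fun h e => by simp [e] at h
  refine List.Perm.eq_of_pairwise (le := fun a b => b ≺[degLex] a)
    (fun a b _ _ h1 h2 => absurd (h1.trans h2) (lt_irrefl _)) (pairwise_sortedSupport p) hl ?_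
  rw [List.perm_ext_iff_of_nodup (nodup_sortedSupport p) hn]
  intro α
  rw [hm, mem_sortedSupport]

lemma sortedSupport_toFinset (p : MvPolynomial (Fin n) ℚ) :
    (sortedSupport p).toFinset = p.support := by
  ext α; simp

@[simp] lemma sortedSupport_eq_nil {p : MvPolynomial (Fin n) ℚ} : sortedSupport p = [] ↔ p = 0 := by
  rw [← List.toFinset_eq_empty_iff, sortedSupport_toFinset, MvPolynomial.support_eq_empty]

lemma encodePoly_injective : Function.Injective (encodePoly (n := n)) := fun p q h => by
  rw [encodePoly_eq, encodePoly_eq] at h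
  have h1 := Data.ofList_injective h
  have h2 : sortedSupport p = sortedSupport q := by
    have h3 := congrArg (List.map Data.snd) h1
    simp only [List.map_map] at h3
    exact List.map_injective_iff.2 encExp_injective h3
  rw [← h2] at h1
  ext α
  by_cases hα : α ∈ sortedSupport p
  · have := (List.map_inj_left.1 h1) α hα
    simp only [encTerm, Data.pair.injEq, Data.atom.injEq] at this
    exact this.1
  · have hα' := hα
    rw [h2] at hα'
    rw [mem_sortedSupport, not_not] at hα hα'
    rw [hα, hα']

/-- The leading term comes first. -/
lemma sortedSupport_eq_cons {p : MvPolynomial (Fin n) ℚ} (hp : p ≠ 0) :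
    ∃ l, sortedSupport p = degLex.degree p :: l := by
  obtain ⟨a, l, h⟩ := List.exists_cons_of_ne_nil (mt sortedSupport_eq_nil.1 hp)
  refine ⟨l, ?_⟩
  have hpw := pairwise_sortedSupport p
  rw [h, List.pairwise_cons] at hpw
  have hm : degLex.degree p ∈ sortedSupport p := by
    rw [mem_sortedSupport]
    exact MonomialOrder.coeff_degree_ne_zero_iff.2 hp
  have ha : a ∈ p.support := by
    rw [MvPolynomial.mem_support_iff, ← mem_sortedSupport, h]; simp
  rw [h] at hm
  rcases List.mem_cons.1 hm with h1 | h1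
  · rw [h, h1]
  · exact absurd (hpw.1 _ h1) (not_lt.2 (MonomialOrder.le_degree ha))

/-- The bit length of a term. -/
noncomputable def termSize (p : MvPolynomial (Fin n) ℚ) (α : Fin n →₀ ℕ) : ℕ :=
  (encTerm p α).size

lemma termSize_eq (p : MvPolynomial (Fin n) ℚ) (α : Fin n →₀ ℕ) :
    termSize p α = (Data.atom (p.coeff α)).size + (encExp α).size + 1 := rfl

lemma size_encodePoly (p : MvPolynomial (Fin n) ℚ) :
    (encodePoly p).size = ∑ α ∈ p.support, (termSize p α + 1) + 2 := by
  rw [encodePoly_eq, Data.size_ofList, List.map_map, ← sortedSupport_toFinset,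
    List.sum_toFinset _ (nodup_sortedSupport p)]
  rfl

lemma termSize_le_size {p : MvPolynomial (Fin n) ℚ} {α : Fin n →₀ ℕ} (h : α ∈ p.support) :
    termSize p α ≤ (encodePoly p).size := by
  rw [size_encodePoly]
  have := Finset.single_le_sum (f := fun α => termSize p α + 1) (fun _ _ => Nat.zero_le _) h
  omega

lemma card_support_le_size (p : MvPolynomial (Fin n) ℚ) :
    p.support.card ≤ (encodePoly p).size := by
  rw [size_encodePoly, Finset.card_eq_sum_ones]
  have := Finset.sum_le_sum (s := p.support) (f := fun _ => 1) (g := fun α => termSize p α + 1)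
    fun _ _ => by omega
  omega

/-- A bound for the size of a polynomial from bounds for its terms. -/
lemma size_encodePoly_le_of {p : MvPolynomial (Fin n) ℚ} {a b e : ℕ} (ha : p.support.card ≤ a)
    (hb : ∀ α ∈ p.support, (Data.atom (p.coeff α)).size ≤ b)
    (he : ∀ α ∈ p.support, (encExp α).size ≤ e) : (encodePoly p).size ≤ a * (b + e + 2) + 2 := by
  rw [size_encodePoly]
  have h : ∑ α ∈ p.support, (termSize p α + 1) ≤ ∑ α ∈ p.support, (b + e + 2) :=
    Finset.sum_le_sum fun α hα => by
      have := hb α hα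
      have := he α hα
      rw [termSize_eq]
      omega
  rw [Finset.sum_const, smul_eq_mul] at h
  have := Nat.mul_le_mul_right (b + e + 2) ha
  omega

lemma size_encodePoly_add_le (p q : MvPolynomial (Fin n) ℚ) :
    (encodePoly (p + q)).size ≤ 12 * ((encodePoly p).size + (encodePoly q).size) := by
  classical
  have h0 : (Data.atom 0).size = 2 := by simp [Data.size]
  -- A monomial missing from one summand has coefficient 0 there, of size 2; the factor 12 absorbs
  -- this and the constants of rational addition.
  have key : ∀ α, (if α ∈ (p + q).support then termSize (p + q) α + 1 else 0) ≤
      12 * ((if α ∈ p.support then termSize p α + 1 else 0) +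
        if α ∈ q.support then termSize q α + 1 else 0) := by
    intro α
    split_ifs with h1 h2 h3 h3 <;> try omega
    · have := Data.size_atom_add_le (p.coeff α) (q.coeff α)
      simp only [termSize_eq, coeff_add]
      omega
    · have := Data.size_atom_add_le (p.coeff α) (q.coeff α)
      rw [notMem_support_iff] at h3
      simp only [termSize_eq, coeff_add, h3, h0] at this ⊢
      omega
    · have := Data.size_atom_add_le (p.coeff α) (q.coeff α)
      rw [notMem_support_iff] at h2
      simp only [termSize_eq, coeff_add, h2, h0] at this ⊢
      omega
    · exact absurd (support_add h1) (by simp only [Finset.mem_union]; tauto)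
  have h1 := Finset.sum_le_sum (s := p.support ∪ q.support) fun α _ => key α
  have h2 : ∀ r : MvPolynomial (Fin n) ℚ, r.support ⊆ p.support ∪ q.support →
      ∑ α ∈ p.support ∪ q.support, (if α ∈ r.support then termSize r α + 1 else 0) =
        ∑ α ∈ r.support, (termSize r α + 1) := fun r hr => by
    rw [← Finset.sum_filter]
    congr 1
    ext α
    simp only [Finset.mem_filter]
    exact ⟨fun h => h.2, fun h => ⟨hr h, h⟩⟩
  rw [← Finset.mul_sum, Finset.sum_add_distrib, h2 _ support_add, h2 _ Finset.subset_union_left,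
    h2 _ Finset.subset_union_right] at h1
  simp only [size_encodePoly]
  omega

lemma size_encodePoly_C_mul_le (a : ℚ) (p : MvPolynomial (Fin n) ℚ) :
    (encodePoly (C a * p)).size ≤ (2 * (Data.atom a).size + 4) * (encodePoly p).size := by
  have hs : (C a * p).support ⊆ p.support := fun α => by
    simp only [mem_support_iff, coeff_C_mul]
    exact fun h => right_ne_zero_of_mul h
  have h : ∑ α ∈ (C a * p).support, (termSize (C a * p) α + 1) ≤
      ∑ α ∈ p.support, (2 * (Data.atom a).size + 4) * (termSize p α + 1) := by
    refine (Finset.sum_le_sum fun α _ => ?_).trans (Finset.sum_le_sum_of_subset hs)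
    have := Data.size_atom_mul_le a (p.coeff α)
    simp only [termSize_eq, coeff_C_mul]
    nlinarith
  rw [← Finset.mul_sum] at h
  simp only [size_encodePoly]
  nlinarith

lemma size_encExp_add_single_le (α : Fin n →₀ ℕ) (i : Fin n) :
    (encExp (single i 1 + α)).size ≤ 2 * (encExp α).size := by
  have key : ∀ j, (Data.ofNat ((single i 1 + α : Fin n →₀ ℕ) j)).size + 1 ≤ 2 * ((Data.ofNat (α j)).size + 1) := by
    intro j
    have h1 : (single i 1 + α : Fin n →₀ ℕ) j ≤ α j + 1 := by
      simp only [Finsupp.add_apply, Finsupp.single_apply]; split_ifs <;> omega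
    have h2 : Nat.size (α j + 1) ≤ Nat.size (α j) + 1 := by
      rw [Nat.size_le, pow_succ]
      have := Nat.lt_size_self (α j)
      omega
    have := Nat.size_le_size h1
    simp only [Data.size_ofNat]
    omega
  simp only [encExp, encList, Data.size_ofList, List.map_ofFn, List.sum_ofFn]
  have := Finset.sum_le_sum (s := Finset.univ) fun j _ => key j
  rw [← Finset.mul_sum] at this
  simp only [Function.comp_apply]
  omega

lemma support_X_mul_eq (p : MvPolynomial (Fin n) ℚ) (i : Fin n) :
    (X i * p).support = p.support.map (addLeftEmbedding (single i 1)) :=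
  MvPolynomial.support_X_mul i p

lemma size_encodePoly_X_mul_le (i : Fin n) (p : MvPolynomial (Fin n) ℚ) :
    (encodePoly (X i * p)).size ≤ 2 * (encodePoly p).size := by
  simp only [size_encodePoly]
  rw [support_X_mul_eq, Finset.sum_map]
  have h : ∑ α ∈ p.support, (termSize (X i * p) (addLeftEmbedding (single i 1) α) + 1) ≤
      ∑ α ∈ p.support, 2 * (termSize p α + 1) := Finset.sum_le_sum fun α _ => by
    have := size_encExp_add_single_le α i
    simp only [termSize_eq, addLeftEmbedding_apply, coeff_X_mul]
    omega
  rw [← Finset.mul_sum] at h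
  omega

/-- Multiplication by a fixed polynomial in a few variables increases sizes by a constant factor. -/
lemma exists_size_encodePoly_rename_mul_le {k : ℕ} (f : MvPolynomial (Fin k) ℚ) :
    ∃ c, ∀ (n : ℕ) (v : Fin k → Fin n) (p : MvPolynomial (Fin n) ℚ),
      (encodePoly (rename v f * p)).size ≤ c * (encodePoly p).size := by
  induction f using MvPolynomial.induction_on with
  | C a => exact ⟨_, fun n v p => by rw [rename_C]; exact size_encodePoly_C_mul_le a p⟩
  | add f g hf hg =>
    obtain ⟨c, hc⟩ := hf
    obtain ⟨c', hc'⟩ := hg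
    refine ⟨12 * (c + c'), fun n v p => ?_⟩
    rw [map_add, add_mul]
    have := size_encodePoly_add_le (rename v f * p) (rename v g * p)
    have := hc n v p
    have := hc' n v p
    nlinarith
  | mul_X f j hf =>
    obtain ⟨c, hc⟩ := hf
    refine ⟨2 * c, fun n v p => ?_⟩
    rw [map_mul, rename_X, mul_comm _ (X _), mul_assoc]
    have := size_encodePoly_X_mul_le (v j) (rename v f * p)
    have := hc n v p
    nlinarith

/-! ### The effect of the arithmetic operations on sorted supports -/

/-- The degree followed by the exponents. -/
def degList (α : Fin n →₀ ℕ) : List ℕ := (List.ofFn α).sum :: List.ofFn α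

lemma listLexLt_cons (a b : ℕ) (l l' : List ℕ) :
    listLexLt (a :: l) (b :: l') = true ↔ a < b ∨ a = b ∧ listLexLt l l' = true := by
  by_cases h : a = b
  · simp [listLexLt, h]
  · simp [listLexLt, h]

lemma listLexLt_ofFn {m : ℕ} (f g : Fin m → ℕ) :
    listLexLt (List.ofFn f) (List.ofFn g) = true ↔ ∃ i, (∀ j < i, f j = g j) ∧ f i < g i := by
  induction m with
  | zero => simp [listLexLt]
  | succ m ih =>
    rw [List.ofFn_succ, List.ofFn_succ, listLexLt_cons, ih, Fin.exists_fin_succ]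
    simp only [Fin.not_lt_zero, IsEmpty.forall_iff, implies_true, true_and, Fin.forall_fin_succ,
      Fin.succ_pos, forall_const, Fin.succ_lt_succ_iff]
    constructor
    · rintro (h | ⟨h, i, h1, h2⟩)
      · exact Or.inl h
      · exact Or.inr ⟨i, ⟨h, h1⟩, h2⟩
    · rintro (h | ⟨i, ⟨h, h1⟩, h2⟩)
      · exact Or.inl h
      · exact Or.inr ⟨h, i, h1, h2⟩

/-- The graded order compares total degrees first and breaks ties lexicographically, so prepending
the degree turns it into a lexicographic order. -/
lemma listLexLt_degList (α β : Fin n →₀ ℕ) :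
    listLexLt (degList α) (degList β) = true ↔ α ≺[degLex] β := by
  rw [degList, degList, listLexLt_cons, listLexLt_ofFn, MonomialOrder.degLex_lt_iff,
    Finsupp.DegLex.lt_iff]
  simp only [List.sum_ofFn, ofDegLex_toDegLex, Finsupp.degree_eq_sum, Finsupp.Lex.lt_iff, ofLex_toLex]

/-- The insertion step of polynomial addition: larger monomials, then `α` unless its coefficient
cancels, then smaller monomials. -/
lemma sortedSupport_add_monomial (p : MvPolynomial (Fin n) ℚ) (α : Fin n →₀ ℕ) (c : ℚ) :
    sortedSupport (p + monomial α c) =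
      (sortedSupport p).filter (fun β => listLexLt (degList α) (degList β)) ++
      ((if p.coeff α + c = 0 then [] else [α]) ++
        (sortedSupport p).filter fun β => listLexLt (degList β) (degList α)) := by
  refine sortedSupport_eq ?_ fun β => ?_
  · have h := pairwise_sortedSupport p
    refine List.pairwise_append.2 ⟨h.filter _, List.pairwise_append.2 ⟨?_, h.filter _, ?_⟩, ?_⟩
    · split_ifs <;> simp
    · intro β hβ γ hγ
      rw [List.mem_filter, listLexLt_degList] at hγ
      split_ifs at hβ with h0
      · simp at hβ
      · rw [List.mem_singleton.1 hβ]; exact hγ.2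
    · intro β hβ γ hγ
      rw [List.mem_filter, listLexLt_degList] at hβ
      rcases List.mem_append.1 hγ with hγ | hγ
      · split_ifs at hγ with h0
        · simp at hγ
        · rw [List.mem_singleton.1 hγ]; exact hβ.2
      · rw [List.mem_filter, listLexLt_degList] at hγ
        exact hγ.2.trans hβ.2
  · rw [List.mem_append, List.mem_append, List.mem_filter, List.mem_filter, listLexLt_degList,
      listLexLt_degList, mem_sortedSupport, coeff_add, coeff_monomial]
    rcases eq_or_ne α β with rfl | hne
    · by_cases h0 : p.coeff α + c = 0 <;> simp [h0]
    · have h1 : α ≺[degLex] β ∨ β ≺[degLex] α :=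
        lt_or_gt_of_ne fun h => hne (degLex.toSyn.injective h)
      have h2 : β ∉ (if p.coeff α + c = 0 then [] else [α]) := by
        split_ifs <;> simp [hne.symm]
      simp only [hne, if_false, add_zero, h2, false_or]
      tauto

lemma sortedSupport_C_mul (p : MvPolynomial (Fin n) ℚ) {a : ℚ} (ha : a ≠ 0) :
    sortedSupport (C a * p) = sortedSupport p :=
  sortedSupport_eq (pairwise_sortedSupport p) fun α => by simp [ha]

lemma sortedSupport_X_mul (p : MvPolynomial (Fin n) ℚ) (i : Fin n) :
    sortedSupport (X i * p) = (sortedSupport p).map fun α => single i 1 + α := by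
  refine sortedSupport_eq (List.pairwise_map.2 ((pairwise_sortedSupport p).imp fun h => ?_))
    fun α => ?_
  · simpa using h
  · rw [← mem_support_iff, support_X_mul_eq]
    simp

lemma eq_foldl_add_monomial (p q : MvPolynomial (Fin n) ℚ) :
    p + q = (sortedSupport q).foldl (fun r α => r + monomial α (q.coeff α)) p := by
  have h : ∀ (l : List (Fin n →₀ ℕ)) (p : MvPolynomial (Fin n) ℚ),
      l.foldl (fun r α => r + monomial α (q.coeff α)) p =
        p + (l.map fun α => monomial α (q.coeff α)).sum := by
    intro l
    induction l with
    | nil => simp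
    | cons a l ih => intro p; simp [ih, add_assoc]
  rw [h, ← List.sum_toFinset _ (nodup_sortedSupport q), sortedSupport_toFinset, ← q.as_sum]

lemma coeff_foldl_add_monomial (p q : MvPolynomial (Fin n) ℚ) (l : List (Fin n →₀ ℕ))
    (hl : l.Nodup) (β : Fin n →₀ ℕ) :
    coeff β (l.foldl (fun r α => r + monomial α (q.coeff α)) p) =
      p.coeff β + if β ∈ l then q.coeff β else 0 := by
  induction l using List.reverseRecOn with
  | nil => simp
  | append_singleton l a ih =>
    have hl' := (List.nodup_append.1 hl)
    rw [List.foldl_append, List.foldl_cons, List.foldl_nil, coeff_add, ih hl'.1, coeff_monomial]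
    rcases eq_or_ne a β with rfl | h
    · have : a ∉ l := fun h => hl'.2.2 a h a (by simp) rfl
      simp [this]
    · simp [h, h.symm]

/-- The partial sums of the addition loop are `p` plus a truncation of `q`, so their size does not
compound with the number of insertions. -/
lemma size_foldl_add_monomial_le (p q : MvPolynomial (Fin n) ℚ) {l : List (Fin n →₀ ℕ)}
    (hl : l <+: sortedSupport q) :
    (encodePoly (l.foldl (fun r α => r + monomial α (q.coeff α)) p)).size ≤
      12 * ((encodePoly p).size + (encodePoly q).size) := by
  set r : MvPolynomial (Fin n) ℚ := ∑ α ∈ l.toFinset, monomial α (q.coeff α)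
  have hn : l.Nodup := (nodup_sortedSupport q).sublist hl.sublist
  have hr : ∀ β, r.coeff β = if β ∈ l then q.coeff β else 0 := fun β => by
    classical
    simp [r, coeff_sum, coeff_monomial]
  have h : l.foldl (fun r α => r + monomial α (q.coeff α)) p = p + r := by
    ext β
    rw [coeff_foldl_add_monomial p q l hn, coeff_add, hr]
  rw [h]
  refine (size_encodePoly_add_le p r).trans ?_
  have hs : r.support ⊆ q.support := fun β hβ => by
    rw [mem_support_iff, hr] at hβ
    rw [mem_support_iff]
    split_ifs at hβ with h1
    · exact hβ
    · exact absurd rfl hβ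
  have : (encodePoly r).size ≤ (encodePoly q).size := by
    simp only [size_encodePoly]
    refine Nat.add_le_add_right ((Finset.sum_le_sum fun β hβ => ?_).trans
      (Finset.sum_le_sum_of_subset hs)) 2
    rw [mem_support_iff, hr] at hβ
    split_ifs at hβ with h1
    · simp only [termSize_eq, hr, if_pos h1]; exact le_rfl
    · exact absurd rfl hβ
  omega

end encodings

/-! ## Computing with polynomials -/

namespace Computes

variable {ι κ : Type} {T : ι → ℕ} {x y : ι → Data}

section steps

variable {α β : ι → Type} {ea : ∀ i, α i → Data} {eb : ∀ i, β i → Data}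
  {l : ∀ i, List (α i)} {b : ∀ i, β i} {f : ∀ i, β i → α i → β i}

/-- In the body of a `map`, `filter` or `flatMap` the data is the outer context paired with the
current element: `memVal` reads the element and `memCtx` lifts a computation from the outer context.
`foldId` and `foldCtx` play the same role for folds. -/
lemma memId (hl : Computes T x fun i => encList (ea i) (l i)) :
    Computes (fun j : {j : Σ i, α i // j.2 ∈ l j.1} => T j.1.1)
      (fun j => .pair (x j.1.1) (ea _ j.1.2)) fun j => .pair (x j.1.1) (ea _ j.1.2) := by
  refine id ((((hl.size_left.add hl.size_right).add (.const 1)).reindex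
    fun j : {j : Σ i, α i // j.2 ∈ l j.1} => j.1.1).mono fun j => ?_)
  have : (ea j.1.1 j.1.2).size ≤ (encList (ea j.1.1) (l j.1.1)).size :=
    Data.size_le_of_mem (List.mem_map_of_mem j.2)
  simp only [Data.size]
  omega

lemma memVal (hl : Computes T x fun i => encList (ea i) (l i)) :
    Computes (fun j : {j : Σ i, α i // j.2 ∈ l j.1} => T j.1.1)
      (fun j => .pair (x j.1.1) (ea _ j.1.2)) fun j => ea _ j.1.2 :=
  (memId hl).snd

lemma memCtx (hl : Computes T x fun i => encList (ea i) (l i)) (h : Computes T x y) :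
    Computes (fun j : {j : Σ i, α i // j.2 ∈ l j.1} => T j.1.1)
      (fun j => .pair (x j.1.1) (ea _ j.1.2)) fun j => y j.1.1 :=
  (memId hl).fst.comp (h.reindex fun j : {j : Σ i, α i // j.2 ∈ l j.1} => j.1.1)

lemma foldId (hl : Computes T x fun i => encList (ea i) (l i))
    (hsize : PolyBdd (fun j : {j : Σ i, List (α i) // j.2 <+: l j.1} => T j.1.1)
      fun j => (eb _ (j.1.2.foldl (f _) (b _))).size) :
    Computes (fun j : {j : Σ i, β i × α i // ∃ l1 l2, l j.1 = l1 ++ j.2.2 :: l2 ∧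
        j.2.1 = l1.foldl (f j.1) (b j.1)} => T j.1.1)
      (fun j => .pair (x j.1.1) (.pair (eb _ j.1.2.1) (ea _ j.1.2.2)))
      fun j => .pair (x j.1.1) (.pair (eb _ j.1.2.1) (ea _ j.1.2.2)) := by
  let κ := {j : Σ i, β i × α i // ∃ l1 l2, l j.1 = l1 ++ j.2.2 :: l2 ∧
        j.2.1 = l1.foldl (f j.1) (b j.1)}
  have h1 := hsize.reindex fun j : κ => ⟨⟨j.1.1, j.2.choose⟩, by
    obtain ⟨l2, h1, -⟩ := j.2.choose_spec
    exact ⟨_, h1.symm⟩⟩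
  refine id (((((hl.size_left.add hl.size_right).add (.const 2)).reindex
    fun j : κ => j.1.1).add h1).mono fun j => ?_)
  obtain ⟨l2, h1, h2⟩ := j.2.choose_spec
  have h3 : (ea j.1.1 j.1.2.2).size ≤ (encList (ea j.1.1) (l j.1.1)).size :=
    Data.size_le_of_mem (List.mem_map_of_mem (by rw [h1]; simp))
  simp only [← h2, Data.size] at h3 ⊢
  omega

lemma foldCtx (hl : Computes T x fun i => encList (ea i) (l i))
    (hsize : PolyBdd (fun j : {j : Σ i, List (α i) // j.2 <+: l j.1} => T j.1.1)
      fun j => (eb _ (j.1.2.foldl (f _) (b _))).size) (h : Computes T x y) :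
    Computes (fun j : {j : Σ i, β i × α i // ∃ l1 l2, l j.1 = l1 ++ j.2.2 :: l2 ∧
        j.2.1 = l1.foldl (f j.1) (b j.1)} => T j.1.1)
      (fun j => .pair (x j.1.1) (.pair (eb _ j.1.2.1) (ea _ j.1.2.2))) fun j => y j.1.1 :=
  (foldId hl hsize).fst.comp (h.reindex fun j : {j : Σ i, β i × α i // ∃ l1 l2,
    l j.1 = l1 ++ j.2.2 :: l2 ∧ j.2.1 = l1.foldl (f j.1) (b j.1)} => j.1.1)

end steps

variable {n : ι → ℕ} {p q : ∀ i, MvPolynomial (Fin (n i)) ℚ} {α β : ∀ i, Fin (n i) →₀ ℕ}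
  {c : ι → ℚ} {v : ∀ i, Fin (n i)}

lemma degList (hα : Computes T x fun i => encExp (α i)) :
    Computes T x fun i => encList Data.ofNat (degList (α i)) :=
  cons (ea := fun _ => Data.ofNat) (natSum hα) hα

lemma monLt (hα : Computes T x fun i => encExp (α i)) (hβ : Computes T x fun i => encExp (β i)) :
    Computes T x fun i => .ofBool (listLexLt (_root_.degList (α i)) (_root_.degList (β i))) :=
  lexLt hα.degList hβ.degList fun i => by simp [_root_.degList]

lemma monLe (hα : Computes T x fun i => encExp (α i)) (hβ : Computes T x fun i => encExp (β i)) :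
    Computes T x fun i => .ofBool (decide (α i ≤ β i)) := by
  refine (listLe hα hβ fun i => by simp).congr fun i => ?_
  congr 1
  rw [Bool.eq_iff_iff, decide_eq_true_iff, decide_eq_true_iff, Finsupp.le_def]
  constructor
  · intro h j
    refine h (α i j, β i j) (List.mem_iff_getElem.2 ⟨j, by simp, by simp⟩)
  · intro h p hp
    obtain ⟨k, hk, rfl⟩ := List.mem_iff_getElem.1 hp
    simpa using h ⟨k, by simpa using hk⟩

lemma encExp_zero (hn : Computes T x fun i => .ofNat (n i)) (hT : PolyBdd T n) :
    Computes T x fun i => encExp (0 : Fin (n i) →₀ ℕ) := by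
  have hr := range hn hT
  refine (map (ea := fun _ => Data.ofNat) (ec := fun _ => Data.ofNat) (f := fun _ _ => 0) hr
    (const (memId (ea := fun _ => Data.ofNat) hr).size_left (.ofNat 0))).congr fun i => ?_
  rw [encExp, List.map_const', List.length_range, ← List.ofFn_const]
  rfl

lemma encExp_add_single (hv : Computes T x fun i => encVar (v i))
    (hα : Computes T x fun i => encExp (α i)) :
    Computes T x fun i => encExp (single (v i) 1 + α i) := by
  have h := mapIdx (α := fun _ => ℕ) (ea := fun _ => Data.ofNat) (ec := fun _ => Data.ofNat)
    (f := fun i k a => if (v i : ℕ) = k then 1 + a else a) hα ?_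
  · refine h.congr fun i => ?_
    rw [encExp, List.mapIdx_eq_ofFn]
    congr 1
    refine List.ext_getElem (by simp) fun k h1 h2 => ?_
    simp only [List.length_ofFn] at h1 h2
    simp only [List.getElem_ofFn, Finsupp.add_apply, Finsupp.single_apply, Fin.ext_iff]
    split_ifs <;> simp
  · let κ := {j : Σ i, ℕ × ℕ // j.2.1 < (List.ofFn (α j.1)).length ∧ j.2.2 ∈ List.ofFn (α j.1)}
    change Computes (fun j : κ => T j.1.1) _ _
    have hi := id (T := fun j : κ => T j.1.1)
      (x := fun j => .pair (x j.1.1) (.pair (.ofNat j.1.2.1) (.ofNat j.1.2.2))) ?_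
    · have h1 := hi.fst.comp (hv.reindex fun j : κ => j.1.1)
      have h2 : Computes (fun j : κ => T j.1.1) _ fun j => .ofNat (1 + j.1.2.2) :=
        natAdd (m := fun _ => 1) (n := fun j : κ => j.1.2.2) (const hi.size_left (.ofNat 1))
          hi.snd.snd
      exact (ite (eqEnc (α := fun _ => ℕ) (e := fun _ => Data.ofNat)
        (u := fun j : κ => (v j.1.1 : ℕ)) (v := fun j : κ => j.1.2.1)
        (fun _ => Data.ofNat_injective) h1 hi.snd.fst)
        (h2.reindex Subtype.val) (hi.snd.snd.reindex Subtype.val)).congr fun j => by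
          split_ifs <;> rfl
    · refine (((hα.size_left.add ((PolyBdd.const 2).mul hα.size_right)).add (.const 4)).reindex
        fun j : κ => j.1.1).mono fun j => ?_
      have h1 : (Data.ofNat j.1.2.2).size ≤ (encExp (α j.1.1)).size :=
        Data.size_le_of_mem (List.mem_map_of_mem j.2.2)
      have h2 := Data.length_le_size ((List.ofFn (α j.1.1)).map Data.ofNat)
      have h3 : Nat.size j.1.2.1 ≤ j.1.2.1 := Nat.size_le.2 Nat.lt_two_pow_self
      have h4 := j.2.1
      simp only [List.length_map, encExp, encList, Data.size, Data.size_ofNat] at h1 h2 ⊢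
      omega

lemma encTerm (hc : Computes T x fun i => .atom ((p i).coeff (α i)))
    (hα : Computes T x fun i => encExp (α i)) :
    Computes T x fun i => _root_.encTerm (p i) (α i) :=
  hc.pair hα

lemma terms (hp : Computes T x fun i => encodePoly (p i)) :
    Computes T x fun i => encList (_root_.encTerm (p i)) (sortedSupport (p i)) :=
  hp.congr fun i => encodePoly_eq (p i)

lemma ofTerms (hp : Computes T x fun i => encList (_root_.encTerm (p i)) (sortedSupport (p i))) :
    Computes T x fun i => encodePoly (p i) :=
  hp.congr fun i => (encodePoly_eq (p i)).symm

lemma coeff (hp : Computes T x fun i => encodePoly (p i)) (hα : Computes T x fun i => encExp (α i)) :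
    Computes T x fun i => .atom ((p i).coeff (α i)) := by
  have h := filter (p := fun i β => decide (β = α i)) hp.terms
    (eqEnc (fun _ => encExp_injective) (memVal hp.terms).snd (memCtx hp.terms hα))
  -- At most one term has exponent `α i`. If there is none, reading the head of the empty list
  -- returns the default leaf 0, which is the right coefficient.
  refine h.fst.fst.congr fun i => ?_
  by_cases h0 : α i ∈ sortedSupport (p i)
  · have h1 : (sortedSupport (p i)).filter (fun β => decide (β = α i)) = [α i] := by
      rw [List.filter_eq, (List.count_eq_one_of_mem (nodup_sortedSupport _) h0)]
      rfl
    rw [h1]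
    rfl
  · have h1 : (sortedSupport (p i)).filter (fun β => decide (β = α i)) = [] := by
      rw [List.filter_eq_nil_iff]
      intro a ha
      simp only [decide_eq_true_eq]
      rintro rfl
      exact h0 ha
    rw [mem_sortedSupport, not_not] at h0
    rw [h1, h0]
    rfl

lemma isZero (hc : Computes T x fun i => .atom (c i)) :
    Computes T x fun i => .ofBool (decide (c i = 0)) :=
  (hc.decideEq (const hc.size_left (.atom 0))).congr fun i => by simp

lemma addMonomial (hp : Computes T x fun i => encodePoly (p i))
    (hα : Computes T x fun i => encExp (α i)) (hc : Computes T x fun i => .atom (c i)) :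
    Computes T x fun i => encodePoly (p i + monomial (α i) (c i)) := by
  have hv := (memVal hp.terms).snd
  have h1 := filter (p := fun i β => listLexLt (_root_.degList (α i)) (_root_.degList β)) hp.terms
    (monLt (memCtx hp.terms hα) hv)
  have h2 := filter (p := fun i β => listLexLt (_root_.degList β) (_root_.degList (α i))) hp.terms
    (monLt hv (memCtx hp.terms hα))
  have hs := (coeff hp hα).add hc
  let r := fun i => p i + monomial (α i) (c i)
  have hr : ∀ i β, β ≠ α i → _root_.encTerm (p i) β = _root_.encTerm (r i) β := fun i β h => by
    simp [_root_.encTerm, r, coeff_monomial, h.symm]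
  have h1' : Computes T x fun i => encList (_root_.encTerm (r i)) ((sortedSupport (p i)).filter
      fun β => listLexLt (_root_.degList (α i)) (_root_.degList β)) := h1.congr fun i => by
    refine congrArg Data.ofList (List.map_congr_left fun β hβ => hr i β ?_)
    rintro rfl
    rw [List.mem_filter, listLexLt_degList] at hβ
    exact lt_irrefl _ hβ.2
  have h2' : Computes T x fun i => encList (_root_.encTerm (r i)) ((sortedSupport (p i)).filter
      fun β => listLexLt (_root_.degList β) (_root_.degList (α i))) := h2.congr fun i => by
    refine congrArg Data.ofList (List.map_congr_left fun β hβ => hr i β ?_)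
    rintro rfl
    rw [List.mem_filter, listLexLt_degList] at hβ
    exact lt_irrefl _ hβ.2
  have hmid : Computes T x fun i => if (p i).coeff (α i) + c i = 0 then
      encList (_root_.encTerm (r i)) [] else encList (_root_.encTerm (r i)) [α i] := by
    refine ite (isZero hs) ((nil (ea := fun i => _root_.encTerm (r i)) hp.size_left).reindex
      Subtype.val)
      ((cons (ea := fun i => _root_.encTerm (r i)) (l := fun i => []) ?_
        (nil hp.size_left)).reindex Subtype.val)
    exact encTerm (p := r) (hs.congr fun i => by simp [r]) hα
  have hmid' : Computes T x fun i => encList (_root_.encTerm (r i))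
      (if (p i).coeff (α i) + c i = 0 then [] else [α i]) := hmid.congr fun i => by
    split_ifs <;> rfl
  exact ofTerms (p := r) ((append h1' (append hmid' h2')).congr fun i => by
    rw [← sortedSupport_add_monomial])

lemma zero (hx : PolyBdd T fun i => (x i).size) :
    Computes T x fun i => encodePoly (0 : MvPolynomial (Fin (n i)) ℚ) :=
  (const hx (.atom 0)).congr fun i => by
    rw [encodePoly_eq, sortedSupport_eq_nil.2 rfl]; rfl

lemma C_mul (hc : Computes T x fun i => .atom (c i)) (hp : Computes T x fun i => encodePoly (p i)) :
    Computes T x fun i => encodePoly (C (c i) * p i) := by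
  have h1 : Computes T x fun i => encList (_root_.encTerm (C (c i) * p i))
      ((sortedSupport (p i)).map fun α => α) := by
    refine map (ea := fun i => _root_.encTerm (p i))
      (ec := fun i => _root_.encTerm (C (c i) * p i)) (f := fun i α => α) hp.terms ?_
    have h2 := (memCtx hp.terms hc).mul (memVal hp.terms).fst
    exact (h2.pair (memVal hp.terms).snd).congr fun j => by
      simp only [_root_.encTerm, coeff_C_mul, Data.snd]
  -- Scaling by 0 is the only case in which the list of monomials changes.
  have h : Computes T x fun i => if c i = 0 then encodePoly (0 : MvPolynomial (Fin (n i)) ℚ) else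
      encList (_root_.encTerm (C (c i) * p i)) ((sortedSupport (p i)).map fun α => α) :=
    ite (isZero hc) ((zero hp.size_left).reindex Subtype.val) (h1.reindex Subtype.val)
  refine h.congr fun i => ?_
  split_ifs with h0
  · rw [h0, C_0, zero_mul]
  · rw [encodePoly_eq, sortedSupport_C_mul _ h0, List.map_id']

lemma polyAdd (hp : Computes T x fun i => encodePoly (p i))
    (hq : Computes T x fun i => encodePoly (q i)) :
    Computes T x fun i => encodePoly (p i + q i) := by
  have hsize : PolyBdd (fun j : {j : Σ i, List (Fin (n i) →₀ ℕ) // j.2 <+: sortedSupport (q j.1)} =>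
      T j.1.1) fun j => (encodePoly (j.1.2.foldl (fun r α => r + monomial α ((q j.1.1).coeff α))
        (p j.1.1))).size :=
    (((PolyBdd.const 12).mul (hp.size_right.add hq.size_right)).reindex
      fun j : {j : Σ i, List (Fin (n i) →₀ ℕ) // j.2 <+: sortedSupport (q j.1)} => j.1.1).mono
      fun j => size_foldl_add_monomial_le _ _ j.2
  refine (foldl (eb := fun i => encodePoly) (f := fun i r α => r + monomial α ((q i).coeff α))
    hq.terms hp hsize ?_).congr fun i => by rw [eq_foldl_add_monomial]
  have hi := foldId (eb := fun i => encodePoly)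
    (f := fun i r α => r + monomial α ((q i).coeff α)) hq.terms hsize
  exact addMonomial hi.snd.fst hi.snd.snd.snd hi.snd.snd.fst

lemma X_mul (hv : Computes T x fun i => encVar (v i)) (hp : Computes T x fun i => encodePoly (p i)) :
    Computes T x fun i => encodePoly (X (v i) * p i) := by
  refine ofTerms ((map (ec := fun i => _root_.encTerm (X (v i) * p i))
    (f := fun i α => single (v i) 1 + α) hp.terms ?_).congr fun i => by rw [sortedSupport_X_mul])
  exact encTerm ((memVal hp.terms).fst.congr fun j => by rw [coeff_X_mul]; rfl)
    (encExp_add_single (memCtx hp.terms hv) (memVal hp.terms).snd)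

lemma one (hn : Computes T x fun i => .ofNat (n i)) (hT : PolyBdd T n) :
    Computes T x fun i => encodePoly (1 : MvPolynomial (Fin (n i)) ℚ) :=
  (addMonomial (zero hn.size_left) (encExp_zero hn hT) (const hn.size_left (.atom 1))).congr
    fun i => by rw [zero_add]; rfl

/-- Since `f` is fixed, multiplication by it unrolls into a fixed number of scalings, additions and
multiplications by a variable. The algorithm never has to multiply two polynomials that both depend
on the input. -/
lemma rename_mul {k : ℕ} (f : MvPolynomial (Fin k) ℚ) {v : ∀ i, Fin k → Fin (n i)}
    (hv : ∀ j, Computes T x fun i => encVar (v i j)) (hp : Computes T x fun i => encodePoly (p i)) :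
    Computes T x fun i => encodePoly (rename (v i) f * p i) := by
  induction f using MvPolynomial.induction_on with
  | C a => exact (C_mul (const hp.size_left (.atom a)) hp).congr fun i => by rw [rename_C]
  | add f g hf hg => exact (hf.polyAdd hg).congr fun i => by rw [map_add, add_mul]
  | mul_X f j hf =>
    exact (X_mul (hv j) hf).congr fun i => by
      rw [map_mul, rename_X, mul_comm (rename _ f) (X _), mul_assoc]

lemma polySub (hp : Computes T x fun i => encodePoly (p i))
    (hq : Computes T x fun i => encodePoly (q i)) :
    Computes T x fun i => encodePoly (p i - q i) :=
  (hp.polyAdd (C_mul (const hp.size_left (.atom (-1))) hq)).congr fun i => by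
    rw [C_neg, C_1]; ring_nf

lemma polyEq [∀ i, DecidableEq (MvPolynomial (Fin (n i)) ℚ)]
    (hp : Computes T x fun i => encodePoly (p i)) (hq : Computes T x fun i => encodePoly (q i)) :
    Computes T x fun i => .ofBool (decide (p i = q i)) :=
  eqEnc (fun _ => encodePoly_injective) hp hq

lemma leadingTerm (hp : Computes T x fun i => encodePoly (p i)) (h0 : ∀ i, p i ≠ 0) :
    Computes T x fun i => _root_.encTerm (p i) (degLex.degree (p i)) :=
  hp.terms.fst.congr fun i => by
    obtain ⟨l, hl⟩ := sortedSupport_eq_cons (h0 i)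
    rw [hl]
    rfl

lemma degree (hp : Computes T x fun i => encodePoly (p i)) (h0 : ∀ i, p i ≠ 0) :
    Computes T x fun i => encExp (degLex.degree (p i)) :=
  (leadingTerm hp h0).snd

lemma leadingCoeff (hp : Computes T x fun i => encodePoly (p i)) (h0 : ∀ i, p i ≠ 0) :
    Computes T x fun i => .atom (degLex.leadingCoeff (p i)) :=
  (leadingTerm hp h0).fst

end Computes

/-! ## The algorithm -/

section algorithm

variable {n : ℕ}

open scoped Classical in
/-- The projection of `u` to the span of the reduced echelon basis `B`, with its partial sums. -/
noncomputable def projLog (B : List (MvPolynomial (Fin n) ℚ)) (u : MvPolynomial (Fin n) ℚ) :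
    MvPolynomial (Fin n) ℚ × List (MvPolynomial (Fin n) ℚ) :=
  foldlLog (fun r b => (r + C (u.coeff (degLex.degree b)) * b,
    [r + C (u.coeff (degLex.degree b)) * b])) 0 B

open scoped Classical in
/-- Extends a reduced echelon basis by one polynomial. -/
noncomputable def elimStep (B : List (MvPolynomial (Fin n) ℚ)) (g : MvPolynomial (Fin n) ℚ) :
    List (MvPolynomial (Fin n) ℚ) × List (MvPolynomial (Fin n) ℚ) :=
  -- Here and in the functions below that return a pair, the first component is the result and the
  -- second one logs the newly derived polynomials in an order in which they can be inferred.
  let s := projLog B g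
  let v := g - s.1
  if v = 0 then (B, s.2) else
    let w := C (degLex.leadingCoeff v)⁻¹ * v
    let B' := w :: B.map fun b => b - C (b.coeff (degLex.degree w)) * w
    (B', s.2 ++ v :: B')

/-- The reduced echelon basis of the span of a list of polynomials. -/
noncomputable def elim (G : List (MvPolynomial (Fin n) ℚ)) :
    List (MvPolynomial (Fin n) ℚ) × List (MvPolynomial (Fin n) ℚ) :=
  foldlLog elimStep [] G

/-- Adds the products of a list of polynomials with the variables. -/
noncomputable def multStep (G : List (MvPolynomial (Fin n) ℚ)) :
    List (MvPolynomial (Fin n) ℚ) × List (MvPolynomial (Fin n) ℚ) :=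
  (G ++ G.flatMap fun g => (List.finRange n).map fun i => X i * g,
    G.flatMap fun g => (List.finRange n).map fun i => X i * g)

/-- Adds the products of a list of polynomials with the monomials of degree at most `k`. -/
noncomputable def mults (k : ℕ) (G : List (MvPolynomial (Fin n) ℚ)) :
    List (MvPolynomial (Fin n) ℚ) × List (MvPolynomial (Fin n) ℚ) :=
  foldlLog (fun G _ => multStep G) G (List.range k)

/-- The products of at most `k` polynomials `t(x_i)`, with `t` from the list `tab`. -/
noncomputable def prods (n : ℕ) (tab : List (MvPolynomial (Fin 1) ℚ)) (k : ℕ) :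
    List (MvPolynomial (Fin n) ℚ) :=
  (List.range k).foldl (fun U _ => U ++ U.flatMap fun u => (List.finRange n).flatMap fun i =>
    tab.map fun t => rename (fun _ => i) t * u) [1]

open scoped Classical in
/-- The members of `U` in the span of the multiples of `F ++ H`. -/
noncomputable def roundStep (F U : List (MvPolynomial (Fin n) ℚ)) (k : ℕ)
    (H : List (MvPolynomial (Fin n) ℚ)) :
    List (MvPolynomial (Fin n) ℚ) × List (MvPolynomial (Fin n) ℚ) :=
  let M := mults k (F ++ H)
  let E := elim M.1
  (U.filter fun u => decide ((projLog E.1 u).1 = u),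
    M.2 ++ (E.2 ++ U.flatMap fun u => (projLog E.1 u).2))

/-- Iterates `roundStep` until it is stable. -/
noncomputable def rounds (F U : List (MvPolynomial (Fin n) ℚ)) (k : ℕ) :
    List (MvPolynomial (Fin n) ℚ) × List (MvPolynomial (Fin n) ℚ) :=
  -- The list `U` serves only as a counter: every round that is not yet stable finds a new member of
  -- `U`, so `U.length` rounds suffice.
  foldlLog (fun H _ => roundStep F U k H) [] U

/-- A reduced echelon basis of the span of the multiples of `F` and of the derived members
of `U`. -/
noncomputable def saturate (F U : List (MvPolynomial (Fin n) ℚ)) (k : ℕ) :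
    List (MvPolynomial (Fin n) ℚ) × List (MvPolynomial (Fin n) ℚ) :=
  let R := rounds F U k
  let M := mults k (F ++ R.1)
  let E := elim M.1
  (E.1, F ++ (R.2 ++ (M.2 ++ E.2)))

open scoped Classical in
/-- Whether `b` has degree at most `d` and no other leading monomial divides that of `b`. -/
noncomputable def keep (d : ℕ) (B : List (MvPolynomial (Fin n) ℚ)) (b : MvPolynomial (Fin n) ℚ) :
    Bool :=
  decide ((List.ofFn (degLex.degree b)).sum ≤ d) && (B.filter fun b' =>
    decide (degLex.degree b' ≤ degLex.degree b) && !decide (b' = b)).isEmpty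

open scoped Classical in
/-- The selected basis elements, each with a derivation. -/
noncomputable def output (F U : List (MvPolynomial (Fin n) ℚ)) (k d : ℕ) :
    List (MvPolynomial (Fin n) ℚ × List (MvPolynomial (Fin n) ℚ)) :=
  let S := saturate F U k
  -- The log treats 0 as given, because projections start from the sum 0; deleting all zeros removes
  -- this assumption. A copy of `g` is appended because a derivation must end in `g`.
  (S.1.filter (keep d S.1)).map fun g => (g, S.2.filter (fun p => !decide (p = 0)) ++ [g])

end algorithm

/-! ## Validity of the derivations -/

section PCLog

variable {n : ℕ}

/-- One inference of polynomial calculus from the set `A`, of degree at most `m`. -/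
def PCStep (F : Set (MvPolynomial (Fin n) ℚ)) (m : ℕ) (A : Set (MvPolynomial (Fin n) ℚ))
    (p : MvPolynomial (Fin n) ℚ) : Prop :=
  (p ∈ F ∧ p.totalDegree ≤ m) ∨ (∃ q ∈ A, ∃ r ∈ A, ∃ a b : ℚ, p = C a * q + C b * r) ∨
    ∃ q ∈ A, (∃ v, p = X v * q) ∧ p.totalDegree ≤ m

/-- Each entry of the list follows from `A` and the earlier entries. -/
def PCLog (F : Set (MvPolynomial (Fin n) ℚ)) (m : ℕ) :
    Set (MvPolynomial (Fin n) ℚ) → List (MvPolynomial (Fin n) ℚ) → Prop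
  | _, [] => True
  | A, p :: l => PCStep F m A p ∧ PCLog F m (insert p A) l

variable {F : Set (MvPolynomial (Fin n) ℚ)} {m : ℕ} {A A' : Set (MvPolynomial (Fin n) ℚ)}
  {p : MvPolynomial (Fin n) ℚ} {l l' B : List (MvPolynomial (Fin n) ℚ)}

lemma PCStep.mono (h : PCStep F m A p) (hA : A ⊆ A') : PCStep F m A' p := by
  rcases h with h | ⟨q, hq, r, hr, h⟩ | ⟨q, hq, h⟩
  · exact Or.inl h
  · exact Or.inr (Or.inl ⟨q, hA hq, r, hA hr, h⟩)
  · exact Or.inr (Or.inr ⟨q, hA hq, h⟩)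

lemma PCStep.lincomb {q r : MvPolynomial (Fin n) ℚ} (hq : q ∈ A) (hr : r ∈ A) (a b : ℚ)
    (h : p = C a * q + C b * r) : PCStep F m A p :=
  Or.inr (Or.inl ⟨q, hq, r, hr, a, b, h⟩)

lemma PCLog.mono (h : PCLog F m A l) (hA : A ⊆ A') : PCLog F m A' l := by
  induction l generalizing A A' with
  | nil => trivial
  | cons p l ih => exact ⟨h.1.mono hA, ih h.2 (Set.insert_subset_insert hA)⟩

lemma PCLog.append (h : PCLog F m A l) (h' : PCLog F m (A ∪ {p | p ∈ l}) l') :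
    PCLog F m A (l ++ l') := by
  induction l generalizing A with
  | nil => simpa using h'
  | cons p l ih =>
    refine ⟨h.1, ih h.2 (h'.mono ?_)⟩
    rintro q (hq | hq)
    · exact Or.inl (Or.inr hq)
    · rcases List.mem_cons.1 hq with rfl | hq
      · exact Or.inl (Or.inl rfl)
      · exact Or.inr hq

lemma PCLog.of_forall (h : ∀ p ∈ l, PCStep F m A p) : PCLog F m A l := by
  induction l generalizing A with
  | nil => trivial
  | cons p l ih =>
    exact ⟨h p (by simp), ih fun q hq => (h q (by simp [hq])).mono (Set.subset_insert _ _)⟩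

/-- `I A s` expresses what the state `s` needs once the polynomials of `A` are derived. The known
set grows with the log, so a step must be valid from every larger set. -/
lemma PCLog.foldlLog {α β : Type} {f : β → α → β × List (MvPolynomial (Fin n) ℚ)} {b : β}
    {l : List α} {I : Set (MvPolynomial (Fin n) ℚ) → β → Prop} (h0 : I A b)
    (hstep : ∀ A', A ⊆ A' → ∀ s, ∀ a ∈ l, I A' s →
      PCLog F m A' (f s a).2 ∧ I (A' ∪ {p | p ∈ (f s a).2}) (f s a).1) :
    PCLog F m A (foldlLog f b l).2 ∧
      I (A ∪ {p | p ∈ (_root_.foldlLog f b l).2}) (_root_.foldlLog f b l).1 := by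
  induction l using List.reverseRecOn with
  | nil => exact ⟨trivial, by simpa using h0⟩
  | append_singleton l a ih =>
    obtain ⟨h1, h2⟩ := ih fun A' hA s a' ha' => hstep A' hA s a' (by simp [ha'])
    obtain ⟨h3, h4⟩ := hstep _ Set.subset_union_left _ a (by simp) h2
    rw [foldlLog_concat]
    refine ⟨h1.append h3, ?_⟩
    convert h4 using 1
    ext q
    simp [or_assoc]

/-- Each partial sum combines the previous one with a single basis element. The sum starts at 0,
which must be available, also when `B` is empty. -/
lemma pcLog_projLog (hB : ∀ b ∈ B, b ∈ A) (h0 : 0 ∈ A) (u : MvPolynomial (Fin n) ℚ) :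
    PCLog F m A (projLog B u).2 ∧ (projLog B u).1 ∈ A ∪ {p | p ∈ (projLog B u).2} := by
  refine PCLog.foldlLog (I := fun A r => r ∈ A) h0 fun A' hA s b hb hs => ⟨⟨?_, trivial⟩, ?_⟩
  · exact .lincomb hs (hA (hB b hb)) 1 (u.coeff (degLex.degree b)) (by rw [C_1, one_mul])
  · exact Or.inr (by simp)

lemma elimStep_of_eq {g : MvPolynomial (Fin n) ℚ} (h : g - (projLog B g).1 = 0) :
    elimStep B g = (B, (projLog B g).2) := by
  simp [elimStep, h]

lemma elimStep_of_ne {g v w : MvPolynomial (Fin n) ℚ} (hv : v = g - (projLog B g).1) (h : v ≠ 0)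
    (hw : w = C (degLex.leadingCoeff v)⁻¹ * v) :
    elimStep B g = (w :: B.map fun b => b - C (b.coeff (degLex.degree w)) * w,
      (projLog B g).2 ++ v :: w :: B.map fun b => b - C (b.coeff (degLex.degree w)) * w) := by
  subst hv hw
  simp only [elimStep, if_neg h]

lemma pcLog_elimStep {g : MvPolynomial (Fin n) ℚ} (hB : ∀ b ∈ B, b ∈ A) (h0 : 0 ∈ A) (hg : g ∈ A) :
    PCLog F m A (elimStep B g).2 ∧
      ∀ b ∈ (elimStep B g).1, b ∈ A ∪ {q | q ∈ (elimStep B g).2} := by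
  obtain ⟨h1, h2⟩ := pcLog_projLog (F := F) (m := m) hB h0 g
  rcases eq_or_ne (g - (projLog B g).1) 0 with hv | hv
  · rw [elimStep_of_eq hv]
    exact ⟨h1, fun b hb => Or.inl (hB b hb)⟩
  obtain ⟨v, hv'⟩ : ∃ v, v = g - (projLog B g).1 := ⟨_, rfl⟩
  obtain ⟨w, hw⟩ : ∃ w, w = C (degLex.leadingCoeff v)⁻¹ * v := ⟨_, rfl⟩
  rw [elimStep_of_ne hv' (hv' ▸ hv) hw]
  refine ⟨h1.append ⟨?_, ?_, PCLog.of_forall fun q hq => ?_⟩, fun b hb =>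
    Or.inr (List.mem_append_right _ (List.mem_cons_of_mem _ hb))⟩
  · exact .lincomb (Or.inl hg) h2 1 (-1) (by rw [hv', C_neg, C_1]; ring)
  · exact .lincomb (Set.mem_insert _ _) (Set.mem_insert _ _) (degLex.leadingCoeff v)⁻¹ 0
      (by rw [hw, C_0]; ring)
  · obtain ⟨b, hb, rfl⟩ := List.mem_map.1 hq
    exact .lincomb (Or.inr (Or.inr (Or.inl (hB b hb)))) (Set.mem_insert _ _) 1
      (-coeff (degLex.degree w) b) (by rw [C_neg, C_1]; ring)

lemma pcLog_elim (hl : ∀ p ∈ l, p ∈ A) (h0 : 0 ∈ A) :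
    PCLog F m A (elim l).2 ∧ ∀ b ∈ (elim l).1, b ∈ A ∪ {q | q ∈ (elim l).2} :=
  PCLog.foldlLog (f := elimStep) (I := fun A B => ∀ b ∈ B, b ∈ A) (by simp)
    fun A' hA s g hg hs => pcLog_elimStep hs (hA h0) (hA (hl g hg))

lemma mults_succ (k : ℕ) (G : List (MvPolynomial (Fin n) ℚ)) :
    mults (k + 1) G = ((multStep (mults k G).1).1, (mults k G).2 ++ (multStep (mults k G).1).2) := by
  rw [mults, List.range_succ, foldlLog_concat]
  rfl

lemma pcLog_mults {d k : ℕ} (hl : ∀ p ∈ l, p ∈ A ∧ p.totalDegree ≤ d) (hm : d + k ≤ m) :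
    PCLog F m A (mults k l).2 ∧
      ∀ p ∈ (mults k l).1, p ∈ A ∪ {p | p ∈ (mults k l).2} ∧ p.totalDegree ≤ d + k := by
  induction k with
  | zero => exact ⟨trivial, fun p hp => ⟨Or.inl (hl p hp).1, (hl p hp).2⟩⟩
  | succ k ih =>
    obtain ⟨h1, h2⟩ := ih (by omega)
    have h3 : ∀ q ∈ (multStep (mults k l).1).2,
        ∃ p ∈ (mults k l).1, ∃ v, q = X v * p ∧ q.totalDegree ≤ d + (k + 1) := by
      intro q hq
      simp only [multStep, List.mem_flatMap, List.mem_map] at hq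
      obtain ⟨p, hp, v, -, rfl⟩ := hq
      refine ⟨p, hp, v, rfl, (totalDegree_mul _ _).trans ?_⟩
      have := (h2 p hp).2
      rw [totalDegree_X]
      omega
    rw [mults_succ]
    refine ⟨h1.append (PCLog.of_forall fun q hq => ?_), fun q hq => ?_⟩
    · obtain ⟨p, hp, v, h4, h5⟩ := h3 q hq
      exact Or.inr (Or.inr ⟨p, (h2 p hp).1, ⟨v, h4⟩, by omega⟩)
    · rcases List.mem_append.1 hq with hq | hq
      · obtain ⟨h4, h5⟩ := h2 q hq
        refine ⟨?_, by omega⟩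
        rcases h4 with h4 | h4
        · exact Or.inl h4
        · exact Or.inr (List.mem_append_left _ h4)
      · obtain ⟨-, -, -, -, h5⟩ := h3 q hq
        exact ⟨Or.inr (List.mem_append_right _ hq), h5⟩

lemma projLog_mem {W : Submodule ℚ (MvPolynomial (Fin n) ℚ)} (hB : ∀ b ∈ B, b ∈ W)
    (u : MvPolynomial (Fin n) ℚ) : (projLog B u).1 ∈ W := by
  rw [projLog, foldlLog_fst]
  refine List.foldlRecOn B _ W.zero_mem fun r hr b hb => W.add_mem hr ?_
  rw [C_mul']
  exact W.smul_mem _ (hB b hb)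

lemma pcLog_flatMap_projLog (hB : ∀ b ∈ B, b ∈ A) (h0 : 0 ∈ A)
    (U : List (MvPolynomial (Fin n) ℚ)) :
    PCLog F m A (U.flatMap fun u => (projLog B u).2) ∧
      ∀ u ∈ U, (projLog B u).1 ∈ A ∪ {p | p ∈ U.flatMap fun u => (projLog B u).2} := by
  induction U generalizing A with
  | nil => exact ⟨trivial, by simp⟩
  | cons u U ih =>
    obtain ⟨h1, h2⟩ := pcLog_projLog (F := F) (m := m) hB h0 u
    obtain ⟨h3, h4⟩ := ih (A := A ∪ {p | p ∈ (projLog B u).2}) (fun b hb => Or.inl (hB b hb))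
      (Or.inl h0)
    have h5 : ∀ p, p ∈ (u :: U).flatMap (fun u => (projLog B u).2) ↔
        p ∈ (projLog B u).2 ∨ p ∈ U.flatMap fun u => (projLog B u).2 := fun p => by
      rw [List.flatMap_cons, List.mem_append]
    refine ⟨h1.append h3, fun u' hu' => ?_⟩
    simp only [Set.mem_union, Set.mem_ofPred_eq, h5] at h2 h4 ⊢
    rcases List.mem_cons.1 hu' with rfl | hu'
    · tauto
    · have := h4 u' hu'
      tauto

/-- A member of `U` is kept when it equals its projection, and the partial sums of that projection
are in the log. Its degree is bounded by that of `U` and not by `d + k`, so the next round starts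
from the same degree bound. -/
lemma pcLog_roundStep {L U H : List (MvPolynomial (Fin n) ℚ)} {d k : ℕ}
    (hF : ∀ p ∈ L, p ∈ A ∧ p.totalDegree ≤ d) (hU : ∀ p ∈ U, p.totalDegree ≤ d)
    (hH : ∀ p ∈ H, p ∈ A ∧ p.totalDegree ≤ d) (hm : d + k ≤ m) (h0 : 0 ∈ A) :
    PCLog F m A (roundStep L U k H).2 ∧ ∀ p ∈ (roundStep L U k H).1,
      p ∈ A ∪ {p | p ∈ (roundStep L U k H).2} ∧ p.totalDegree ≤ d := by
  obtain ⟨h1, h2⟩ := pcLog_mults (F := F) (l := L ++ H) (k := k) (fun p hp => by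
    rcases List.mem_append.1 hp with hp | hp
    exacts [hF p hp, hH p hp]) hm
  obtain ⟨h3, h4⟩ := pcLog_elim (F := F) (m := m) (l := (mults k (L ++ H)).1)
    (fun p hp => (h2 p hp).1) (Or.inl h0)
  obtain ⟨h5, h6⟩ := pcLog_flatMap_projLog (F := F) (m := m) h4 (Or.inl (Or.inl h0)) U
  refine ⟨h1.append (h3.append h5), fun u hu => ?_⟩
  simp only [roundStep, List.mem_filter, decide_eq_true_eq] at hu
  have := h6 u hu.1
  rw [hu.2] at this
  refine ⟨?_, hU u hu.1⟩
  simp only [roundStep, Set.mem_union, Set.mem_ofPred_eq, List.mem_append] at this ⊢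
  tauto

lemma pcLog_saturate {L U : List (MvPolynomial (Fin n) ℚ)} {d k : ℕ}
    (hL : ∀ p ∈ L, p ∈ F ∧ p.totalDegree ≤ d) (hU : ∀ p ∈ U, p.totalDegree ≤ d) (hm : d + k ≤ m) :
    PCLog F m {0} (saturate L U k).2 ∧
      ∀ p ∈ (saturate L U k).1, p ∈ insert 0 {p | p ∈ (saturate L U k).2} := by
  have h1 : PCLog F m {0} L := .of_forall fun p hp =>
    Or.inl ⟨(hL p hp).1, (hL p hp).2.trans (by omega)⟩
  obtain ⟨h2, h3⟩ := PCLog.foldlLog (F := F) (m := m) (A := {0} ∪ {p | p ∈ L})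
    (f := fun H _ => roundStep L U k H) (b := []) (l := U)
    (I := fun A H => ∀ p ∈ H, p ∈ A ∧ p.totalDegree ≤ d) (by simp) fun A' hA s _ _ hs =>
      pcLog_roundStep (fun p hp => ⟨hA (Or.inr hp), (hL p hp).2⟩) hU hs hm (hA (Or.inl rfl))
  change PCLog F m _ (rounds L U k).2 at h2
  change ∀ p ∈ (rounds L U k).1, p ∈ _ ∪ {p | p ∈ (rounds L U k).2} ∧ _ at h3
  obtain ⟨h4, h5⟩ := pcLog_mults (F := F)
    (A := {0} ∪ {p | p ∈ L} ∪ {p | p ∈ (rounds L U k).2}) (l := L ++ (rounds L U k).1) (k := k) (fun p hp => by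
    rcases List.mem_append.1 hp with hp | hp
    exacts [⟨Or.inl (Or.inr hp), (hL p hp).2⟩, h3 p hp]) hm
  obtain ⟨h6, h7⟩ := pcLog_elim (F := F) (m := m) (l := (mults k (L ++ (rounds L U k).1)).1)
    (fun p hp => (h5 p hp).1) (Or.inl (Or.inl (Or.inl rfl)))
  refine ⟨h1.append (h2.append (h4.append h6)), fun p hp => ?_⟩
  have := h7 p hp
  simp only [saturate, Set.mem_union, Set.mem_ofPred_eq, List.mem_append, Set.mem_insert_iff,
    Set.mem_singleton_iff] at this ⊢
  tauto

/-- Linear combinations do not raise the degree, which is why `PCStep` restricts it only for axioms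
and for multiplications by a variable. -/
lemma PCLog.totalDegree_le (h : PCLog F m A l) (hA : ∀ p ∈ A, p.totalDegree ≤ m) :
    ∀ p ∈ l, p.totalDegree ≤ m := by
  induction l generalizing A with
  | nil => simp
  | cons p l ih =>
    have hp : p.totalDegree ≤ m := by
      rcases h.1 with h | ⟨q, hq, r, hr, a, b, rfl⟩ | ⟨-, -, -, h⟩
      · exact h.2
      · have h1 := totalDegree_mul (C a) q
        have h2 := totalDegree_mul (C b) r
        rw [totalDegree_C, zero_add] at h1 h2
        exact (totalDegree_add _ _).trans (max_le (h1.trans (hA q hq)) (h2.trans (hA r hr)))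
      · exact h
    intro q hq
    rcases List.mem_cons.1 hq with rfl | hq
    · exact hp
    · exact ih h.2 (fun r hr => by
        rcases hr with rfl | hr
        exacts [hp, hA r hr]) q hq

end PCLog

/-! ## Reduced echelon bases -/

section rref

variable {n : ℕ}

/-- Monic polynomials such that no leading monomial occurs in another one. -/
structure IsEchelon (B : List (MvPolynomial (Fin n) ℚ)) : Prop where
  monic : ∀ b ∈ B, degLex.leadingCoeff b = 1
  pairwise : B.Pairwise fun b c => b.coeff (degLex.degree c) = 0 ∧ c.coeff (degLex.degree b) = 0

variable {B : List (MvPolynomial (Fin n) ℚ)} {b c g u v w : MvPolynomial (Fin n) ℚ}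

lemma IsEchelon.ne_zero (h : IsEchelon B) (hb : b ∈ B) : b ≠ 0 := fun h0 => by
  have := h.monic b hb
  rw [h0, MonomialOrder.leadingCoeff_zero] at this
  exact zero_ne_one this

lemma IsEchelon.coeff_degree (h : IsEchelon B) (hb : b ∈ B) : b.coeff (degLex.degree b) = 1 :=
  h.monic b hb

lemma IsEchelon.nodup (h : IsEchelon B) : B.Nodup := by
  refine (List.pairwise_iff_forall_sublist.2 fun {b c} hs e => ?_)
  have h1 := List.pairwise_iff_forall_sublist.1 h.pairwise hs
  have hb : b ∈ B := hs.subset (by simp)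
  rw [← e, h.coeff_degree hb] at h1
  exact one_ne_zero h1.1

lemma IsEchelon.coeff_eq_zero (h : IsEchelon B) (hb : b ∈ B) (hc : c ∈ B) (hbc : b ≠ c) :
    b.coeff (degLex.degree c) = 0 := by
  obtain ⟨i, hi, rfl⟩ := List.getElem_of_mem hb
  obtain ⟨j, hj, rfl⟩ := List.getElem_of_mem hc
  have h1 := List.pairwise_iff_getElem.1 h.pairwise
  rcases lt_trichotomy i j with hij | rfl | hij
  exacts [(h1 i j hi hj hij).1, absurd rfl hbc, (h1 j i hj hi hij).2]

lemma projLog_fst (B : List (MvPolynomial (Fin n) ℚ)) (u : MvPolynomial (Fin n) ℚ) :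
    (projLog B u).1 = (B.map fun b => C (u.coeff (degLex.degree b)) * b).sum := by
  rw [projLog, foldlLog_fst, List.sum_eq_foldl, List.foldl_map]

lemma IsEchelon.projLog_fst (h : IsEchelon B) (u : MvPolynomial (Fin n) ℚ) :
    (projLog B u).1 = ∑ b ∈ B.toFinset, C (u.coeff (degLex.degree b)) * b := by
  rw [_root_.projLog_fst, List.sum_toFinset _ h.nodup]

lemma IsEchelon.coeff_projLog (h : IsEchelon B) (u : MvPolynomial (Fin n) ℚ) (hc : c ∈ B) :
    (projLog B u).1.coeff (degLex.degree c) = u.coeff (degLex.degree c) := by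
  rw [h.projLog_fst, coeff_sum, Finset.sum_eq_single c]
  · rw [coeff_C_mul, h.coeff_degree hc, mul_one]
  · intro b hb hbc
    rw [coeff_C_mul, h.coeff_eq_zero (List.mem_toFinset.1 hb) hc hbc, mul_zero]
  · intro hc'
    exact absurd (List.mem_toFinset.2 hc) hc'

lemma projLog_mem_span (B : List (MvPolynomial (Fin n) ℚ)) (u : MvPolynomial (Fin n) ℚ) :
    (projLog B u).1 ∈ Submodule.span ℚ {b | b ∈ B} :=
  projLog_mem (fun _ hb => Submodule.subset_span hb) u

/-- Each leading monomial occurs in exactly one basis element, with coefficient 1. So the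
coefficients at the leading monomials are the coordinates of an element of the span, and membership
is tested by projecting. -/
lemma IsEchelon.projLog_eq_iff (h : IsEchelon B) :
    (projLog B u).1 = u ↔ u ∈ Submodule.span ℚ {b | b ∈ B} := by
  refine ⟨fun h => h ▸ projLog_mem_span B u, fun hu => ?_⟩
  induction hu using Submodule.span_induction with
  | mem b hb =>
    rw [h.projLog_fst, Finset.sum_eq_single b]
    · rw [h.coeff_degree hb, C_1, one_mul]
    · intro c hc hcb
      rw [h.coeff_eq_zero hb (List.mem_toFinset.1 hc) hcb.symm, C_0, zero_mul]
    · intro hb'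
      exact absurd (List.mem_toFinset.2 hb) hb'
  | zero => rw [h.projLog_fst]; simp
  | add p q _ _ hp hq =>
    rw [h.projLog_fst] at hp hq ⊢
    simp only [coeff_add, C_add, add_mul, Finset.sum_add_distrib, hp, hq]
  | smul a p _ hp =>
    rw [h.projLog_fst] at hp ⊢
    conv_rhs => rw [← hp]
    simp only [smul_eq_C_mul, coeff_C_mul, C_mul, mul_assoc, Finset.mul_sum]

/-- The leading monomials of the span are those of the basis. -/
lemma IsEchelon.exists_degree_eq (h : IsEchelon B) (hu : u ∈ Submodule.span ℚ {b | b ∈ B})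
    (h0 : u ≠ 0) : ∃ b ∈ B, degLex.degree b = degLex.degree u := by
  have h1 : u.coeff (degLex.degree u) ≠ 0 := MonomialOrder.coeff_degree_ne_zero_iff.2 h0
  have h2 := h.projLog_eq_iff.2 hu
  rw [h.projLog_fst] at h2
  replace h1 : coeff (degLex.degree u) (∑ b ∈ B.toFinset, C (u.coeff (degLex.degree b)) * b) ≠ 0 :=
    h2.symm ▸ h1
  rw [coeff_sum] at h1
  obtain ⟨b, hb, h3⟩ := Finset.exists_ne_zero_of_sum_ne_zero h1
  rw [coeff_C_mul] at h3
  refine ⟨b, List.mem_toFinset.1 hb, degLex.toSyn.injective (le_antisymm ?_ ?_)⟩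
  · exact MonomialOrder.le_degree (mem_support_iff.2 (left_ne_zero_of_mul h3))
  · exact MonomialOrder.le_degree (mem_support_iff.2 (right_ne_zero_of_mul h3))

/-- If the leading monomial of `w` occurs in `b`, it is strictly below that of `b`, since `w`
contains no leading monomial of `B`. Clearing it from `b` therefore leaves the leading term of `b`
unchanged. -/
lemma IsEchelon.cons (h : IsEchelon B) (hv : v ≠ 0) (hv0 : ∀ b ∈ B, v.coeff (degLex.degree b) = 0)
    (hw : w = C (degLex.leadingCoeff v)⁻¹ * v) :
    IsEchelon (w :: B.map fun b => b - C (b.coeff (degLex.degree w)) * w) := by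
  have hlc : degLex.leadingCoeff v ≠ 0 := MonomialOrder.leadingCoeff_ne_zero_iff.2 hv
  have hw1 : degLex.leadingCoeff w = 1 := by
    rw [hw, MonomialOrder.leadingCoeff_mul, MonomialOrder.leadingCoeff_C, inv_mul_cancel₀ hlc]
  have hwd : w.coeff (degLex.degree w) = 1 := hw1
  have hw0 : ∀ b ∈ B, w.coeff (degLex.degree b) = 0 := fun b hb => by
    rw [hw, coeff_C_mul, hv0 b hb, mul_zero]
  have hne : ∀ b ∈ B, degLex.degree b ≠ degLex.degree w := fun b hb e => by
    have := hw0 b hb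
    rw [e, hwd] at this
    exact one_ne_zero this
  have hdeg : ∀ b ∈ B, degLex.degree (b - C (b.coeff (degLex.degree w)) * w) = degLex.degree b ∧
      degLex.leadingCoeff (b - C (b.coeff (degLex.degree w)) * w) = 1 := by
    intro b hb
    rcases eq_or_ne (b.coeff (degLex.degree w)) 0 with h0 | h0
    · rw [h0, C_0, zero_mul, sub_zero]
      exact ⟨rfl, h.monic b hb⟩
    · have h1 : degLex.degree w ≺[degLex] degLex.degree b :=
        lt_of_le_of_ne (MonomialOrder.le_degree (mem_support_iff.2 h0)) fun e =>
          hne b hb (degLex.toSyn.injective e).symm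
      have h2 : degLex.degree (C (b.coeff (degLex.degree w)) * w) ≺[degLex] degLex.degree b := by
        rwa [MonomialOrder.degree_mul (by simpa using h0) (MonomialOrder.leadingCoeff_ne_zero_iff.1
          (hw1 ▸ one_ne_zero)), MonomialOrder.degree_C, zero_add]
      rw [MonomialOrder.degree_sub_of_lt h2, MonomialOrder.leadingCoeff_sub_of_lt h2]
      exact ⟨rfl, h.monic b hb⟩
  refine ⟨?_, List.pairwise_cons.2 ⟨?_, List.pairwise_map.2 (h.pairwise.imp_of_mem ?_)⟩⟩
  · intro b hb
    rcases List.mem_cons.1 hb with rfl | hb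
    · exact hw1
    · obtain ⟨b', hb', rfl⟩ := List.mem_map.1 hb
      exact (hdeg b' hb').2
  · intro b' hb'
    obtain ⟨b, hb, rfl⟩ := List.mem_map.1 hb'
    rw [(hdeg b hb).1, coeff_sub, coeff_C_mul, hwd, mul_one, sub_self]
    exact ⟨hw0 b hb, rfl⟩
  · intro b c hb hc hbc
    rw [(hdeg b hb).1, (hdeg c hc).1, coeff_sub, coeff_sub, coeff_C_mul, coeff_C_mul, hw0 b hb,
      hw0 c hc, hbc.1, hbc.2]
    simp

lemma IsEchelon.elimStep (h : IsEchelon B) (g : MvPolynomial (Fin n) ℚ) :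
    IsEchelon (elimStep B g).1 := by
  rcases eq_or_ne (g - (projLog B g).1) 0 with hv | hv
  · rwa [elimStep_of_eq hv]
  rw [elimStep_of_ne rfl hv rfl]
  exact h.cons hv (fun b hb => by rw [coeff_sub, h.coeff_projLog g hb, sub_self]) rfl

lemma span_elimStep (B : List (MvPolynomial (Fin n) ℚ)) (g : MvPolynomial (Fin n) ℚ) :
    Submodule.span ℚ {b | b ∈ (elimStep B g).1} = Submodule.span ℚ (insert g {b | b ∈ B}) := by
  have hp : (projLog B g).1 ∈ Submodule.span ℚ {b | b ∈ B} := projLog_mem_span B g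
  rcases eq_or_ne (g - (projLog B g).1) 0 with hv | hv
  · rw [elimStep_of_eq hv, Submodule.span_insert_eq_span]
    rw [sub_eq_zero.1 hv]
    exact hp
  obtain ⟨v, hv'⟩ : ∃ v, v = g - (projLog B g).1 := ⟨_, rfl⟩
  obtain ⟨w, hw⟩ : ∃ w, w = C (degLex.leadingCoeff v)⁻¹ * v := ⟨_, rfl⟩
  rw [elimStep_of_ne hv' (hv' ▸ hv) hw]
  have hlc : degLex.leadingCoeff v ≠ 0 := MonomialOrder.leadingCoeff_ne_zero_iff.2 (hv' ▸ hv)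
  set V := Submodule.span ℚ (insert g {b | b ∈ B})
  set V' := Submodule.span ℚ {b | b ∈ w :: B.map fun b => b - C (b.coeff (degLex.degree w)) * w}
  have hBV : Submodule.span ℚ {b | b ∈ B} ≤ V := Submodule.span_mono (Set.subset_insert _ _)
  have hwV : w ∈ V := by
    rw [hw, C_mul', hv']
    exact V.smul_mem _ (V.sub_mem (Submodule.subset_span (Set.mem_insert _ _)) (hBV hp))
  have hwV' : w ∈ V' := Submodule.subset_span (List.mem_cons_self)
  have hBV' : Submodule.span ℚ {b | b ∈ B} ≤ V' := by
    rw [Submodule.span_le]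
    intro b hb
    have h1 : b - C (b.coeff (degLex.degree w)) * w ∈ V' :=
      Submodule.subset_span (List.mem_cons_of_mem _ (List.mem_map_of_mem hb))
    have h2 := V'.add_mem h1 (V'.smul_mem (b.coeff (degLex.degree w)) hwV')
    rwa [← C_mul', sub_add_cancel] at h2
  refine le_antisymm (Submodule.span_le.2 fun b hb => ?_) (Submodule.span_le.2 fun b hb => ?_)
  · rcases List.mem_cons.1 hb with rfl | hb
    · exact hwV
    · obtain ⟨b', hb', rfl⟩ := List.mem_map.1 hb
      rw [C_mul']
      exact V.sub_mem (hBV (Submodule.subset_span hb')) (V.smul_mem _ hwV)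
  · rcases hb with rfl | hb
    · have h1 := V'.add_mem (V'.smul_mem (degLex.leadingCoeff v) hwV') (hBV' hp)
      rwa [hw, ← C_mul', ← mul_assoc, ← C_mul, mul_inv_cancel₀ hlc, C_1, one_mul, hv',
        sub_add_cancel] at h1
    · exact hBV' (Submodule.subset_span hb)

lemma elim_concat (G : List (MvPolynomial (Fin n) ℚ)) (g : MvPolynomial (Fin n) ℚ) :
    (elim (G ++ [g])).1 = (elimStep (elim G).1 g).1 := by
  rw [elim, foldlLog_concat]
  rfl

lemma elim_fst (G : List (MvPolynomial (Fin n) ℚ)) :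
    (elim G).1 = G.foldl (fun B g => (elimStep B g).1) [] :=
  foldlLog_fst _ _ _

lemma isEchelon_elim (G : List (MvPolynomial (Fin n) ℚ)) : IsEchelon (elim G).1 := by
  induction G using List.reverseRecOn with
  | nil => exact ⟨by simp [elim], by simp [elim]⟩
  | append_singleton G g ih => rw [elim_concat]; exact ih.elimStep g

lemma span_elim (G : List (MvPolynomial (Fin n) ℚ)) :
    Submodule.span ℚ {b | b ∈ (elim G).1} = Submodule.span ℚ {g | g ∈ G} := by
  induction G using List.reverseRecOn with
  | nil => simp [elim]
  | append_singleton G g ih =>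
    rw [elim_concat, span_elimStep, Submodule.span_insert, ih, ← Submodule.span_insert]
    congr 1
    ext x
    simp [or_comm]

lemma length_elim_le (G : List (MvPolynomial (Fin n) ℚ)) : (elim G).1.length ≤ G.length := by
  induction G using List.reverseRecOn with
  | nil => simp [elim]
  | append_singleton G g ih =>
    rw [elim_concat]
    rcases eq_or_ne (g - (projLog (elim G).1 g).1) 0 with hv | hv
    · rw [elimStep_of_eq hv, List.length_append]
      exact ih.trans (Nat.le_add_right _ _)
    · rw [elimStep_of_ne rfl hv rfl]
      simpa using ih

/-! ### Heights of reduced echelon bases -/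

/-- Cramer's rule: the solution of a regular system whose entries are integers up to the common
denominator `c`. -/
lemma ratHeight_le_of_mulVec_eq {r : ℕ} (M : Matrix (Fin r) (Fin r) ℚ) (x y : Fin r → ℚ)
    (hM : IsUnit M) (hxy : M.mulVec x = y) {c N : ℕ} (hc : c ≠ 0)
    (hMN : ∀ i j, ∃ z : ℤ, c * M i j = z ∧ z.natAbs ≤ N)
    (hyN : ∀ i, ∃ z : ℤ, c * y i = z ∧ z.natAbs ≤ N) (k : Fin r) :
    ratHeight (x k) ≤ r.factorial * N ^ r := by
  choose A hA hAN using hMN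
  choose z hz hzN using hyN
  have hA' : (Matrix.of A).map (fun a : ℤ => (a : ℚ)) = (c : ℚ) • M := by
    ext i j
    simp [hA]
  have hdet : ((Matrix.of A).det : ℚ) ≠ 0 := by
    have h1 : ((Matrix.of A).det : ℚ) = ((c : ℚ) • M).det := by
      rw [← hA', Int.cast_det]
    rw [h1, Matrix.det_smul]
    exact mul_ne_zero (pow_ne_zero _ (Nat.cast_ne_zero.2 hc))
      ((Matrix.isUnit_iff_isUnit_det M).1 hM).ne_zero
  have hx : ((Matrix.of A).map (fun a : ℤ => (a : ℚ))).mulVec x = fun i => (z i : ℚ) := by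
    rw [hA', Matrix.smul_mulVec, hxy]
    ext i
    simp [hz]
  -- Cramer's rule for the system cleared of denominators: `x k` is a quotient of two integer
  -- determinants.
  have hcr : (((Matrix.of A).updateCol k z).det : ℚ) = (Matrix.of A).det * x k := by
    have h1 : ((Matrix.of A).map (fun a : ℤ => (a : ℚ))).cramer (fun i => (z i : ℚ)) =
        ((Matrix.of A).map (fun a : ℤ => (a : ℚ))).det • x := by
      rw [← hx, Matrix.cramer_eq_adjugate_mulVec, Matrix.mulVec_mulVec, Matrix.adjugate_mul,
        Matrix.smul_mulVec, Matrix.one_mulVec]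
    have h2 := congrFun h1 k
    rw [Matrix.cramer_apply, Pi.smul_apply, smul_eq_mul] at h2
    have h3 : ((Matrix.of A).map (fun a : ℤ => (a : ℚ))).det = ((Matrix.of A).det : ℚ) := by
      rw [Int.cast_det]
    rw [← h3, ← h2, Int.cast_det]
    congr 1
    ext i j
    simp only [Matrix.map_apply, Matrix.updateCol_apply]
    split_ifs <;> rfl
  have hxk : x k = (((Matrix.of A).updateCol k z).det : ℚ) / ((Matrix.of A).det : ℚ) := by
    rw [hcr, mul_div_cancel_left₀ _ hdet]
  -- The Leibniz formula has `r!` terms, each a product of `r` entries.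
  have hbound : ∀ E : Matrix (Fin r) (Fin r) ℤ, (∀ i j, (E i j).natAbs ≤ N) →
      E.det.natAbs ≤ r.factorial * N ^ r := fun E hE => by
    have := Matrix.det_le (A := E) (abv := AbsoluteValue.abs) (x := (N : ℤ)) fun i j => by
      have := hE i j
      rw [AbsoluteValue.abs_apply, Int.abs_eq_natAbs]
      exact_mod_cast this
    simp only [AbsoluteValue.abs_apply, Fintype.card_fin, nsmul_eq_mul] at this
    zify
    exact_mod_cast this
  rw [hxk]
  refine (ratHeight_div_le _ _ (by exact_mod_cast hdet)).trans (max_le ?_ ?_)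
  · refine hbound _ fun i j => ?_
    rw [Matrix.updateCol_apply]
    split_ifs
    exacts [hzN i, hAN i j]
  · exact hbound _ hAN

/-- A matrix whose rows span has a regular square submatrix made of some of the rows. -/
lemma exists_isUnit_of_span_eq_top {r : ℕ} {S : Set (Fin r → ℚ)} (hS : Submodule.span ℚ S = ⊤) :
    ∃ R : Fin r → Fin r → ℚ, (∀ j, R j ∈ S) ∧ IsUnit (Matrix.of R) := by
  obtain ⟨s, hs, hspan, hli⟩ := exists_linearIndependent ℚ S
  rw [hS] at hspan
  let bas := Module.Basis.mk hli (by rw [Subtype.range_coe, hspan])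
  have := Module.Finite.finite_basis bas
  have := Fintype.ofFinite s
  have hcard : Fintype.card s = r := by
    rw [← Module.finrank_eq_card_basis bas, Module.finrank_fin_fun]
  let e : Fin r ≃ s := (Fintype.equivFinOfCardEq hcard).symm
  refine ⟨fun j => e j, fun j => hs (e j).2, ?_⟩
  rw [← Matrix.linearIndependent_rows_iff_isUnit]
  exact hli.comp e e.injective

/-- Every `g` in the span is the sum of the `b` in `B` weighted by the coefficients of `g` at their
leading monomials. Thus the coefficients of `B` at `α` solve a linear system whose matrix and
right-hand side consist of coefficients of members of `G`. Since `G` spans, `B.length` of its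
members give a regular matrix, and Cramer's rule applies. The bound does not depend on how the
elimination proceeded. -/
lemma IsEchelon.ratHeight_coeff_le (h : IsEchelon B) {G : List (MvPolynomial (Fin n) ℚ)}
    (hG : Submodule.span ℚ {g | g ∈ G} = Submodule.span ℚ {b | b ∈ B}) {c N : ℕ} (hc : c ≠ 0)
    (hGN : ∀ g ∈ G, ∀ α, ∃ z : ℤ, c * g.coeff α = z ∧ z.natAbs ≤ N) (hb : b ∈ B)
    (α : Fin n →₀ ℕ) : ratHeight (b.coeff α) ≤ B.length.factorial * N ^ B.length := by
  set r := B.length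
  let φ : MvPolynomial (Fin n) ℚ →ₗ[ℚ] (Fin r → ℚ) :=
    LinearMap.pi fun k => MvPolynomial.lcoeff ℚ (degLex.degree (B[k]))
  have hφ : ∀ u k, φ u k = u.coeff (degLex.degree (B[k])) := fun u k => rfl
  have hunit : ∀ k : Fin r, φ (B[k]) = Pi.single k 1 := fun k => by
    ext l
    rw [hφ, Pi.single_apply]
    split_ifs with hkl
    · subst hkl
      exact h.coeff_degree (List.getElem_mem _)
    · refine h.coeff_eq_zero (List.getElem_mem _) (List.getElem_mem _) fun e => hkl ?_
      exact Fin.ext (((List.Nodup.getElem_inj_iff h.nodup).1 e).symm)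
  have htop : Submodule.span ℚ (φ '' {g | g ∈ G}) = ⊤ := by
    rw [← Submodule.map_span, hG, eq_top_iff, ← (Pi.basisFun ℚ (Fin r)).span_eq,
      Submodule.span_le]
    rintro _ ⟨k, rfl⟩
    rw [Pi.basisFun_apply, ← hunit]
    exact Submodule.mem_map_of_mem (Submodule.subset_span (List.getElem_mem _))
  obtain ⟨R, hR, hRu⟩ := exists_isUnit_of_span_eq_top htop
  choose g hg hgR using hR
  obtain ⟨k, hk, rfl⟩ := List.getElem_of_mem hb
  refine ratHeight_le_of_mulVec_eq (Matrix.of R) (fun k => (B[k]).coeff α)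
    (fun j => (g j).coeff α) hRu ?_ hc (fun i j => ?_) (fun i => hGN _ (hg i) α) ⟨k, hk⟩
  · ext j
    have h1 : g j ∈ Submodule.span ℚ {b | b ∈ B} := hG ▸ Submodule.subset_span (hg j)
    have h2 := h.projLog_eq_iff.2 h1
    conv_rhs => rw [← h2, _root_.projLog_fst]
    rw [Matrix.mulVec, dotProduct, ← Fin.sum_univ_fun_getElem, coeff_sum]
    refine Finset.sum_congr rfl fun k _ => ?_
    rw [coeff_C_mul, Matrix.of_apply, ← hgR, hφ]
    rfl
  · rw [Matrix.of_apply, ← hgR, hφ]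
    exact hGN _ (hg i) _

end rref

/-! ## Size bounds -/

section sizes

variable {n : ℕ} {G B : List (MvPolynomial (Fin n) ℚ)} {p u : MvPolynomial (Fin n) ℚ} {S : ℕ}

lemma size_encodePoly_le_of_mem (hp : p ∈ G) : (encodePoly p).size ≤ (encodePolyList G).size :=
  Data.size_le_of_mem (List.mem_map_of_mem hp)

lemma size_encodePolyList_cons (p : MvPolynomial (Fin n) ℚ) (G : List (MvPolynomial (Fin n) ℚ)) :
    (encodePolyList (p :: G)).size = (encodePoly p).size + (encodePolyList G).size + 1 := rfl

lemma length_le_size_encodePolyList (G : List (MvPolynomial (Fin n) ℚ)) :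
    G.length ≤ (encodePolyList G).size := by
  simpa [encodePolyList] using Data.length_le_size (G.map encodePoly)

lemma sum_card_support_le_size (G : List (MvPolynomial (Fin n) ℚ)) :
    (G.map fun g => g.support.card).sum ≤ (encodePolyList G).size := by
  induction G with
  | nil => simp
  | cons g G ih =>
    rw [size_encodePolyList_cons, List.map_cons, List.sum_cons]
    have := card_support_le_size g
    omega

lemma card_biUnion_support_le (G : List (MvPolynomial (Fin n) ℚ)) :
    (G.toFinset.biUnion support).card ≤ (encodePolyList G).size := by
  refine le_trans ?_ (sum_card_support_le_size G)
  induction G with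
  | nil => simp
  | cons g G ih =>
    rw [List.toFinset_cons, Finset.biUnion_insert, List.map_cons, List.sum_cons]
    exact (Finset.card_union_le _ _).trans (Nat.add_le_add_left ih _)

lemma size_encExp_le_of_mem_support {α : Fin n →₀ ℕ} (h : α ∈ p.support) :
    (encExp α).size ≤ (encodePoly p).size := by
  have := termSize_le_size h
  rw [termSize_eq] at this
  omega

/-- The size of a polynomial all of whose monomials occur in `G`. -/
lemma size_encodePoly_le_of_support_subset {b : ℕ}
    (h : ∀ α ∈ p.support, ∃ g ∈ G, α ∈ g.support)
    (hb : ∀ α ∈ p.support, (Data.atom (p.coeff α)).size ≤ b) (hS : (encodePolyList G).size ≤ S) :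
    (encodePoly p).size ≤ S * (b + S + 2) + 2 := by
  refine size_encodePoly_le_of ((Finset.card_le_card fun α hα => ?_).trans
    ((card_biUnion_support_le G).trans hS)) hb fun α hα => ?_
  · obtain ⟨g, hg, hαg⟩ := h α hα
    exact Finset.mem_biUnion.2 ⟨g, List.mem_toFinset.2 hg, hαg⟩
  · obtain ⟨g, hg, hαg⟩ := h α hα
    exact (size_encExp_le_of_mem_support hαg).trans ((size_encodePoly_le_of_mem hg).trans hS)

lemma exists_mem_support_of_mem_span (hp : p ∈ Submodule.span ℚ {g | g ∈ G}) :
    ∀ α ∈ p.support, ∃ g ∈ G, α ∈ g.support := by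
  induction hp using Submodule.span_induction with
  | mem g hg => exact fun α hα => ⟨g, hg, hα⟩
  | zero => simp
  | add p q _ _ hp hq =>
    intro α hα
    rcases Finset.mem_union.1 (support_add hα) with h | h
    exacts [hp α h, hq α h]
  | smul a p _ hp => exact fun α hα => hp α (support_smul hα)

/-- A common denominator of the coefficients. -/
lemma exists_common_denominator (G : List (MvPolynomial (Fin n) ℚ)) :
    ∃ c : ℕ, c ≠ 0 ∧ c ≤ 2 ^ (encodePolyList G).size ∧
      ∀ g ∈ G, ∀ α ∈ g.support, (g.coeff α).den ∣ c := by
  induction G with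
  | nil => exact ⟨1, one_ne_zero, Nat.one_le_two_pow, by simp⟩
  | cons g G ih =>
    obtain ⟨c, hc, hcS, hd⟩ := ih
    refine ⟨(∏ α ∈ g.support, (g.coeff α).den) * c, mul_ne_zero (Finset.prod_ne_zero_iff.2
      fun α _ => (g.coeff α).den_ne_zero) hc, ?_, fun p hp α hα => ?_⟩
    · have h1 : ∏ α ∈ g.support, (g.coeff α).den ≤ 2 ^ (encodePoly g).size := by
        refine (Finset.prod_le_prod' (g := fun α => 2 ^ (termSize g α + 1)) fun α _ => ?_).trans ?_
        · have h2 : (g.coeff α).den ≤ ratHeight (g.coeff α) := le_max_right _ _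
          refine h2.trans ((Data.ratHeight_lt _).le.trans (Nat.pow_le_pow_right two_pos ?_))
          rw [termSize_eq]
          omega
        · rw [Finset.prod_pow_eq_pow_sum, size_encodePoly]
          exact Nat.pow_le_pow_right two_pos (Nat.le_add_right _ _)
      calc _ ≤ 2 ^ (encodePoly g).size * 2 ^ (encodePolyList G).size := Nat.mul_le_mul h1 hcS
        _ ≤ _ := by
          rw [← pow_add, size_encodePolyList_cons]
          exact Nat.pow_le_pow_right two_pos (Nat.le_succ _)
    · rcases List.mem_cons.1 hp with rfl | hp
      · exact (Finset.dvd_prod_of_mem _ hα).mul_right _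
      · exact (hd p hp α hα).mul_left _

/-- A common denominator is at most `2 ^ S` and so is every numerator, hence the exponent `2 * S`.
-/
lemma exists_int_coeffs (G : List (MvPolynomial (Fin n) ℚ)) (hS : (encodePolyList G).size ≤ S) :
    ∃ c : ℕ, c ≠ 0 ∧ ∀ g ∈ G, ∀ α, ∃ z : ℤ, c * g.coeff α = z ∧ z.natAbs ≤ 2 ^ (2 * S) := by
  obtain ⟨c, hc, hcS, hd⟩ := exists_common_denominator G
  refine ⟨c, hc, fun g hg α => ?_⟩
  by_cases hα : α ∈ g.support
  · obtain ⟨k, rfl⟩ := hd g hg α hα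
    refine ⟨k * (g.coeff α).num, ?_, ?_⟩
    · conv_lhs => rw [← Rat.num_div_den (g.coeff α)]
      have : ((g.coeff α).den : ℚ) ≠ 0 := by exact_mod_cast (g.coeff α).den_ne_zero
      push_cast
      rw [Rat.num_div_den]
      conv_lhs => rw [← Rat.num_div_den (g.coeff α)]
      rw [Rat.num_div_den]
      have h2 := Rat.mul_den_eq_num (g.coeff α)
      rw [← h2]
      ring
    · rw [Int.natAbs_mul, Int.natAbs_natCast, two_mul S, pow_add]
      refine Nat.mul_le_mul ?_ ?_
      · refine (Nat.le_mul_of_pos_left _ (g.coeff α).den_pos).trans (hcS.trans ?_)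
        exact Nat.pow_le_pow_right two_pos hS
      · have h2 : (g.coeff α).num.natAbs ≤ ratHeight (g.coeff α) := le_max_left _ _
        refine h2.trans ((Data.ratHeight_lt _).le.trans (Nat.pow_le_pow_right two_pos ?_))
        have h3 := termSize_le_size hα
        rw [termSize_eq] at h3
        have h4 := size_encodePoly_le_of_mem hg
        omega
  · exact ⟨0, by rw [notMem_support_iff.1 hα]; simp, by simp⟩

/-- With at most `S` basis elements, Cramer's bound is at most `2 ^ (S * S) * 2 ^ (2 * S * S)`.
Applied to the prefixes of `G`, it controls every intermediate basis of the elimination. -/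
lemma size_elim_le (hS : (encodePolyList G).size ≤ S) :
    (encodePolyList (elim G).1).size ≤ S * (S * (2 * (3 * S * S + 1) + 1 + S + 2) + 2 + 1) + 2 := by
  have hech := isEchelon_elim G
  have hspan := span_elim G
  obtain ⟨c, hc, hcoef⟩ := exists_int_coeffs G hS
  have hlen : (elim G).1.length ≤ S :=
    (length_elim_le G).trans ((length_le_size_encodePolyList G).trans hS)
  refine (Data.size_ofList_le_of_forall (b := S * (2 * (3 * S * S + 1) + 1 + S + 2) + 2) ?_).trans ?_
  · intro a ha
    obtain ⟨b, hb, rfl⟩ := List.mem_map.1 ha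
    refine size_encodePoly_le_of_support_subset (G := G) (exists_mem_support_of_mem_span
      (hspan ▸ Submodule.subset_span hb)) (fun α _ => Data.size_atom_le_of_ratHeight_lt ?_) hS
    have h1 := hech.ratHeight_coeff_le hspan.symm hc hcoef hb α
    have h2 : (elim G).1.length.factorial ≤ 2 ^ (S * S) := by
      refine (Nat.factorial_le hlen).trans ((Nat.factorial_le_pow S).trans ?_)
      rw [pow_mul]
      exact Nat.pow_le_pow_left Nat.lt_two_pow_self.le _
    have h3 : (2 ^ (2 * S)) ^ (elim G).1.length ≤ 2 ^ (2 * S * S) := by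
      rw [← pow_mul]
      exact Nat.pow_le_pow_right two_pos (Nat.mul_le_mul_left _ hlen)
    refine (h1.trans (Nat.mul_le_mul h2 h3)).trans_lt ?_
    rw [← pow_add]
    refine Nat.pow_lt_pow_right one_lt_two ?_
    nlinarith
  · rw [List.length_map]
    gcongr

lemma ratHeight_list_sum_le {H : ℕ} {l : List ℚ} (h : ∀ q ∈ l, ratHeight q ≤ H) :
    ratHeight l.sum ≤ (2 * H) ^ l.length := by
  induction l with
  | nil => simp [ratHeight]
  | cons q l ih =>
    rw [List.sum_cons, List.length_cons, pow_succ', mul_assoc]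
    exact (ratHeight_add_le _ _).trans (Nat.mul_le_mul_left _ (Nat.mul_le_mul (h q (by simp))
      (ih fun q hq => h q (by simp [hq]))))

lemma ratHeight_coeff_le (hS : (encodePoly p).size ≤ S) (α : Fin n →₀ ℕ) :
    ratHeight (p.coeff α) ≤ 2 ^ S := by
  by_cases hα : α ∈ p.support
  · refine (Data.ratHeight_lt _).le.trans (Nat.pow_le_pow_right two_pos ?_)
    have := termSize_le_size hα
    rw [termSize_eq] at this
    omega
  · rw [notMem_support_iff.1 hα]
    exact (Nat.one_le_two_pow (n := S)).trans' (by simp [ratHeight])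

/-- The coefficients are sums of at most `S` products of height at most `2 ^ (2 * S)`. For prefixes
of `B` the lemma bounds the partial sums of a projection. -/
lemma size_projLog_le (hB : (encodePolyList B).size ≤ S) (hu : (encodePoly u).size ≤ S) :
    (encodePoly (projLog B u).1).size ≤ S * (2 * ((2 * S + 1) * S + 1) + 1 + S + 2) + 2 := by
  refine size_encodePoly_le_of_support_subset (exists_mem_support_of_mem_span
    (projLog_mem_span B u)) (fun α _ => Data.size_atom_le_of_ratHeight_lt ?_) hB
  rw [projLog_fst, ← lcoeff_apply ℚ, map_list_sum, List.map_map]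
  refine (ratHeight_list_sum_le (H := 2 ^ S * 2 ^ S) fun q hq => ?_).trans_lt ?_
  · obtain ⟨b, hb, rfl⟩ := List.mem_map.1 hq
    rw [Function.comp_apply, lcoeff_apply, coeff_C_mul]
    exact (ratHeight_mul_le _ _).trans (Nat.mul_le_mul (ratHeight_coeff_le hu _)
      (ratHeight_coeff_le ((size_encodePoly_le_of_mem hb).trans hB) _))
  · rw [← pow_add, ← pow_succ', ← pow_mul, List.length_map]
    refine Nat.pow_lt_pow_right one_lt_two (Nat.lt_succ_of_le ?_)
    have := (length_le_size_encodePolyList B).trans hB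
    rw [← two_mul]
    exact Nat.mul_le_mul_left _ this

lemma size_encList_flatMap_le {α β : Type} {ea : α → Data} {eb : β → Data} {f : α → List β}
    {c : ℕ} {l : List α} (h : ∀ a ∈ l, (encList eb (f a)).size ≤ c * ((ea a).size + 1) + 2) :
    (encList eb (l.flatMap f)).size + 2 * c ≤ c * (encList ea l).size + 2 := by
  induction l with
  | nil =>
    simp only [List.flatMap_nil, encList, List.map_nil, Data.size_ofList, List.sum_nil]
    omega
  | cons a l ih =>
    have h1 := ih fun a ha => h a (by simp [ha])
    have h2 := h a (by simp)
    have h3 := Data.size_ofList_append ((f a).map eb) ((l.flatMap f).map eb)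
    rw [List.flatMap_cons, encList, List.map_append]
    have h4 : (encList ea (a :: l)).size = (ea a).size + (encList ea l).size + 1 := rfl
    rw [h4]
    simp only [encList] at *
    nlinarith

lemma size_encList_flatMap_le_of_forall {α β : Type} {eb : β → Data} {f : α → List β} {w : ℕ}
    {l : List α} (h : ∀ a ∈ l, (encList eb (f a)).size ≤ w + 2) :
    (encList eb (l.flatMap f)).size ≤ l.length * w + 2 := by
  induction l with
  | nil => simp [encList, Data.size_ofList]
  | cons a l ih =>
    have h1 := ih fun a ha => h a (by simp [ha])
    have h2 := h a (by simp)
    have h3 := Data.size_ofList_append ((f a).map eb) ((l.flatMap f).map eb)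
    rw [List.flatMap_cons, encList, List.map_append, List.length_cons]
    simp only [encList] at *
    nlinarith

lemma size_multStep_le (G : List (MvPolynomial (Fin n) ℚ)) :
    (encodePolyList (multStep G).1).size ≤ (encodePolyList G).size * (1 + 2 * n) := by
  have h1 := size_encList_flatMap_le (ea := encodePoly) (eb := encodePoly) (c := 2 * n) (l := G)
    (f := fun g => (List.finRange n).map fun i => X i * g) fun g _ => by
      refine (Data.size_ofList_le_of_forall (b := 2 * (encodePoly g).size) ?_).trans ?_
      · intro a ha
        simp only [List.mem_map] at ha
        obtain ⟨_, ⟨i, -, rfl⟩, rfl⟩ := ha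
        exact size_encodePoly_X_mul_le i g
      · simp only [List.length_map, List.length_finRange]
        nlinarith
  have h2 := Data.size_ofList_append (G.map encodePoly)
    ((G.flatMap fun g => (List.finRange n).map fun i => X i * g).map encodePoly)
  rw [multStep, encodePolyList, List.map_append]
  simp only [encodePolyList, encList] at *
  nlinarith

lemma size_mults_le (k : ℕ) (G : List (MvPolynomial (Fin n) ℚ)) :
    (encodePolyList (mults k G).1).size ≤ (encodePolyList G).size * (1 + 2 * n) ^ k := by
  induction k with
  | zero => simp [mults, foldlLog_nil]
  | succ k ih =>
    rw [mults_succ, pow_succ, ← mul_assoc]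
    exact (size_multStep_le _).trans (Nat.mul_le_mul_right _ ih)

lemma prods_succ (n : ℕ) (tab : List (MvPolynomial (Fin 1) ℚ)) (k : ℕ) :
    prods n tab (k + 1) = prods n tab k ++ (prods n tab k).flatMap fun u =>
      (List.finRange n).flatMap fun i => tab.map fun t => rename (fun _ => i) t * u := by
  rw [prods, List.range_succ, List.foldl_concat]
  rfl

/-- The table is fixed, so each round multiplies the size by at most `1 + c * n`, with `c`
independent of `n` and `k`. -/
lemma exists_size_prods_le (tab : List (MvPolynomial (Fin 1) ℚ)) : ∃ c, ∀ n k,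
    (encodePolyList (prods n tab k)).size ≤
      (encodePoly (1 : MvPolynomial (Fin n) ℚ)).size * 4 * (1 + c * n) ^ k := by
  obtain ⟨c, hc⟩ : ∃ c, ∀ (n : ℕ) (i : Fin n) (u : MvPolynomial (Fin n) ℚ),
      (encodePolyList (tab.map fun t => rename (fun _ => i) t * u)).size ≤
        c * ((encodePoly u).size + 1) + 2 := by
    induction tab with
    | nil => exact ⟨0, fun n i u => by simp [encodePolyList, Data.size_ofList]⟩
    | cons t tab ih =>
      obtain ⟨c, hc⟩ := ih
      obtain ⟨c', hc'⟩ := exists_size_encodePoly_rename_mul_le t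
      refine ⟨c + c' + 1, fun n i u => ?_⟩
      have h1 := hc n i u
      have h2 := hc' n (fun _ => i) u
      rw [List.map_cons, size_encodePolyList_cons]
      nlinarith
  refine ⟨c, fun n k => ?_⟩
  induction k with
  | zero =>
    have := Data.one_le_size (encodePoly (1 : MvPolynomial (Fin n) ℚ))
    simp only [prods, List.range_zero, List.foldl_nil, size_encodePolyList_cons]
    simp only [encodePolyList, List.map_nil, Data.size_ofList, List.sum_nil, pow_zero]
    omega
  | succ k ih =>
    have h1 := size_encList_flatMap_le (ea := encodePoly) (eb := encodePoly) (c := c * n)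
      (l := prods n tab k) (f := fun u => (List.finRange n).flatMap fun i =>
        tab.map fun t => rename (fun _ => i) t * u) fun u _ => by
          refine (size_encList_flatMap_le_of_forall (l := List.finRange n) fun i _ =>
            hc n i u).trans (le_of_eq ?_)
          rw [List.length_finRange]
          ring
    have h2 := Data.size_ofList_append ((prods n tab k).map encodePoly)
      (((prods n tab k).flatMap fun u => (List.finRange n).flatMap fun i =>
        tab.map fun t => rename (fun _ => i) t * u).map encodePoly)
    rw [prods_succ, encodePolyList, List.map_append, pow_succ, ← mul_assoc]
    refine le_trans ?_ (Nat.mul_le_mul_right _ ih)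
    simp only [encodePolyList, encList] at *
    nlinarith

end sizes

/-! ## Running the algorithm -/

namespace Computes

variable {ι κ : Type} {T : ι → ℕ} {x y : ι → Data} {n k d : ι → ℕ}
  {B G F H U : ∀ i, List (MvPolynomial (Fin (n i)) ℚ)} {g u : ∀ i, MvPolynomial (Fin (n i)) ℚ}
  {v : ∀ i, Fin (n i)}

lemma singleton {α : ι → Type} {ea : ∀ i, α i → Data} {a : ∀ i, α i}
    (ha : Computes T x fun i => ea i (a i)) : Computes T x fun i => encList (ea i) [a i] :=
  cons ha (nil ha.size_left)

lemma projLog (hB : Computes T x fun i => encList encodePoly (B i))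
    (hu : Computes T x fun i => encodePoly (u i)) (h0 : ∀ i, ∀ b ∈ B i, b ≠ 0) :
    Computes T x fun i => encPair encodePoly (encList encodePoly) (projLog (B i) (u i)) := by
  let f : ∀ i, MvPolynomial (Fin (n i)) ℚ → MvPolynomial (Fin (n i)) ℚ → MvPolynomial (Fin (n i)) ℚ ×
    List (MvPolynomial (Fin (n i)) ℚ) := fun i r b => (r + C ((u i).coeff (degLex.degree b)) * b,
      [r + C ((u i).coeff (degLex.degree b)) * b])
  have hsize : PolyBdd (fun j : {j : Σ i, List (MvPolynomial (Fin (n i)) ℚ) // j.2 <+: B j.1} =>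
      T j.1.1) fun j => (encodePoly (j.1.2.foldl (fun s a => (f _ s a).1) 0)).size := by
    have hS := hB.size_right.add hu.size_right
    have := (hS.mul ((((PolyBdd.const 2).mul (((((PolyBdd.const 2).mul hS).add (.const 1)).mul
      hS).add (.const 1))).add (.const 1)).add hS |>.add (.const 2))).add (.const 2)
    refine (this.reindex fun j : {j : Σ i, List (MvPolynomial (Fin (n i)) ℚ) // j.2 <+: B j.1} =>
      j.1.1).mono fun j => ?_
    have h1 := size_projLog_le (B := j.1.2) (u := u j.1.1) (S := (encList encodePoly (B j.1.1)).size +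
      (encodePoly (u j.1.1)).size) ((Data.size_ofList_le_of_sublist
        (j.2.sublist.map encodePoly)).trans (Nat.le_add_right _ _)) (Nat.le_add_left _ _)
    rwa [_root_.projLog, foldlLog_fst] at h1
  refine foldlLog (f := f) (ea := fun _ => encodePoly) (eb := fun _ => encodePoly)
    (ec := fun _ => encodePoly) (b := fun _ => 0) hB (zero hB.size_left) hsize ?_
  have hi := foldId (eb := fun i => encodePoly) (f := fun i s a => (f i s a).1)
    (b := fun _ => 0) hB hsize
  have hu' := foldCtx (eb := fun i => encodePoly) (f := fun i s a => (f i s a).1)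
    (b := fun _ => 0) hB hsize hu
  have h1 := polyAdd hi.snd.fst (C_mul (coeff hu' (degree hi.snd.snd fun j => ?_)) hi.snd.snd)
  · exact h1.pair (singleton (ea := fun _ => encodePoly) h1)
  · obtain ⟨l1, l2, h, -⟩ := j.2
    exact h0 _ _ (by rw [h]; simp)

lemma subMultiples {w : ∀ i, MvPolynomial (Fin (n i)) ℚ}
    (hB : Computes T x fun i => encList encodePoly (B i))
    (hw : Computes T x fun i => encodePoly (w i)) (hw0 : ∀ i, w i ≠ 0) :
    Computes T x fun i => encList encodePoly
      ((B i).map fun b => b - C (b.coeff (degLex.degree (w i))) * w i) :=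
  map (ea := fun _ => encodePoly) (ec := fun _ => encodePoly)
    (f := fun i b => b - C (b.coeff (degLex.degree (w i))) * w i) hB
    (polySub (memVal hB) (C_mul (coeff (memVal hB) (memCtx hB (degree hw hw0))) (memCtx hB hw)))

lemma elimStep (hB : Computes T x fun i => encList encodePoly (B i))
    (hg : Computes T x fun i => encodePoly (g i)) (h0 : ∀ i, ∀ b ∈ B i, b ≠ 0) :
    Computes T x fun i => encPair (encList encodePoly) (encList encodePoly)
      (elimStep (B i) (g i)) := by
  classical
  have hs := projLog hB hg h0
  obtain ⟨v, hv⟩ : ∃ v : ∀ i, MvPolynomial (Fin (n i)) ℚ,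
    ∀ i, v i = g i - (_root_.projLog (B i) (g i)).1 := ⟨_, fun _ => rfl⟩
  obtain ⟨w, hw⟩ : ∃ w : ∀ i, MvPolynomial (Fin (n i)) ℚ,
    ∀ i, w i = C (degLex.leadingCoeff (v i))⁻¹ * v i := ⟨_, fun _ => rfl⟩
  have hs1 : Computes T x fun i => encodePoly (_root_.projLog (B i) (g i)).1 := hs.fst
  have hs2 : Computes T x fun i => encList encodePoly (_root_.projLog (B i) (g i)).2 := hs.snd
  have hcv : Computes T x fun i => encodePoly (v i) := (polySub hg hs1).congr fun i => by rw [hv]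
  have h : Computes T x fun i => if v i = 0 then
      encPair (encList encodePoly) (encList encodePoly) (B i, (_root_.projLog (B i) (g i)).2) else
      encPair (encList encodePoly) (encList encodePoly)
        (w i :: (B i).map fun b => b - C (b.coeff (degLex.degree (w i))) * w i,
        (_root_.projLog (B i) (g i)).2 ++ v i :: w i :: (B i).map fun b =>
          b - C (b.coeff (degLex.degree (w i))) * w i) := by
    refine ite (polyEq hcv (zero hcv.size_left)) ((hB.pair hs2).reindex Subtype.val) ?_
    let σ : {i // ¬ v i = 0} → ι := Subtype.val
    have hcv' := hcv.reindex σ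
    have hcw : Computes (fun j => T (σ j)) (fun j => x (σ j)) fun j => encodePoly (w (σ j)) :=
      (C_mul (inv (leadingCoeff hcv' fun j => j.2)) hcv').congr fun j => by rw [hw]
    have hm := subMultiples (hB.reindex σ) hcw fun j => by
      rw [hw]
      exact mul_ne_zero (by simpa using j.2) j.2
    have hc := cons (ea := fun _ => encodePoly) hcw hm
    exact hc.pair (append (ea := fun _ => encodePoly) (hs2.reindex σ)
      (cons (ea := fun _ => encodePoly) hcv' hc))
  refine h.congr fun i => ?_
  split_ifs with h
  · rw [hv] at h
    rw [elimStep_of_eq h]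
  · rw [elimStep_of_ne (hv i) h (hw i)]

lemma elim (hG : Computes T x fun i => encList encodePoly (G i)) :
    Computes T x fun i => encPair (encList encodePoly) (encList encodePoly) (elim (G i)) := by
  have hsize : PolyBdd (fun j : {j : Σ i, List (MvPolynomial (Fin (n i)) ℚ) // j.2 <+: G j.1} =>
      T j.1.1) fun j => (encList encodePoly (j.1.2.foldl
        (fun s a => (_root_.elimStep s a).1) [])).size := by
    have hS := hG.size_right
    have := (hS.mul (((hS.mul (((((PolyBdd.const 2).mul ((((PolyBdd.const 3).mul hS).mul hS).add
      (.const 1))).add (.const 1)).add hS).add (.const 2))).add (.const 2)).add (.const 1))).add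
      (.const 2)
    refine (this.reindex fun j : {j : Σ i, List (MvPolynomial (Fin (n i)) ℚ) // j.2 <+: G j.1} =>
      j.1.1).mono fun j => ?_
    have h1 := size_elim_le (G := j.1.2) (S := (encList encodePoly (G j.1.1)).size)
      (Data.size_ofList_le_of_sublist (j.2.sublist.map encodePoly))
    rwa [elim_fst] at h1
  refine foldlLog (f := fun _ => _root_.elimStep) (ea := fun _ => encodePoly)
    (eb := fun _ => encList encodePoly) (ec := fun _ => encodePoly) (b := fun _ => []) hG
    (nil hG.size_left) hsize ?_
  have hi := foldId (eb := fun i => encList encodePoly)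
    (f := fun i s a => (_root_.elimStep s a).1) (b := fun _ => []) hG hsize
  refine elimStep hi.snd.fst hi.snd.snd fun j b hb => ?_
  obtain ⟨l1, l2, -, h⟩ := j.2
  rw [h, ← elim_fst] at hb
  exact (isEchelon_elim l1).ne_zero hb

lemma finRange (hn : Computes T x fun i => .ofNat (n i)) (hT : PolyBdd T n) :
    Computes T x fun i => encList encVar (List.finRange (n i)) :=
  (range hn hT).congr fun i => by
    rw [encList, encList, ← List.map_coe_finRange_eq_range, List.map_map]
    rfl

lemma multStep (hn : Computes T x fun i => .ofNat (n i)) (hT : PolyBdd T n)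
    (hG : Computes T x fun i => encList encodePoly (G i)) :
    Computes T x fun i => encPair (encList encodePoly) (encList encodePoly)
      (multStep (G i)) := by
  have h1 : Computes T x fun i => encList encodePoly ((G i).flatMap fun g =>
      (List.finRange (n i)).map fun v => X v * g) := by
    refine flatMap (ea := fun _ => encodePoly) (ec := fun _ => encodePoly)
      (f := fun i g => (List.finRange (n i)).map fun v => X v * g) hG ?_
    have h2 := memCtx hG (finRange hn hT)
    exact map (ea := fun _ => encVar) (ec := fun _ => encodePoly)
      (l := fun j : {j : Σ i, MvPolynomial (Fin (n i)) ℚ // j.2 ∈ G j.1} => List.finRange (n j.1.1))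
      (f := fun j v => X v * j.1.2) h2 (X_mul (memVal h2) (memCtx h2 (memVal hG)))
  exact (append (ea := fun _ => encodePoly) hG h1).pair h1

lemma foldl_multStep (l : List ℕ) {n : ℕ} (G : List (MvPolynomial (Fin n) ℚ)) :
    l.foldl (fun G _ => (_root_.multStep G).1) G = (_root_.mults l.length G).1 := by
  rw [_root_.mults, foldlLog_fst]
  induction l using List.reverseRecOn with
  | nil => rfl
  | append_singleton l a ih =>
    rw [List.foldl_concat, ih, List.length_append, List.length_singleton, List.range_succ,
      List.foldl_concat]

lemma mults (hn : Computes T x fun i => .ofNat (n i)) (hT : PolyBdd T n)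
    (hk : Computes T x fun i => .ofNat (k i)) (hkT : PolyBdd T k)
    (hnk : PolyBdd T fun i => (1 + 2 * n i) ^ k i)
    (hG : Computes T x fun i => encList encodePoly (G i)) :
    Computes T x fun i => encPair (encList encodePoly) (encList encodePoly)
      (mults (k i) (G i)) := by
  have hr := range hk hkT
  have hsize : PolyBdd (fun j : {j : Σ i, List ℕ // j.2 <+: List.range (k j.1)} => T j.1.1)
      fun j => (encList encodePoly (j.1.2.foldl
        (fun s _ => (_root_.multStep s).1) (G j.1.1))).size := by
    refine ((hG.size_right.mul hnk).reindex
      fun j : {j : Σ i, List ℕ // j.2 <+: List.range (k j.1)} => j.1.1).mono fun j => ?_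
    rw [foldl_multStep]
    refine (size_mults_le _ _).trans (Nat.mul_le_mul_left _ (Nat.pow_le_pow_right (by omega) ?_))
    simpa using j.2.length_le
  refine foldlLog (f := fun _ G _ => _root_.multStep G) (ea := fun _ => Data.ofNat)
    (eb := fun _ => encList encodePoly) (ec := fun _ => encodePoly) hr hG hsize ?_
  have hi := foldId (eb := fun i => encList encodePoly)
    (f := fun i s (_ : ℕ) => (_root_.multStep s).1) hr hsize
  exact multStep (foldCtx (eb := fun i => encList encodePoly)
    (f := fun i s (_ : ℕ) => (_root_.multStep s).1) hr hsize hn)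
    (hT.reindex fun j : {j : Σ i, List (MvPolynomial (Fin (n i)) ℚ) × ℕ // ∃ l1 l2,
      List.range (k j.1) = l1 ++ j.2.2 :: l2 ∧ j.2.1 = l1.foldl (fun s _ => (_root_.multStep s).1)
        (G j.1)} => j.1.1) hi.snd.fst

lemma foldl_prods (l : List ℕ) (n : ℕ) (tab : List (MvPolynomial (Fin 1) ℚ)) :
    l.foldl (fun U _ => U ++ U.flatMap fun u => (List.finRange n).flatMap fun i =>
      tab.map fun t => rename (fun _ => i) t * u) [1] = _root_.prods n tab l.length := by
  induction l using List.reverseRecOn with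
  | nil => rfl
  | append_singleton l a ih =>
    rw [List.foldl_concat, ih, List.length_append, List.length_singleton, prods_succ]

lemma map_rename_mul (tab : List (MvPolynomial (Fin 1) ℚ))
    (hv : Computes T x fun i => encVar (v i)) (hu : Computes T x fun i => encodePoly (u i)) :
    Computes T x fun i => encList encodePoly
      (tab.map fun t => rename (fun _ => v i) t * u i) := by
  induction tab with
  | nil => exact nil hu.size_left
  | cons t tab ih => exact cons (ea := fun _ => encodePoly) (rename_mul t (fun _ => hv) hu) ih

lemma prodStep (tab : List (MvPolynomial (Fin 1) ℚ)) (hn : Computes T x fun i => .ofNat (n i))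
    (hT : PolyBdd T n) (hU : Computes T x fun i => encList encodePoly (U i)) :
    Computes T x fun i => encList encodePoly (U i ++ (U i).flatMap fun u =>
      (List.finRange (n i)).flatMap fun v => tab.map fun t => rename (fun _ => v) t * u) := by
  refine append (ea := fun _ => encodePoly) hU (flatMap (ea := fun _ => encodePoly)
    (ec := fun _ => encodePoly) (f := fun i u => (List.finRange (n i)).flatMap fun v =>
      tab.map fun t => rename (fun _ => v) t * u) hU ?_)
  have hfr := memCtx hU (finRange hn hT)
  exact flatMap (ea := fun _ => encVar) (ec := fun _ => encodePoly)
    (l := fun j : {j : Σ i, MvPolynomial (Fin (n i)) ℚ // j.2 ∈ U j.1} => List.finRange (n j.1.1))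
    (f := fun j v => tab.map fun t => rename (fun _ => v) t * j.1.2) hfr
    (map_rename_mul tab (memVal hfr) (memCtx hfr (memVal hU)))

lemma prods (tab : List (MvPolynomial (Fin 1) ℚ)) (hn : Computes T x fun i => .ofNat (n i))
    (hT : PolyBdd T n) (hk : Computes T x fun i => .ofNat (k i)) (hkT : PolyBdd T k)
    (hnk : ∀ c, PolyBdd T fun i => (1 + c * n i) ^ k i) :
    Computes T x fun i => encList encodePoly (prods (n i) tab (k i)) := by
  have hr := range hk hkT
  have h1 := one hn hT
  let f : ∀ i, List (MvPolynomial (Fin (n i)) ℚ) → ℕ → List (MvPolynomial (Fin (n i)) ℚ) :=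
    fun i U _ => U ++ U.flatMap fun u => (List.finRange (n i)).flatMap fun v =>
      tab.map fun t => rename (fun _ => v) t * u
  have hsize : PolyBdd (fun j : {j : Σ i, List ℕ // j.2 <+: List.range (k j.1)} => T j.1.1)
      fun j => (encList encodePoly (j.1.2.foldl (f j.1.1) [1])).size := by
    obtain ⟨c, hc⟩ := exists_size_prods_le tab
    refine (((h1.size_right.mul (.const 4)).mul (hnk c)).reindex
      fun j : {j : Σ i, List ℕ // j.2 <+: List.range (k j.1)} => j.1.1).mono fun j => ?_
    rw [foldl_prods]
    refine (hc _ _).trans (Nat.mul_le_mul_left _ (Nat.pow_le_pow_right (by positivity) ?_))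
    simpa using j.2.length_le
  refine foldl (f := f) (ea := fun _ => Data.ofNat) (b := fun i => [1])
    (eb := fun _ => encList encodePoly) hr (singleton (ea := fun _ => encodePoly) h1) hsize ?_
  exact prodStep tab (foldCtx (eb := fun i => encList encodePoly) (f := f) (b := fun _ => [1]) hr
    hsize hn) (hT.reindex _)
    (foldId (eb := fun i => encList encodePoly) (f := f) (b := fun _ => [1]) hr hsize).snd.fst

lemma roundStep (hn : Computes T x fun i => .ofNat (n i)) (hT : PolyBdd T n)
    (hk : Computes T x fun i => .ofNat (k i)) (hkT : PolyBdd T k)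
    (hnk : PolyBdd T fun i => (1 + 2 * n i) ^ k i)
    (hF : Computes T x fun i => encList encodePoly (F i))
    (hU : Computes T x fun i => encList encodePoly (U i))
    (hH : Computes T x fun i => encList encodePoly (H i)) :
    Computes T x fun i => encPair (encList encodePoly) (encList encodePoly)
      (roundStep (F i) (U i) (k i) (H i)) := by
  classical
  have hM := mults hn hT hk hkT hnk (append (ea := fun _ => encodePoly) hF hH)
  have hE := elim (G := fun i => (_root_.mults (k i) (F i ++ H i)).1) hM.fst
  have hp := projLog (n := fun j : {j : Σ i, MvPolynomial (Fin (n i)) ℚ // j.2 ∈ U j.1} => n j.1.1)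
    (B := fun j => (_root_.elim (_root_.mults (k j.1.1) (F j.1.1 ++ H j.1.1)).1).1)
    (u := fun j => j.1.2) (memCtx hU hE.fst) (memVal hU) fun j b hb =>
    (isEchelon_elim _).ne_zero hb
  have h1 := filter (ea := fun _ => encodePoly) (p := fun i u => decide ((_root_.projLog
    (_root_.elim (_root_.mults (k i) (F i ++ H i)).1).1 u).1 = u)) hU (polyEq hp.fst (memVal hU))
  have h2 := flatMap (ea := fun _ => encodePoly) (ec := fun _ => encodePoly)
    (f := fun i u => (_root_.projLog (_root_.elim (_root_.mults (k i) (F i ++ H i)).1).1 u).2)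
    hU hp.snd
  refine (h1.pair (append (ea := fun _ => encodePoly) hM.snd (append (ea := fun _ => encodePoly)
    hE.snd h2))).congr fun i => ?_
  simp only [_root_.roundStep]

lemma rounds (hn : Computes T x fun i => .ofNat (n i)) (hT : PolyBdd T n)
    (hk : Computes T x fun i => .ofNat (k i)) (hkT : PolyBdd T k)
    (hnk : PolyBdd T fun i => (1 + 2 * n i) ^ k i)
    (hF : Computes T x fun i => encList encodePoly (F i))
    (hU : Computes T x fun i => encList encodePoly (U i)) :
    Computes T x fun i => encPair (encList encodePoly) (encList encodePoly)
      (rounds (F i) (U i) (k i)) := by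
  let f : ∀ i, List (MvPolynomial (Fin (n i)) ℚ) → MvPolynomial (Fin (n i)) ℚ →
    List (MvPolynomial (Fin (n i)) ℚ) × List (MvPolynomial (Fin (n i)) ℚ) :=
    fun i H _ => _root_.roundStep (F i) (U i) (k i) H
  -- The state of every round is a sublist of `U`, which bounds its size uniformly in the number of
  -- rounds.
  have hsub : ∀ i (l : List (MvPolynomial (Fin (n i)) ℚ)),
      (l.foldl (fun s a => (f i s a).1) []).Sublist (U i) := fun i l => by
    induction l using List.reverseRecOn with
    | nil => exact List.nil_sublist _
    | append_singleton l a ih =>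
      rw [List.foldl_concat]
      exact List.filter_sublist
  have hsize : PolyBdd (fun j : {j : Σ i, List (MvPolynomial (Fin (n i)) ℚ) // j.2 <+: U j.1} =>
      T j.1.1) fun j => (encList encodePoly (j.1.2.foldl (fun s a => (f _ s a).1) [])).size :=
    (hU.size_right.reindex fun j : {j : Σ i, List (MvPolynomial (Fin (n i)) ℚ) // j.2 <+: U j.1} =>
      j.1.1).mono fun j => Data.size_ofList_le_of_sublist ((hsub _ _).map _)
  have hi := foldId (eb := fun i => encList encodePoly) (f := fun i s a => (f i s a).1)
    (b := fun _ => []) hU hsize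
  have hc : ∀ {y}, Computes T x y → _ := fun {y} h =>
    foldCtx (eb := fun i => encList encodePoly) (f := fun i s a => (f i s a).1)
      (b := fun _ => []) (y := y) hU hsize h
  exact foldlLog (f := f) (ea := fun _ => encodePoly)
    (eb := fun _ => encList encodePoly) (ec := fun _ => encodePoly) (b := fun _ => []) hU
    (nil hU.size_left) hsize
    (roundStep (hc hn) (hT.reindex _) (hc hk) (hkT.reindex _) (hnk.reindex _) (hc hF) (hc hU)
      hi.snd.fst)

lemma saturate (hn : Computes T x fun i => .ofNat (n i)) (hT : PolyBdd T n)
    (hk : Computes T x fun i => .ofNat (k i)) (hkT : PolyBdd T k)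
    (hnk : PolyBdd T fun i => (1 + 2 * n i) ^ k i)
    (hF : Computes T x fun i => encList encodePoly (F i))
    (hU : Computes T x fun i => encList encodePoly (U i)) :
    Computes T x fun i => encPair (encList encodePoly) (encList encodePoly)
      (saturate (F i) (U i) (k i)) := by
  have hR := rounds hn hT hk hkT hnk hF hU
  have hM := mults hn hT hk hkT hnk (append (ea := fun _ => encodePoly) hF hR.fst)
  have hE := elim hM.fst
  exact hE.fst.pair (append (ea := fun _ => encodePoly) hF (append (ea := fun _ => encodePoly)
    hR.snd (append (ea := fun _ => encodePoly) hM.snd hE.snd)))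

lemma keep (hd : Computes T x fun i => .ofNat (d i))
    (hB : Computes T x fun i => encList encodePoly (B i))
    (hu : Computes T x fun i => encodePoly (u i)) (h0 : ∀ i, ∀ b ∈ B i, b ≠ 0)
    (hu0 : ∀ i, u i ≠ 0) :
    Computes T x fun i => .ofBool (keep (d i) (B i) (u i)) := by
  classical
  have hdeg := degree hu hu0
  have hdeg' := degree (memVal hB) fun j => h0 _ _ j.2
  have h1 := natLe (natSum hdeg) hd
  have h2 := isNil (filter (ea := fun _ => encodePoly) (p := fun i b' =>
    decide (degLex.degree b' ≤ degLex.degree (u i)) && !decide (b' = u i)) hB (and (monLe hdeg' (memCtx hB hdeg))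
    (not (polyEq (memVal hB) (memCtx hB hu)))))
  refine (and h1 h2).congr fun i => ?_
  simp only [_root_.keep]

lemma output (hn : Computes T x fun i => .ofNat (n i)) (hT : PolyBdd T n)
    (hk : Computes T x fun i => .ofNat (k i)) (hkT : PolyBdd T k)
    (hnk : PolyBdd T fun i => (1 + 2 * n i) ^ k i) (hd : Computes T x fun i => .ofNat (d i))
    (hF : Computes T x fun i => encList encodePoly (F i))
    (hU : Computes T x fun i => encList encodePoly (U i)) :
    Computes T x fun i => encodeOutput (output (F i) (U i) (k i) (d i)) := by
  classical
  have hS := saturate hn hT hk hkT hnk hF hU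
  have hS1 : Computes T x fun i => encList encodePoly (_root_.saturate (F i) (U i) (k i)).1 := hS.fst
  have hS2 : Computes T x fun i => encList encodePoly (_root_.saturate (F i) (U i) (k i)).2 := hS.snd
  have h0 : ∀ i, ∀ b ∈ (_root_.saturate (F i) (U i) (k i)).1, b ≠ 0 := fun i b hb =>
    (isEchelon_elim _).ne_zero hb
  have hf := filter (ea := fun _ => encodePoly)
    (p := fun i b => _root_.keep (d i) (_root_.saturate (F i) (U i) (k i)).1 b) hS1
    (keep (n := fun j : {j : Σ i, MvPolynomial (Fin (n i)) ℚ //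
      j.2 ∈ (_root_.saturate (F j.1) (U j.1) (k j.1)).1} => n j.1.1)
      (B := fun j => (_root_.saturate (F j.1.1) (U j.1.1) (k j.1.1)).1) (u := fun j => j.1.2)
      (memCtx hS1 hd) (memCtx hS1 hS1) (memVal hS1) (fun j => h0 j.1.1) fun j => h0 _ _ j.2)
  have hz := filter (ea := fun _ => encodePoly) (p := fun i p => !decide (p = 0)) hS2
    (not (polyEq (memVal hS2) (zero (memVal hS2).size_left)))
  have hm := map (ea := fun _ => encodePoly) (ec := fun _ => encPair encodePoly (encList encodePoly))
    (f := fun i g => (g, (_root_.saturate (F i) (U i) (k i)).2.filter (fun p => !decide (p = 0)) ++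
      [g])) hf ((memVal hf).pair (append (ea := fun _ => encodePoly) (memCtx hf hz)
        (singleton (ea := fun _ => encodePoly) (memVal hf))))
  refine hm.congr fun i => ?_
  simp only [_root_.output, encodeOutput]
  congr!

end Computes

/-! ## Reading the input -/

namespace Computes

variable {ι κ : Type} {T : ι → ℕ} {x y : ι → Data} {n : ι → ℕ}

/-- Nested branching of fixed depth `m`: a different program may be used for each value of `a`. This
is how a program depends on the relation of a constraint. -/
lemma natCases {ι : Type} {T : ι → ℕ} {x y : ι → Data} (hx : PolyBdd T fun i => (x i).size)
    (m : ℕ) {a : ι → ℕ} (ha : Computes T x fun i => .ofNat (a i)) (hm : ∀ i, a i < m)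
    (h : ∀ k < m, Computes (fun i : {i // a i = k} => T i) (fun i => x i) fun i => y i) :
    Computes T x y := by
  induction m generalizing ι with
  | zero =>
    refine (const hx (.atom 0)).congr fun i => ?_
    exact absurd (hm i) (Nat.not_lt_zero _)
  | succ m ih =>
    refine (ite (p := fun i => a i = m) (y := y) (z := y)
      (eqEnc (e := fun _ => Data.ofNat) (fun _ => Data.ofNat_injective) ha (const hx (.ofNat m)))
      (h m (Nat.lt_succ_self m)) ?_).congr fun i => ite_self _
    refine ih (hx.reindex Subtype.val) (ha.reindex Subtype.val) (fun i => ?_) fun k hk => ?_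
    · have h1 := hm i.1
      have h2 : a i.1 ≠ m := i.2
      change a i.1 < m
      omega
    · exact (h k (hk.trans (Nat.lt_succ_self m))).reindex
        fun j : {i : {i // ¬ a i = m} // a i.1 = k} => ⟨j.1.1, j.2⟩

lemma getElem {α : ι → Type} {ea : ∀ i, α i → Data} (m : ℕ) {l : ∀ i, List (α i)}
    (hl : Computes T x fun i => encList (ea i) (l i)) (hm : ∀ i, m < (l i).length) :
    Computes T x fun i => ea i ((l i)[m]'(hm i)) := by
  induction m generalizing l with
  | zero =>
    refine hl.fst.congr fun i => ?_
    obtain ⟨a, t, h⟩ := List.exists_cons_of_length_pos (hm i)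
    simp only [h]
    rfl
  | succ m ih =>
    refine (ih (l := fun i => (l i).tail) (hl.snd.congr fun i => ?_) fun i => ?_).congr fun i => ?_
    · obtain ⟨a, t, h⟩ := List.exists_cons_of_length_pos (Nat.zero_lt_of_lt (hm i))
      simp only [h]
      rfl
    · have := hm i
      rw [List.length_tail]
      omega
    · rw [List.getElem_tail]

variable {D : Finset ℚ} {Γ : ConstraintLanguage D}

lemma constraintPoly (f : DefiningPolys Γ) {c : ∀ i, Constraint Γ (n i)}
    (hn : Computes T x fun i => .ofNat (n i)) (hT : PolyBdd T n)
    (hc : Computes T x fun i => (c i).encode) :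
    Computes T x fun i => encodePoly (rename (c i).scope (f.poly (c i).idx)) := by
  refine natCases hc.size_left Γ.num (a := fun i => (c i).idx) hc.fst (fun i => (c i).idx.2)
    fun k hk => ?_
  obtain ⟨j, rfl⟩ : ∃ j : Fin Γ.num, j.1 = k := ⟨⟨k, hk⟩, rfl⟩
  let κ := {i // ((c i).idx : ℕ) = j}
  have hidx : ∀ i : κ, (c i).idx = j := fun i => Fin.ext i.2
  have hs : Computes (fun i : κ => T i) (fun i => x i) fun i => encList encVar
      (List.ofFn (c i).scope) := (hc.snd.reindex (Subtype.val : κ → ι)).congr fun i => by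
    rw [encList, List.map_ofFn]
    rfl
  have hv : ∀ l : Fin (Γ.arity j), Computes (fun i : κ => T i) (fun i => x i)
      fun i => encVar ((c i).scope (Fin.cast (by rw [hidx]) l)) := fun l =>
    (getElem l.1 hs fun i => by rw [List.length_ofFn, hidx]; exact l.2).congr fun i => by
      rw [List.getElem_ofFn]
      rfl
  refine (rename_mul (f.poly j) (v := fun (i : κ) l => (c i).scope (Fin.cast (by rw [hidx]) l)) hv
    ((one hn hT).reindex (Subtype.val : κ → ι))).congr fun i => ?_
  -- Generalizing the constraint allows `c.idx = j` to be eliminated, although the types of the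
  -- scope and of the polynomial depend on the index.
  have key : ∀ (c : Constraint Γ (n i)) (j : Fin Γ.num) (h : c.idx = j),
      rename (fun l => c.scope (Fin.cast (by rw [h]) l)) (f.poly j) * 1 = rename c.scope (f.poly c.idx) := by
    rintro c _ rfl
    rw [mul_one]
    rfl
  rw [key _ _ (hidx i)]

end Computes

lemma domainPoly_eq_rename (D : Finset ℚ) {n : ℕ} (i : Fin n) :
    domainPoly D i = rename (fun _ => i) (domainPoly D (0 : Fin 1)) := by
  simp [domainPoly, map_prod]

/-- The polynomials of an instance, as a list. -/
noncomputable def CSPInstance.axiomList {D : Finset ℚ} {Γ : ConstraintLanguage D} {n : ℕ}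
    (I : CSPInstance Γ n) (f : DefiningPolys Γ) : List (MvPolynomial (Fin n) ℚ) :=
  (I.constraints.map fun c => rename c.scope (f.poly c.idx)) ++
    (List.finRange n).map (domainPoly D)

/-! ### Bounds in terms of the time scale, and the computation of the output from the input. -/

section input

variable {D : Finset ℚ} {Γ : ConstraintLanguage D}

lemma CSPInstance.mem_axiomList {n : ℕ} (I : CSPInstance Γ n) (f : DefiningPolys Γ)
    {p : MvPolynomial (Fin n) ℚ} : p ∈ I.axiomList f ↔ p ∈ I.axiomPolys f := by
  simp only [axiomList, axiomPolys, List.mem_append, List.mem_map, List.mem_finRange, true_and,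
    Set.mem_union, Set.mem_ofPred_eq, Set.mem_range, eq_comm]

/-- The inputs: `n`, `d` and an instance on `n` variables. -/
abbrev Input (Γ : ConstraintLanguage D) : Type := Σ n : ℕ, ℕ × CSPInstance Γ n

/-- The time scale `n ^ d`. -/
abbrev timeScale (i : Input Γ) : ℕ := max i.1 2 ^ max i.2.1 1

abbrev Input.enc (i : Input Γ) : Data := i.2.2.encode i.2.1

lemma le_timeScale (i : Input Γ) : max i.1 2 ≤ timeScale i :=
  Nat.le_self_pow (by omega) _

lemma polyBdd_vars : PolyBdd (timeScale (Γ := Γ)) fun i => i.1 :=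
  PolyBdd.self.mono fun i => (le_max_left _ _).trans (le_timeScale i)

lemma polyBdd_deg : PolyBdd (timeScale (Γ := Γ)) fun i => i.2.1 :=
  PolyBdd.self.mono fun i => (Nat.lt_two_pow_self (n := i.2.1)).le.trans
    ((Nat.pow_le_pow_left (le_max_right i.1 2) _).trans
      (Nat.pow_le_pow_right (by omega) (le_max_left _ _)))

/-- With `N = max n 2`, the base is at most `N ^ (c + 2)` and `d + 1 ≤ 2 * max d 1`, so the exponent
of `N` is a constant times `max d 1`. -/
lemma polyBdd_pow (c e : ℕ) :
    PolyBdd (timeScale (Γ := Γ)) fun i => (1 + c * i.1) ^ (e * (i.2.1 + 1)) := by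
  refine (PolyBdd.self.pow ((c + 2) * (2 * e))).mono fun i => ?_
  have h1 : 1 + c * i.1 ≤ max i.1 2 ^ (c + 2) := by
    have h2 : c + 1 ≤ max i.1 2 ^ (c + 1) :=
      Nat.lt_two_pow_self.le.trans (Nat.pow_le_pow_left (le_max_right _ _) _)
    calc 1 + c * i.1 ≤ (c + 1) * max i.1 2 := by
          have := le_max_left i.1 2
          have := le_max_right i.1 2
          nlinarith
      _ ≤ max i.1 2 ^ (c + 1) * max i.1 2 := Nat.mul_le_mul_right _ h2
      _ = _ := (pow_succ _ _).symm
  refine (Nat.pow_le_pow_left h1 _).trans ?_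
  rw [← pow_mul, ← pow_mul]
  refine Nat.pow_le_pow_right (by omega) ?_
  have h3 : i.2.1 + 1 ≤ 2 * max i.2.1 1 := by omega
  calc (c + 2) * (e * (i.2.1 + 1)) ≤ (c + 2) * (e * (2 * max i.2.1 1)) := by gcongr
    _ = _ := by ring

lemma size_ofNat_le (k : ℕ) : (Data.ofNat k).size ≤ k + 2 := by
  rw [Data.size_ofNat]
  exact Nat.add_le_add_right (Nat.size_le.2 Nat.lt_two_pow_self) _

lemma Constraint.size_encode_le {n : ℕ} (c : Constraint Γ n) :
    c.encode.size ≤ Γ.num + (∑ j, Γ.arity j) * (n + 3) + 5 := by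
  have h1 := size_ofNat_le c.idx
  have h2 := Data.size_ofList_le_of_forall (l := List.ofFn fun i => Data.ofNat (c.scope i))
    (b := n + 2) fun a ha => by
      obtain ⟨i, rfl⟩ := List.mem_ofFn.1 ha
      exact (size_ofNat_le _).trans (Nat.add_le_add_right (c.scope i).2.le _)
  have h3 : Γ.arity c.idx ≤ ∑ j, Γ.arity j :=
    Finset.single_le_sum (f := Γ.arity) (fun _ _ => Nat.zero_le _) (Finset.mem_univ _)
  have h4 := c.idx.2
  rw [List.length_ofFn] at h2
  have h5 := Nat.mul_le_mul_right (n + 3) h3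
  rw [show n + 2 + 1 = n + 3 from rfl] at h2
  simp only [encode, Data.size]
  omega

/-- Constraints are not repeated and arities are fixed, so their number is polynomial in `n`. For
this reason the time bound need not mention the size of the instance. -/
lemma CSPInstance.length_constraints_le {n : ℕ} (I : CSPInstance Γ n) :
    I.constraints.length ≤ ∑ j, n ^ Γ.arity j := by
  let e : Constraint Γ n → Σ j, Fin (Γ.arity j) → Fin n := fun c => ⟨c.idx, c.scope⟩
  have he : Function.Injective e := by
    rintro ⟨j, s⟩ ⟨j', s'⟩ h
    simp only [e, Sigma.mk.injEq] at h
    obtain ⟨rfl, h⟩ := h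
    rw [eq_of_heq h]
  have := (I.nodup.map he).length_le_card
  simpa using this

lemma polyBdd_input : PolyBdd (timeScale (Γ := Γ)) fun i => i.enc.size := by
  have hA : PolyBdd (timeScale (Γ := Γ)) fun i => ∑ j, i.1 ^ Γ.arity j := by
    have : ∀ s : Finset (Fin Γ.num), PolyBdd (timeScale (Γ := Γ))
        fun i => ∑ j ∈ s, i.1 ^ Γ.arity j := fun s => by
      induction s using Finset.induction_on with
      | empty => exact (PolyBdd.const 0).mono fun i => by simp
      | insert j s hj ih =>
        exact ((polyBdd_vars.pow _).add ih).mono fun i => by rw [Finset.sum_insert hj]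
    exact this _
  have hB := ((PolyBdd.const (T := timeScale (Γ := Γ)) Γ.num).add
    ((PolyBdd.const (∑ j, Γ.arity j)).mul (polyBdd_vars.add (.const 3)))).add (.const 5)
  refine (((polyBdd_vars.add (.const 2)).add (polyBdd_deg.add (.const 2))).add
    (((hA.mul (hB.add (.const 1))).add (.const 2)).add (.const 2))).mono fun i => ?_
  have h1 := size_ofNat_le i.1
  have h2 := size_ofNat_le i.2.1
  have h3 := Data.size_ofList_le_of_forall (l := i.2.2.constraints.map Constraint.encode)
    (b := Γ.num + (∑ j, Γ.arity j) * (i.1 + 3) + 5) fun a ha => by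
      obtain ⟨c, -, rfl⟩ := List.mem_map.1 ha
      exact c.size_encode_le
  rw [List.length_map] at h3
  have h4 := Nat.mul_le_mul_right (Γ.num + (∑ j, Γ.arity j) * (i.1 + 3) + 5 + 1)
    i.2.2.length_constraints_le
  simp only [Input.enc, CSPInstance.encode, Data.size]
  omega

lemma computes_axiomList (f : DefiningPolys Γ) :
    Computes (timeScale (Γ := Γ)) Input.enc fun i => encList encodePoly (i.2.2.axiomList f) := by
  have hi : Computes (timeScale (Γ := Γ)) Input.enc Input.enc := .id polyBdd_input
  have hn : Computes (timeScale (Γ := Γ)) Input.enc fun i => .ofNat i.1 := hi.fst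
  have hc : Computes (timeScale (Γ := Γ)) Input.enc fun i =>
    encList Constraint.encode i.2.2.constraints := hi.snd.snd
  have hr := Computes.finRange hn polyBdd_vars
  have h1 := Computes.one (n := fun j : {j : Σ i : Input Γ, Fin i.1 // j.2 ∈ List.finRange j.1.1} =>
    j.1.1.1) (.memCtx hr hn) (polyBdd_vars.reindex _)
  refine Computes.append (ea := fun _ => encodePoly)
    (.map (ea := fun _ => Constraint.encode) (ec := fun _ => encodePoly)
      (f := fun i c => rename c.scope (f.poly c.idx)) hc
      (Computes.constraintPoly f (.memCtx hc hn) (polyBdd_vars.reindex _) (.memVal hc)))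
    (.map (ea := fun _ => encVar) (ec := fun _ => encodePoly) (f := fun i => domainPoly D) hr
      ((Computes.rename_mul (domainPoly D (0 : Fin 1)) (v := fun j _ => j.1.2)
        (fun _ => .memVal hr) h1).congr fun j => ?_))
  rw [mul_one, ← domainPoly_eq_rename]

lemma computes_output (f : DefiningPolys Γ) (tab : List (MvPolynomial (Fin 1) ℚ)) (e : ℕ) :
    Computes (timeScale (Γ := Γ)) Input.enc fun i => encodeOutput (output (i.2.2.axiomList f)
      (prods i.1 tab (i.2.1 + 1)) (e * (i.2.1 + 1)) i.2.1) := by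
  have hi : Computes (timeScale (Γ := Γ)) Input.enc Input.enc := .id polyBdd_input
  have hn : Computes (timeScale (Γ := Γ)) Input.enc fun i => .ofNat i.1 := hi.fst
  have hd : Computes (timeScale (Γ := Γ)) Input.enc fun i => .ofNat i.2.1 := hi.snd.fst
  have hd1 := hd.natAdd (.const hi.size_left (.ofNat 1))
  exact .output hn polyBdd_vars ((Computes.const hi.size_left (.ofNat e)).natMul hd1)
    ((PolyBdd.const e).mul (polyBdd_deg.add (.const 1))) (polyBdd_pow 2 e) hd
    (computes_axiomList f) (.prods tab hn polyBdd_vars hd1 (polyBdd_deg.add (.const 1)) fun c =>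
      (polyBdd_pow c 1).mono fun i => by rw [one_mul])

end input

/-! ## Indicator polynomials on a finite semilattice -/

section indicators

variable {A : Type} [Fintype A] [DecidableEq A] {ν : A → ℚ} {n : ℕ}

/-- The indicator polynomial of the point `a`. -/
noncomputable def pointPoly (ν : A → ℚ) (a : A) : MvPolynomial (Fin 1) ℚ :=
  ∏ c ∈ Finset.univ.erase a, (C (ν a - ν c)⁻¹ * (X 0 - C (ν c)))

/-- The substitution of the variable `x_i` in a polynomial in one variable. -/
noncomputable abbrev atVar (i : Fin n) (t : MvPolynomial (Fin 1) ℚ) : MvPolynomial (Fin n) ℚ :=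
  rename (fun _ => i) t

/-- The value of a polynomial at a tuple of elements of `A`. -/
noncomputable abbrev evalAt (ν : A → ℚ) (x : Fin n → A) : MvPolynomial (Fin n) ℚ →+* ℚ :=
  eval fun i => ν (x i)

lemma totalDegree_pointPoly_le (ν : A → ℚ) (a : A) :
    (pointPoly ν a).totalDegree ≤ Fintype.card A := by
  refine (totalDegree_finsetProd _ _).trans ((Finset.sum_le_card_nsmul _ _ 1 fun c _ => ?_).trans ?_)
  · refine (totalDegree_mul _ _).trans ?_
    rw [totalDegree_C, zero_add]
    exact (totalDegree_sub _ _).trans (by simp [totalDegree_C])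
  · rw [smul_eq_mul, mul_one]
    exact Finset.card_le_univ _

lemma evalAt_atVar_pointPoly (hν : Function.Injective ν) (x : Fin n → A) (i : Fin n) (a : A) :
    evalAt ν x (atVar i (pointPoly ν a)) = if x i = a then 1 else 0 := by
  rw [evalAt, eval_rename, pointPoly, map_prod]
  split_ifs with h
  · refine Finset.prod_eq_one fun c hc => ?_
    have : ν a - ν c ≠ 0 := sub_ne_zero.2 fun e => Finset.ne_of_mem_erase hc (hν e).symm
    simp [h, inv_mul_cancel₀ this]
  · refine Finset.prod_eq_zero (Finset.mem_erase.2 ⟨h, Finset.mem_univ _⟩) ?_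
    simp

/-- The indicator polynomial of the tuples which agree with `t` on the variables `v`. -/
noncomputable def tuplePoly (ν : A → ℚ) {m : ℕ} (v : Fin m → Fin n) (t : Fin m → A) :
    MvPolynomial (Fin n) ℚ :=
  ∏ l, atVar (v l) (pointPoly ν (t l))

lemma totalDegree_atVar_pointPoly_le (i : Fin n) (a : A) :
    (atVar i (pointPoly ν a)).totalDegree ≤ Fintype.card A :=
  (totalDegree_rename_le _ _).trans (totalDegree_pointPoly_le ν a)

lemma totalDegree_tuplePoly_le {m : ℕ} (v : Fin m → Fin n) (t : Fin m → A) :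
    (tuplePoly ν v t).totalDegree ≤ m * Fintype.card A := by
  refine (totalDegree_finsetProd _ _).trans ((Finset.sum_le_card_nsmul _ _ (Fintype.card A)
    fun l _ => totalDegree_atVar_pointPoly_le _ _).trans ?_)
  simp

lemma evalAt_tuplePoly (hν : Function.Injective ν) (x : Fin n → A) {m : ℕ} (v : Fin m → Fin n)
    (t : Fin m → A) :
    evalAt ν x (tuplePoly ν v t) = if (fun l => x (v l)) = t then 1 else 0 := by
  rw [tuplePoly, map_prod]
  simp only [evalAt_atVar_pointPoly hν]
  split_ifs with h
  · exact Finset.prod_eq_one fun l _ => if_pos (congrFun h l)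
  · obtain ⟨l, hl⟩ := Function.ne_iff.1 h
    exact Finset.prod_eq_zero (Finset.mem_univ l) (if_neg hl)

variable [SemilatticeInf A]

open scoped Classical in
/-- The indicator polynomial of the upper set generated by `a`. -/
noncomputable def upperPoly (ν : A → ℚ) (a : A) : MvPolynomial (Fin 1) ℚ :=
  ∑ b with a ≤ b, pointPoly ν b

/-- The list of the indicator polynomials. -/
noncomputable def indicatorPolys (ν : A → ℚ) : List (MvPolynomial (Fin 1) ℚ) :=
  (Finset.univ : Finset A).toList.map (pointPoly ν) ++
    (Finset.univ : Finset A).toList.map (upperPoly ν)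

/-- The indicator polynomial of the tuples above `S`. -/
noncomputable def upperProd (ν : A → ℚ) (S : List (Fin n × A)) : MvPolynomial (Fin n) ℚ :=
  (S.map fun s => atVar s.1 (upperPoly ν s.2)).prod

lemma totalDegree_upperPoly_le (ν : A → ℚ) (a : A) :
    (upperPoly ν a).totalDegree ≤ Fintype.card A :=
  totalDegree_finsetSum_le fun b _ => totalDegree_pointPoly_le ν b

lemma totalDegree_indicatorPolys_le {t : MvPolynomial (Fin 1) ℚ} (ht : t ∈ indicatorPolys ν) :
    t.totalDegree ≤ Fintype.card A := by
  simp only [indicatorPolys, List.mem_append, List.mem_map] at ht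
  rcases ht with ⟨a, -, rfl⟩ | ⟨a, -, rfl⟩
  exacts [totalDegree_pointPoly_le ν a, totalDegree_upperPoly_le ν a]

lemma totalDegree_upperProd_le (S : List (Fin n × A)) :
    (upperProd ν S).totalDegree ≤ S.length * Fintype.card A := by
  induction S with
  | nil => simp [upperProd]
  | cons s S ih =>
    rw [upperProd, List.map_cons, List.prod_cons, List.length_cons, add_mul, one_mul, add_comm]
    exact (totalDegree_mul _ _).trans (add_le_add ((totalDegree_rename_le _ _).trans
      (totalDegree_upperPoly_le ν _)) ih)

open scoped Classical in
lemma evalAt_atVar_upperPoly (hν : Function.Injective ν) (x : Fin n → A) (i : Fin n) (a : A) :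
    evalAt ν x (atVar i (upperPoly ν a)) = if a ≤ x i then 1 else 0 := by
  rw [upperPoly, atVar, map_sum, map_sum]
  simp only [evalAt_atVar_pointPoly hν]
  simp

open scoped Classical in
lemma evalAt_upperProd (hν : Function.Injective ν) (x : Fin n → A) (S : List (Fin n × A)) :
    evalAt ν x (upperProd ν S) = if ∀ s ∈ S, s.2 ≤ x s.1 then 1 else 0 := by
  induction S with
  | nil => simp [upperProd]
  | cons s S ih =>
    rw [upperProd, List.map_cons, List.prod_cons, map_mul, ← upperProd, ih,
      evalAt_atVar_upperPoly hν]
    simp only [List.forall_mem_cons, ite_and]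
    split_ifs <;> simp

open scoped Classical in
/-- Every function is a combination of indicator functions of principal upper sets. -/
lemma exists_eq_sum_upper (g : A → ℚ) : ∃ c : A → ℚ, ∀ x, g x = ∑ a, c a * if a ≤ x then 1 else 0 := by
  let ζ : A → A → ℚ := fun a x => if a ≤ x then 1 else 0
  have h1 : ∀ b : A, (Pi.single b 1 : A → ℚ) ∈ Submodule.span ℚ (Set.range ζ) := by
    intro b
    induction b using WellFoundedGT.induction with
    | ind b ih =>
      -- Möbius inversion from the top: the indicator of the upper set of `b` minus the points
      -- strictly above `b`, which are already treated.
      have h2 : (Pi.single b 1 : A → ℚ) = ζ b - ∑ c with b < c, Pi.single c 1 := by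
        ext x
        rw [Pi.sub_apply, Finset.sum_apply]
        simp only [Pi.single_apply, Finset.sum_ite_eq, Finset.mem_filter, Finset.mem_univ, true_and, ζ]
        rcases eq_or_ne x b with rfl | hx
        · simp
        · simp [hx, lt_iff_le_and_ne, hx.symm]
      rw [h2]
      exact Submodule.sub_mem _ (Submodule.subset_span ⟨b, rfl⟩)
        (Submodule.sum_mem _ fun c hc => ih c (Finset.mem_filter.1 hc).2)
  have h2 : g ∈ Submodule.span ℚ (Set.range ζ) := by
    rw [pi_eq_sum_univ' g]
    refine Submodule.sum_mem _ fun b _ => Submodule.smul_mem _ _ ?_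
    convert h1 b using 1
  obtain ⟨c, rfl⟩ := (Submodule.mem_span_range_iff_exists_fun ℚ).1 h2
  exact ⟨c, fun x => by simp [Finset.sum_apply, ζ]⟩

end indicators

/-! ## Propagation on semilattice constraints -/

section core

variable {A : Type} [SemilatticeInf A] [Fintype A] [DecidableEq A] {n : ℕ}

/-- A constraint over `A`: a subsemilattice of `A ^ m` with a polynomial that defines it,
and the variables to which it is applied. -/
structure PolyConstraint (A : Type) [SemilatticeInf A] (ν : A → ℚ) (n : ℕ) where
  arity : ℕ
  rel : Set (Fin arity → A)
  poly : MvPolynomial (Fin arity) ℚ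
  scope : Fin arity → Fin n
  inf_mem : ∀ s ∈ rel, ∀ t ∈ rel, s ⊓ t ∈ rel
  eval_eq_zero_iff : ∀ t, evalAt ν t poly = 0 ↔ t ∈ rel

/-- A space of polynomials which is closed under the inferences needed for propagation. -/
structure IsPropagated (ν : A → ℚ) (𝒞 : Set (PolyConstraint A ν n)) (d k : ℕ)
    (V : Submodule ℚ (MvPolynomial (Fin n) ℚ)) : Prop where
  injective : Function.Injective ν
  mem_of_evalAt_eq_zero : ∀ p, p.totalDegree ≤ k → (∀ x, evalAt ν x p = 0) → p ∈ V
  mul_constraint_mem : ∀ c ∈ 𝒞, ∀ q, q.totalDegree ≤ k → q * rename c.scope c.poly ∈ V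
  -- Only these derived polynomials may be multiplied further. They are products of at most `d + 1`
  -- one-variable indicators, exactly the kind that the algorithm tests in each round.
  mul_mem : ∀ S : List (Fin n × A), S.length ≤ d → ∀ i a, atVar i (pointPoly ν a) * upperProd ν S ∈ V →
    ∀ q, q.totalDegree ≤ k → q * (atVar i (pointPoly ν a) * upperProd ν S) ∈ V
  evalAt_eq_zero : ∀ p ∈ V, ∀ φ : Fin n → A, (∀ c ∈ 𝒞, (fun l => φ (c.scope l)) ∈ c.rel) →
    evalAt ν φ p = 0
  -- Generous room for two products of `d + 1` indicators, two tuple indicators and a constraint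
  -- polynomial.
  le_degree : ∀ c ∈ 𝒞, (2 * d + 2) * Fintype.card A + 2 * (c.arity * Fintype.card A) +
    c.poly.totalDegree ≤ k
  le_degree' : (2 * d + 2) * Fintype.card A ≤ k

variable {ν : A → ℚ} {𝒞 : Set (PolyConstraint A ν n)} {d k : ℕ}
  {V : Submodule ℚ (MvPolynomial (Fin n) ℚ)} {p q : MvPolynomial (Fin n) ℚ} {S : List (Fin n × A)}

namespace IsPropagated

lemma mem_of_evalAt_eq (h : IsPropagated ν 𝒞 d k V) (hq : q ∈ V) (hqk : q.totalDegree ≤ k)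
    (hpk : p.totalDegree ≤ k) (e : ∀ x, evalAt ν x p = evalAt ν x q) : p ∈ V := by
  have := V.add_mem hq (h.mem_of_evalAt_eq_zero (p - q)
    ((totalDegree_sub _ _).trans (max_le hpk hqk)) fun x => by rw [map_sub, e, sub_self])
  rwa [add_sub_cancel] at this

lemma mem_of_evalAt_eq_sum (h : IsPropagated ν 𝒞 d k V) {β : Type} {s : Finset β}
    {q : β → MvPolynomial (Fin n) ℚ} (hq : ∀ b ∈ s, q b ∈ V ∧ (q b).totalDegree ≤ k)
    (hpk : p.totalDegree ≤ k) (e : ∀ x, evalAt ν x p = ∑ b ∈ s, evalAt ν x (q b)) : p ∈ V :=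
  h.mem_of_evalAt_eq (V.sum_mem fun b hb => (hq b hb).1)
    (totalDegree_finsetSum_le fun b hb => (hq b hb).2) hpk fun x => by rw [map_sum, e]

/-- Case distinction on the tuples of a constraint. -/
lemma mem_of_forall_tuple (h : IsPropagated ν 𝒞 d k V) {c : PolyConstraint A ν n} (hc : c ∈ 𝒞)
    (hp : p.totalDegree ≤ (d + 1) * Fintype.card A)
    (ht : ∀ t ∈ c.rel, p * tuplePoly ν c.scope t ∈ V) : p ∈ V := by
  classical
  have hk := h.le_degree c hc
  have hk1 : (2 * d + 2) * Fintype.card A = 2 * ((d + 1) * Fintype.card A) := by ring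
  -- As a function, `p` is the sum of its restrictions to the tuples of the relation and of its
  -- restriction to the other tuples. On the latter the constraint polynomial is nonzero, so
  -- dividing by its values writes that part (`none`) as a multiple of it.
  let q : Option (Fin c.arity → A) → MvPolynomial (Fin n) ℚ
    | some t => if t ∈ c.rel then p * tuplePoly ν c.scope t else 0
    | none => (p * ∑ t with t ∉ c.rel, C (evalAt ν t c.poly)⁻¹ * tuplePoly ν c.scope t) *
        rename c.scope c.poly
  have hdeg : (p * ∑ t with t ∉ c.rel, C (evalAt ν t c.poly)⁻¹ *
      tuplePoly ν c.scope t).totalDegree ≤ (d + 1) * Fintype.card A + c.arity * Fintype.card A := by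
    refine (totalDegree_mul _ _).trans (add_le_add hp (totalDegree_finsetSum_le fun t _ => ?_))
    refine (totalDegree_mul _ _).trans ?_
    rw [totalDegree_C, zero_add]
    exact totalDegree_tuplePoly_le _ _
  refine h.mem_of_evalAt_eq_sum (s := Finset.univ) (q := q) (fun b _ => ?_) (by omega) fun x => ?_
  · rcases b with _ | t
    · refine ⟨h.mul_constraint_mem c hc _ (hdeg.trans (by omega)), (totalDegree_mul _ _).trans ?_⟩
      have := totalDegree_rename_le c.scope c.poly
      omega
    · simp only [q]
      split_ifs with hr
      · refine ⟨ht t hr, (totalDegree_mul _ _).trans ?_⟩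
        have := totalDegree_tuplePoly_le (ν := ν) c.scope t
        omega
      · exact ⟨V.zero_mem, by simp⟩
  · rw [Fintype.sum_option]
    have h1 : ∀ t, evalAt ν x (q (some t)) = if (fun l => x (c.scope l)) = t then
        (if t ∈ c.rel then evalAt ν x p else 0) else 0 := fun t => by
      simp only [q]
      split_ifs <;> simp_all [evalAt_tuplePoly h.injective]
    have h2 : evalAt ν x (q none) = if (fun l => x (c.scope l)) ∈ c.rel then 0 else evalAt ν x p := by
      have h3 : evalAt ν x (rename c.scope c.poly) = evalAt ν (fun l => x (c.scope l)) c.poly :=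
        eval_rename _ _ _
      simp only [q]
      rw [map_mul, h3]
      split_ifs with hr
      · rw [(c.eval_eq_zero_iff _).2 hr, mul_zero]
      · rw [map_mul, map_sum]
        simp only [map_mul, evalAt_tuplePoly h.injective]
        rw [Finset.sum_eq_single (fun l => x (c.scope l))]
        · have := mt (c.eval_eq_zero_iff _).1 hr
          simp [mul_assoc, inv_mul_cancel₀ this]
        · intro t _ htx
          rw [if_neg htx.symm, mul_zero]
        · intro hr'
          exact (hr' (by simpa using hr)).elim
    simp only [h1, h2, Finset.sum_ite_eq, Finset.mem_univ, if_true]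
    split_ifs <;> simp

open scoped Classical in
/-- The values that are not excluded for the variable `i` above `S`. -/
noncomputable def admissible (ν : A → ℚ) (V : Submodule ℚ (MvPolynomial (Fin n) ℚ))
    (S : List (Fin n × A)) (i : Fin n) : Finset A :=
  {a | atVar i (pointPoly ν a) * upperProd ν S ∉ V}

lemma mem_admissible {i : Fin n} {a : A} :
    a ∈ admissible ν V S i ↔ atVar i (pointPoly ν a) * upperProd ν S ∉ V := by
  simp [admissible]

/-- A product with the indicator of a value that is not admissible. -/
lemma mem_of_notMem_admissible (h : IsPropagated ν 𝒞 d k V) (hS : S.length ≤ d) {i : Fin n} {a : A}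
    (ha : a ∉ admissible ν V S i) (hq : q.totalDegree ≤ k)
    (hq' : q.totalDegree + (d + 1) * Fintype.card A ≤ k) (hp : p.totalDegree ≤ k)
    (e : ∀ x, evalAt ν x p = evalAt ν x q * ((if x i = a then 1 else 0) *
      evalAt ν x (upperProd ν S))) : p ∈ V := by
  rw [mem_admissible, not_not] at ha
  refine h.mem_of_evalAt_eq (h.mul_mem S hS i a ha q hq) ?_ hp fun x => ?_
  · refine (totalDegree_mul _ _).trans (le_trans (Nat.add_le_add_left ((totalDegree_mul _ _).trans
      ?_) _) hq')
    have h1 := totalDegree_atVar_pointPoly_le (ν := ν) i a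
    have h2 := totalDegree_upperProd_le (ν := ν) S
    have h3 := Nat.mul_le_mul_right (Fintype.card A) hS
    rw [add_mul]
    omega
  · rw [e, map_mul, map_mul, evalAt_atVar_pointPoly h.injective]

/-- Otherwise each tuple `t` of the relation is incompatible with `q ≠ 0` or has an entry that is
not admissible. In both cases `q * upperProd ν S` times the indicator of `t` is in `V`, and the case
distinction over the tuples puts `q * upperProd ν S` into `V`. The lemma is used for `q = 1` and for
the indicator of one admissible value. -/
lemma exists_tuple (h : IsPropagated ν 𝒞 d k V) (hS : S.length ≤ d) {c : PolyConstraint A ν n}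
    (hc : c ∈ 𝒞) (hq : q.totalDegree ≤ Fintype.card A) (hV : q * upperProd ν S ∉ V) :
    ∃ t ∈ c.rel, (∀ l, t l ∈ admissible ν V S (c.scope l)) ∧
      ∃ x, evalAt ν x q ≠ 0 ∧ (fun l => x (c.scope l)) = t := by
  by_contra! hcon
  have hk := h.le_degree c hc
  have hSd := (totalDegree_upperProd_le (ν := ν) S).trans (Nat.mul_le_mul_right _ hS)
  have hk1 : (2 * d + 2) * Fintype.card A = d * Fintype.card A + (d * Fintype.card A +
    2 * Fintype.card A) := by ring
  have hk2 : (d + 1) * Fintype.card A = d * Fintype.card A + Fintype.card A := by ring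
  refine hV (h.mem_of_forall_tuple hc ((totalDegree_mul _ _).trans (by omega)) fun t ht => ?_)
  have hdt := totalDegree_tuplePoly_le (ν := ν) c.scope t
  have hdeg : (q * upperProd ν S * tuplePoly ν c.scope t).totalDegree ≤ k :=
    (totalDegree_mul _ _).trans ((add_le_add ((totalDegree_mul _ _).trans (add_le_add hq hSd))
      hdt).trans (by omega))
  by_cases hadm : ∀ l, t l ∈ admissible ν V S (c.scope l)
  · refine h.mem_of_evalAt_eq_zero _ hdeg fun x => ?_
    rw [map_mul, map_mul, evalAt_tuplePoly h.injective]
    split_ifs with hx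
    · rw [show evalAt ν x q = 0 by
        by_contra h0
        exact hcon t ht hadm x h0 hx, zero_mul, zero_mul]
    · rw [mul_zero]
  · push Not at hadm
    obtain ⟨l, hl⟩ := hadm
    have hdq : (q * tuplePoly ν c.scope t).totalDegree ≤ Fintype.card A +
      c.arity * Fintype.card A := (totalDegree_mul _ _).trans (add_le_add hq hdt)
    refine h.mem_of_notMem_admissible hS hl (q := q * tuplePoly ν c.scope t) (by omega) (by omega)
      hdeg fun x => ?_
    rw [map_mul, map_mul, map_mul, evalAt_tuplePoly h.injective]
    split_ifs with h1 h2 h2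
    · ring
    · exact absurd (congrFun h1 l) h2
    · ring
    · ring

/-- If `S` is not refuted, there is a least solution above `S`, and it can be derived from `S`. -/
lemma exists_least (h : IsPropagated ν 𝒞 d k V) (hS : S.length ≤ d) (hV : upperProd ν S ∉ V) :
    ∃ m : Fin n → A, (∀ c ∈ 𝒞, (fun l => m (c.scope l)) ∈ c.rel) ∧ (∀ s ∈ S, s.2 ≤ m s.1) ∧
      (∀ φ : Fin n → A, (∀ c ∈ 𝒞, (fun l => φ (c.scope l)) ∈ c.rel) → (∀ s ∈ S, s.2 ≤ φ s.1) →
        m ≤ φ) ∧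
      ∀ T : List (Fin n × A), T.length ≤ d → (∀ s ∈ T, s.2 ≤ m s.1) →
        upperProd ν S - upperProd ν S * upperProd ν T ∈ V := by
  classical
  have hk := h.le_degree'
  have hk1 : (2 * d + 2) * Fintype.card A = d * Fintype.card A + (d * Fintype.card A +
    2 * Fintype.card A) := by ring
  have hk2 : (d + 1) * Fintype.card A = d * Fintype.card A + Fintype.card A := by ring
  have hdeg : ∀ T : List (Fin n × A), T.length ≤ d →
      (upperProd ν T).totalDegree ≤ d * Fintype.card A := fun T hT =>
    (totalDegree_upperProd_le T).trans (Nat.mul_le_mul_right _ hT)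
  have hSd := hdeg S hS
  -- The products with the indicators of all values of `x_i` add up to `upperProd ν S`, so they
  -- cannot all lie in `V`.
  have hne : ∀ i, (admissible ν V S i).Nonempty := fun i => by
    by_contra hemp
    rw [Finset.not_nonempty_iff_eq_empty] at hemp
    refine hV (h.mem_of_evalAt_eq_sum (s := Finset.univ)
      (q := fun a => atVar i (pointPoly ν a) * upperProd ν S) (fun a _ => ⟨?_, ?_⟩) (by omega)
      fun x => ?_)
    · by_contra ha
      have := mem_admissible.2 ha
      rw [hemp] at this
      exact Finset.notMem_empty _ this
    · have := totalDegree_atVar_pointPoly_le (ν := ν) i a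
      exact (totalDegree_mul _ _).trans (by omega)
    · simp only [map_mul, evalAt_atVar_pointPoly h.injective]
      simp
  -- The candidate for the least solution: in each coordinate, the meet of the admissible values.
  let m : Fin n → A := fun i => (admissible ν V S i).inf' (hne i) id
  have hm : ∀ i, ∀ a ∈ admissible ν V S i, m i ≤ a := fun i a ha => Finset.inf'_le id ha
  refine ⟨m, fun c hc => ?_, fun s hs => Finset.le_inf' _ _ fun b hb => ?_, fun φ hφ hφS i => ?_,
    fun T hT hTm => ?_⟩
  -- On the scope of `c`, `m` is the meet of all tuples of the relation with admissible entries,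
  -- hence in the relation: every entry of such a tuple is admissible, and every admissible value is
  -- an entry of such a tuple.
  · let τ : Finset (Fin c.arity → A) :=
      {t | t ∈ c.rel ∧ ∀ l, t l ∈ admissible ν V S (c.scope l)}
    have hτ : τ.Nonempty := by
      obtain ⟨t, ht, hta, -⟩ := h.exists_tuple hS hc (q := 1) (by simp) (by rwa [one_mul])
      exact ⟨t, by simp only [τ, Finset.mem_filter, Finset.mem_univ, true_and]; exact ⟨ht, hta⟩⟩
    have hmem : τ.inf' hτ id ∈ c.rel :=
      Finset.inf'_mem c.rel c.inf_mem τ hτ id fun t ht => (Finset.mem_filter.1 ht).2.1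
    convert hmem using 1
    ext l
    refine le_antisymm ?_ (Finset.le_inf' _ _ fun a ha => ?_)
    · rw [Finset.inf'_apply]
      exact Finset.le_inf' _ _ fun t ht => hm _ _ ((Finset.mem_filter.1 ht).2.2 l)
    · obtain ⟨t, ht, hta, x, hx, rfl⟩ := h.exists_tuple hS hc
        (totalDegree_atVar_pointPoly_le (c.scope l) a) (mem_admissible.1 ha)
      rw [evalAt_atVar_pointPoly h.injective] at hx
      have hxa : x (c.scope l) = a := by
        by_contra h0
        exact hx (if_neg h0)
      rw [Finset.inf'_apply, id, ← hxa]
      exact Finset.inf'_le (b := fun l => x (c.scope l)) (fun t : Fin c.arity → A => t l) (by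
        simp only [τ, Finset.mem_filter, Finset.mem_univ, true_and]; exact ⟨ht, hta⟩)
  -- A value that is not above the bound prescribed by `S` gives a product that vanishes on all
  -- assignments, so it is not admissible.
  · by_contra hsb
    rw [mem_admissible] at hb
    refine hb (h.mem_of_evalAt_eq_zero _ ?_ fun x => ?_)
    · have := totalDegree_atVar_pointPoly_le (ν := ν) s.1 b
      exact (totalDegree_mul _ _).trans (by omega)
    · rw [map_mul, evalAt_atVar_pointPoly h.injective, evalAt_upperProd h.injective]
      split_ifs with h1 h2
      · exact absurd (h1 ▸ h2 s hs) hsb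
      all_goals simp
  -- `V` vanishes on solutions, but the product for the value `φ i` equals 1 at `φ`; so `φ i` is
  -- admissible.
  · refine hm i _ (mem_admissible.2 fun hmem => ?_)
    have := h.evalAt_eq_zero _ hmem φ hφ
    rw [map_mul, evalAt_atVar_pointPoly h.injective, evalAt_upperProd h.injective, if_pos rfl,
      if_pos hφS, mul_one] at this
    exact one_ne_zero this
  · induction T with
    | nil => simp [upperProd]
    | cons s T ih =>
      have hT' : T.length ≤ d := (Nat.le_succ _).trans hT
      have hdT := hdeg T hT'
      have hds := hdeg (s :: T) hT
      -- The difference is supported where `x` at `s.1` is not above `s.2`. Such values are not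
      -- above `m`, hence not admissible, and the difference is a sum of multiples of products in
      -- `V`.
      have h1 : upperProd ν S * upperProd ν T - upperProd ν S * upperProd ν (s :: T) ∈ V := by
        refine h.mem_of_evalAt_eq_sum (s := Finset.univ.filter fun b => ¬ s.2 ≤ b)
          (q := fun b => upperProd ν T * (atVar s.1 (pointPoly ν b) * upperProd ν S))
          (fun b hb => ?_) ?_ fun x => ?_
        · have h2 := totalDegree_atVar_pointPoly_le (ν := ν) s.1 b
          refine ⟨h.mul_mem S hS _ _ ?_ _ (by omega), (totalDegree_mul _ _).trans
            (le_trans (Nat.add_le_add_left (totalDegree_mul _ _) _) (by omega))⟩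
          by_contra hbV
          exact (Finset.mem_filter.1 hb).2 ((hTm s (by simp)).trans (hm _ _ (mem_admissible.2 hbV)))
        · exact (totalDegree_sub _ _).trans (max_le ((totalDegree_mul _ _).trans (by omega))
            ((totalDegree_mul _ _).trans (by omega)))
        · simp only [map_mul, map_sub, evalAt_atVar_pointPoly h.injective]
          rw [← Finset.mul_sum, ← Finset.sum_mul, Finset.sum_ite_eq, upperProd, upperProd, upperProd,
            List.map_cons, List.prod_cons, map_mul, evalAt_atVar_upperPoly h.injective]
          simp only [Finset.mem_filter, Finset.mem_univ, true_and]
          split_ifs <;> ring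
      have := V.add_mem (ih hT' fun s' hs' => hTm s' (by simp [hs'])) h1
      rwa [sub_add_sub_cancel] at this

/-- A polynomial function of degree at most `d` is a combination of functions `upperProd ν S`. -/
lemma exists_eq_sum_upperProd (hν : Function.Injective ν) (hp : p.totalDegree ≤ d) :
    ∃ c : {S : List (Fin n × A) // S.length ≤ d} →₀ ℚ, ∀ x,
      evalAt ν x p = evalAt ν x (c.sum fun S a => a • upperProd ν S.1) := by
  classical
  let L : MvPolynomial (Fin n) ℚ →ₗ[ℚ] ((Fin n → A) → ℚ) :=
    LinearMap.pi fun x => (aeval fun i => ν (x i)).toLinearMap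
  have hL : ∀ p x, L p x = evalAt ν x p := fun p x => by
    simp [L, aeval_eq_eval]
  let W : ℕ → Submodule ℚ ((Fin n → A) → ℚ) := fun e =>
    Submodule.span ℚ (Set.range fun S : {S : List (Fin n × A) // S.length ≤ e} => L (upperProd ν S.1))
  -- As a function, the variable is a combination of upper indicators in `x_i`, so multiplying by it
  -- lengthens the lists by one pair.
  have hmul : ∀ e p i, L p ∈ W e → L (X i * p) ∈ W (e + 1) := by
    intro e p i hp
    obtain ⟨c, hc⟩ := exists_eq_sum_upper ν
    have hX : ∀ (u : MvPolynomial (Fin n) ℚ), L (X i * u) = (fun x => ν (x i)) * L u := fun u => by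
      ext x
      simp only [hL, map_mul, Pi.mul_apply, eval_X, evalAt]
    rw [hX]
    generalize L p = g at hp
    induction hp using Submodule.span_induction with
    | mem g hg =>
      obtain ⟨S, rfl⟩ := hg
      have h1 : (fun x => ν (x i)) * L (upperProd ν S.1) =
          ∑ a, c a • L (upperProd ν ((i, a) :: S.1)) := by
        ext x
        rw [Pi.mul_apply, hc, Finset.sum_mul, Finset.sum_apply]
        refine Finset.sum_congr rfl fun a _ => ?_
        rw [Pi.smul_apply, hL, hL, upperProd, upperProd, List.map_cons, List.prod_cons, map_mul,
          evalAt_atVar_upperPoly hν, smul_eq_mul, mul_assoc]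
      rw [h1]
      exact Submodule.sum_mem _ fun a _ => Submodule.smul_mem _ _ (Submodule.subset_span
        ⟨⟨(i, a) :: S.1, Nat.succ_le_succ S.2⟩, rfl⟩)
    | zero => rw [mul_zero]; exact Submodule.zero_mem _
    | add g g' _ _ hg hg' => rw [mul_add]; exact Submodule.add_mem _ hg hg'
    | smul a g _ hg => rw [mul_smul_comm]; exact Submodule.smul_mem _ _ hg
  have hmon : ∀ e (α : Fin n →₀ ℕ), α.degree ≤ e → L (monomial α 1) ∈ W e := by
    intro e
    induction e with
    | zero =>
      intro α hα
      rw [Nat.le_zero, Finsupp.degree_eq_zero_iff] at hα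
      subst hα
      exact Submodule.subset_span ⟨⟨[], le_rfl⟩, by simp [upperProd]⟩
    | succ e ih =>
      intro α hα
      rcases eq_or_ne α 0 with rfl | h0
      · exact Submodule.subset_span ⟨⟨[], Nat.zero_le _⟩, by simp [upperProd]⟩
      · obtain ⟨i, hi⟩ := Finsupp.ne_iff.1 h0
        have h1 : α = single i 1 + (α - single i 1) := by
          rw [add_tsub_cancel_of_le]
          rw [Finsupp.single_le_iff]
          exact Nat.one_le_iff_ne_zero.2 hi
        have h2 : (α - single i 1).degree ≤ e := by
          rw [h1, map_add, Finsupp.degree_single] at hα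
          omega
        have h3 := hmul e _ i (ih _ h2)
        rwa [X, monomial_mul, one_mul, ← h1] at h3
  have hpW : L p ∈ W d := by
    rw [p.as_sum, map_sum]
    refine Submodule.sum_mem _ fun α hα => ?_
    rw [← mul_one (coeff α p), ← smul_eq_mul, ← smul_monomial, map_smul]
    refine Submodule.smul_mem _ _ (hmon d α ((le_trans ?_ (le_totalDegree hα)).trans hp))
    exact le_of_eq rfl
  obtain ⟨c, hc⟩ := Finsupp.mem_span_range_iff_exists_finsupp.1 hpW
  refine ⟨c, fun x => ?_⟩
  rw [← hL, ← hL, ← hc, map_finsuppSum]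
  simp only [map_smul]

/-- Propagation is complete: every polynomial of degree at most `d` that vanishes on the solutions
is in the space. -/
theorem mem_of_forall_solution (h : IsPropagated ν 𝒞 d k V) (hp : p.totalDegree ≤ d) (hdk : d ≤ k)
    (h0 : ∀ φ : Fin n → A, (∀ c ∈ 𝒞, (fun l => φ (c.scope l)) ∈ c.rel) → evalAt ν φ p = 0) :
    p ∈ V := by
  classical
  obtain ⟨c, hc⟩ := exists_eq_sum_upperProd (A := A) h.injective hp
  have hk := h.le_degree'
  have hk1 : (2 * d + 2) * Fintype.card A = d * Fintype.card A + (d * Fintype.card A +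
    2 * Fintype.card A) := by ring
  have hdc : (c.sum fun S a => a • upperProd ν S.1).totalDegree ≤ k := by
    refine totalDegree_finsetSum_le fun S _ => (totalDegree_smul_le _ _).trans
      ((totalDegree_upperProd_le _).trans ((Nat.mul_le_mul_right _ S.2).trans (by omega)))
  suffices hmem : (c.sum fun S a => a • upperProd ν S.1) ∈ V from
    h.mem_of_evalAt_eq hmem hdc (hp.trans hdk) hc
  replace h0 : ∀ φ : Fin n → A, (∀ c ∈ 𝒞, (fun l => φ (c.scope l)) ∈ c.rel) →
      evalAt ν φ (c.sum fun S a => a • upperProd ν S.1) = 0 := fun φ hφ => by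
    rw [← hc, h0 φ hφ]
  rcases isEmpty_or_nonempty (Fin n → A) with hemp | hne
  · exact h.mem_of_evalAt_eq_zero _ hdc fun x => hemp.elim x
  -- `m S` is the least solution above `S`, for every `S` whose indicator is not in `V`. The
  -- remaining indicators lie in `V` and are split off.
  choose! m hm1 hm2 hm3 hm4 using fun (S : {S : List (Fin n × A) // S.length ≤ d})
    (hS : upperProd ν S.1 ∉ V) => h.exists_least S.2 hS
  obtain ⟨s, hsc⟩ : ∃ s, s = c.support.filter fun S => upperProd ν S.1 ∉ V := ⟨_, rfl⟩
  have hs : ∀ S ∈ s, upperProd ν S.1 ∉ V := fun S hS => by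
    rw [hsc] at hS
    exact (Finset.mem_filter.1 hS).2
  have hsplit : (c.sum fun S a => a • upperProd ν S.1) = ∑ S ∈ s, c S • upperProd ν S.1 +
      ∑ S ∈ c.support with ¬ upperProd ν S.1 ∉ V, c S • upperProd ν S.1 :=
    hsc ▸ (Finset.sum_filter_add_sum_filter_not _ _ _).symm
  have hrest : ∑ S ∈ c.support with ¬ upperProd ν S.1 ∉ V, c S • upperProd ν S.1 ∈ V :=
    V.sum_mem fun S hS => V.smul_mem _ (not_not.1 (Finset.mem_filter.1 hS).2)
  rw [hsplit]
  refine V.add_mem ?_ hrest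
  -- A solution is above `S` if and only if it is above `m S`; so the value at `φ` is the sum of the
  -- coefficients with `m S ≤ φ`.
  have heval : ∀ φ : Fin n → A, (∀ c ∈ 𝒞, (fun l => φ (c.scope l)) ∈ c.rel) →
      ∑ S ∈ s with m S ≤ φ, c S = 0 := fun φ hφ => by
    have h1 := h0 φ hφ
    rw [hsplit, map_add, h.evalAt_eq_zero _ hrest φ hφ, add_zero, map_sum] at h1
    rw [← h1, Finset.sum_filter]
    refine Finset.sum_congr rfl fun S hS => ?_
    rw [smul_eval, evalAt_upperProd h.injective]
    have : m S ≤ φ ↔ ∀ s ∈ S.1, s.2 ≤ φ s.1 :=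
      ⟨fun hle s' hs' => (hm2 S (hs S hS) s' hs').trans (hle s'.1), hm3 S (hs S hS) φ hφ⟩
    simp only [this]
    split_ifs <;> simp
  -- Triangularity: in the sum over all `S'` with `m S' ≤ m S`, the fibres strictly below `m S`
  -- vanish by induction, which leaves the fibre of `m S`.
  have hC : ∀ φ : Fin n → A, ∑ S ∈ s with m S = φ, c S = 0 := by
    intro φ
    induction φ using WellFoundedLT.induction with
    | ind φ ih =>
      by_cases hφ : ∃ S ∈ s, m S = φ
      · obtain ⟨S, hS, rfl⟩ := hφ
        have h1 := heval (m S) (hm1 S (hs S hS))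
        rw [← Finset.sum_fiberwise (g := m)] at h1
        rw [Finset.sum_eq_single (m S)] at h1
        · rw [← h1]
          refine Finset.sum_congr (Finset.ext fun S' => ?_) fun _ _ => rfl
          simp only [Finset.mem_filter]
          exact ⟨fun e => ⟨⟨e.1, e.2.le⟩, e.2⟩, fun e => ⟨e.1.1, e.2⟩⟩
        · intro φ' _ hne
          by_cases hle : φ' ≤ m S
          · rw [← ih φ' (lt_of_le_of_ne hle hne)]
            refine Finset.sum_congr (Finset.ext fun S' => ?_) fun _ _ => rfl
            simp only [Finset.mem_filter]
            exact ⟨fun e => ⟨e.1.1, e.2⟩, fun e => ⟨⟨e.1, e.2 ▸ hle⟩, e.2⟩⟩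
          · refine Finset.sum_eq_zero fun S' hS' => ?_
            simp only [Finset.mem_filter] at hS'
            exact absurd (hS'.2 ▸ hS'.1.2) hle
        · exact fun hmem => absurd (Finset.mem_univ _) hmem
      · refine Finset.sum_eq_zero fun S hS => ?_
        exact absurd ⟨S, (Finset.mem_filter.1 hS).1, (Finset.mem_filter.1 hS).2⟩ hφ
  rw [← Finset.sum_fiberwise (g := m)]
  refine V.sum_mem fun φ _ => ?_
  by_cases hφ : ∃ S ∈ s, m S = φ
  · obtain ⟨S, hS, rfl⟩ := hφ
    -- The coefficients of a fibre add up to 0, so one fixed member may be subtracted from every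
    -- term.
    have h1 : ∑ S' ∈ s with m S' = m S, c S' • upperProd ν S'.1 =
        ∑ S' ∈ s with m S' = m S, c S' • (upperProd ν S'.1 - upperProd ν S.1) := by
      simp only [smul_sub, Finset.sum_sub_distrib, ← Finset.sum_smul, hC (m S), zero_smul, sub_zero]
    rw [h1]
    refine V.sum_mem fun S' hS' => V.smul_mem _ ?_
    obtain ⟨hS's, hmm⟩ := Finset.mem_filter.1 hS'
    have h2 := hm4 S' (hs S' hS's) S.1 S.2 (hmm ▸ hm2 S (hs S hS))
    have h3 := hm4 S (hs S hS) S'.1 S'.2 (hmm ▸ hm2 S' (hs S' hS's))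
    -- Both indicators are congruent modulo `V` to their product, because each list lies below the
    -- common least solution.
    have h4 := V.sub_mem h2 h3
    rwa [mul_comm (upperProd ν S.1), sub_sub_sub_cancel_right] at h4
  · have h1 : ∑ S ∈ s with m S = φ, c S • upperProd ν S.1 = 0 := Finset.sum_eq_zero fun S hS =>
      absurd ⟨S, (Finset.mem_filter.1 hS).1, (Finset.mem_filter.1 hS).2⟩ hφ
    rw [h1]
    exact V.zero_mem

end IsPropagated

end core

/-! ## The span computed by the algorithm -/

section span

variable {n k : ℕ} {F G H U : List (MvPolynomial (Fin n) ℚ)} {g p q u : MvPolynomial (Fin n) ℚ}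

lemma monomial_mul_mem_mults (hg : g ∈ G) {α : Fin n →₀ ℕ} (hα : α.degree ≤ k) :
    monomial α 1 * g ∈ (mults k G).1 := by
  induction k generalizing α with
  | zero =>
    rw [Nat.le_zero, Finsupp.degree_eq_zero_iff] at hα
    subst hα
    simpa [mults, foldlLog_nil] using hg
  | succ k ih =>
    rw [mults_succ]
    rcases eq_or_ne α 0 with rfl | h0
    · exact List.mem_append_left _ (ih (by simp))
    · obtain ⟨i, hi⟩ := Finsupp.ne_iff.1 h0
      have h1 : α = single i 1 + (α - single i 1) := by
        rw [add_tsub_cancel_of_le]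
        rw [Finsupp.single_le_iff]
        exact Nat.one_le_iff_ne_zero.2 hi
      have h2 : (α - single i 1).degree ≤ k := by
        rw [h1, map_add, Finsupp.degree_single] at hα
        omega
      refine List.mem_append_right _ (List.mem_flatMap.2 ⟨_, ih h2, List.mem_map.2
        ⟨i, List.mem_finRange i, ?_⟩⟩)
      rw [X, ← mul_assoc, monomial_mul, one_mul, ← h1]

lemma mul_mem_span_mults (hg : g ∈ G) (hq : q.totalDegree ≤ k) :
    q * g ∈ Submodule.span ℚ {b | b ∈ (mults k G).1} := by
  rw [q.as_sum, Finset.sum_mul]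
  refine Submodule.sum_mem _ fun α hα => ?_
  have h1 : monomial α (coeff α q) = coeff α q • monomial α 1 := by
    rw [smul_monomial, smul_eq_mul, mul_one]
  rw [h1, smul_mul_assoc]
  exact Submodule.smul_mem _ _ (Submodule.subset_span (monomial_mul_mem_mults hg
    ((le_of_eq rfl).trans ((le_totalDegree hα).trans hq))))

lemma mults_subset {J : Ideal (MvPolynomial (Fin n) ℚ)} (hG : ∀ g ∈ G, g ∈ J) :
    ∀ g ∈ (mults k G).1, g ∈ J := by
  induction k with
  | zero => simpa [mults, foldlLog_nil] using hG
  | succ k ih =>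
    intro g hg
    rw [mults_succ] at hg
    rcases List.mem_append.1 hg with hg | hg
    · exact ih g hg
    · simp only [List.mem_flatMap, List.mem_map] at hg
      obtain ⟨g', hg', i, -, rfl⟩ := hg
      exact J.mul_mem_left _ (ih g' hg')

lemma span_mults_subset {J : Ideal (MvPolynomial (Fin n) ℚ)} (hG : ∀ g ∈ G, g ∈ J)
    (hp : p ∈ Submodule.span ℚ {b | b ∈ (mults k G).1}) : p ∈ J := by
  have : Submodule.span ℚ {b | b ∈ (mults k G).1} ≤ J.restrictScalars ℚ :=
    Submodule.span_le.2 fun b hb => mults_subset hG b hb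
  exact this hp

lemma mem_roundStep : u ∈ (roundStep F U k H).1 ↔
    u ∈ U ∧ u ∈ Submodule.span ℚ {b | b ∈ (mults k (F ++ H)).1} := by
  simp only [roundStep, List.mem_filter, decide_eq_true_eq, (isEchelon_elim _).projLog_eq_iff,
    span_elim]

lemma mults_mono (h : ∀ g ∈ G, g ∈ H) : ∀ g ∈ (mults k G).1, g ∈ (mults k H).1 := by
  induction k with
  | zero => simpa [mults, foldlLog_nil] using h
  | succ k ih =>
    intro g hg
    rw [mults_succ] at hg ⊢
    rcases List.mem_append.1 hg with hg | hg
    · exact List.mem_append_left _ (ih g hg)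
    · simp only [List.mem_flatMap, List.mem_map] at hg
      obtain ⟨g', hg', i, -, rfl⟩ := hg
      exact List.mem_append_right _ (List.mem_flatMap.2 ⟨g', ih g' hg', List.mem_map.2
        ⟨i, List.mem_finRange i, rfl⟩⟩)

/-- The sets of derived members of `U`, round by round. -/
noncomputable def roundIter (F U : List (MvPolynomial (Fin n) ℚ)) (k : ℕ) :
    ℕ → List (MvPolynomial (Fin n) ℚ)
  | 0 => []
  | j + 1 => (roundStep F U k (roundIter F U k j)).1

lemma roundIter_sublist_succ (j : ℕ) : (roundIter F U k j).Sublist (roundIter F U k (j + 1)) := by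
  induction j with
  | zero => exact List.nil_sublist _
  | succ j ih =>
    refine List.monotone_filter_right _ fun u hu => ?_
    simp only [decide_eq_true_eq, (isEchelon_elim _).projLog_eq_iff, span_elim] at hu ⊢
    refine Submodule.span_mono (fun g hg => mults_mono (fun g hg => ?_) g hg) hu
    rcases List.mem_append.1 hg with hg | hg
    · exact List.mem_append_left _ hg
    · exact List.mem_append_right _ (ih.subset hg)

/-- The lists increase, and a repetition persists because each list determines the next. So before
stability every round adds at least one element. -/
lemma roundIter_stable (j : ℕ) :
    j ≤ (roundIter F U k j).length ∨ roundIter F U k (j + 1) = roundIter F U k j := by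
  induction j with
  | zero => exact Or.inl (Nat.zero_le _)
  | succ j ih =>
    rcases ih with ih | ih
    · rcases (roundIter_sublist_succ (F := F) (U := U) (k := k) j).length_le.eq_or_lt with h | h
      · right
        have h1 := (roundIter_sublist_succ (F := F) (U := U) (k := k) j).eq_of_length h
        rw [roundIter, ← h1]
        exact h1.symm
      · exact Or.inl (ih.trans_lt h)
    · right
      change (roundStep F U k (roundIter F U k (j + 1))).1 = _
      rw [ih]
      exact ih

lemma rounds_fst : (rounds F U k).1 = roundIter F U k U.length := by
  rw [rounds, foldlLog_fst]
  generalize hU : (fun s (_ : MvPolynomial (Fin n) ℚ) => (roundStep F U k s).1) = f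
  have : ∀ l : List (MvPolynomial (Fin n) ℚ), l.foldl f [] = roundIter F U k l.length := by
    intro l
    subst hU
    induction l using List.reverseRecOn with
    | nil => rfl
    | append_singleton l a ih =>
      rw [List.foldl_concat, ih, List.length_append, List.length_singleton, roundIter]
  exact this U

lemma roundStep_rounds : (roundStep F U k (rounds F U k).1).1 = (rounds F U k).1 := by
  rw [rounds_fst]
  change roundIter F U k (U.length + 1) = _
  -- If all rounds were strict, the list already has the length of `U` and cannot grow.
  rcases roundIter_stable (F := F) (U := U) (k := k) U.length with h | h
  · have h1 := roundIter_sublist_succ (F := F) (U := U) (k := k) U.length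
    have h2 : (roundIter F U k (U.length + 1)).length ≤ U.length := List.length_filter_le _ _
    exact (h1.eq_of_length (le_antisymm h1.length_le (h2.trans h))).symm
  · exact h

lemma rounds_subset {J : Ideal (MvPolynomial (Fin n) ℚ)} (hF : ∀ g ∈ F, g ∈ J) :
    ∀ g ∈ (rounds F U k).1, g ∈ J := by
  rw [rounds_fst]
  generalize U.length = j
  induction j with
  | zero => simp [roundIter]
  | succ j ih =>
    intro g hg
    refine span_mults_subset (fun g hg => ?_) (mem_roundStep.1 hg).2
    rcases List.mem_append.1 hg with hg | hg
    exacts [hF g hg, ih g hg]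

lemma span_saturate : Submodule.span ℚ {b | b ∈ (saturate F U k).1} =
    Submodule.span ℚ {b | b ∈ (mults k (F ++ (rounds F U k).1)).1} := span_elim _

lemma span_saturate_subset {J : Ideal (MvPolynomial (Fin n) ℚ)} (hF : ∀ g ∈ F, g ∈ J)
    (hp : p ∈ Submodule.span ℚ {b | b ∈ (saturate F U k).1}) : p ∈ J := by
  rw [span_saturate] at hp
  refine span_mults_subset (fun g hg => ?_) hp
  rcases List.mem_append.1 hg with hg | hg
  exacts [hF g hg, rounds_subset hF g hg]

/-- The span is closed under multiplication of members of `F` and of `U`. -/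
lemma mul_mem_span_saturate (hg : g ∈ F ∨ g ∈ U ∧ g ∈ Submodule.span ℚ {b | b ∈ (saturate F U k).1})
    (hq : q.totalDegree ≤ k) : q * g ∈ Submodule.span ℚ {b | b ∈ (saturate F U k).1} := by
  rw [span_saturate] at hg ⊢
  refine mul_mem_span_mults ?_ hq
  rcases hg with hg | hg
  · exact List.mem_append_left _ hg
  · exact List.mem_append_right _ (roundStep_rounds ▸ mem_roundStep.2 hg)

lemma prod_mem_prods {tab : List (MvPolynomial (Fin 1) ℚ)} {l : List (Fin n × MvPolynomial (Fin 1) ℚ)}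
    (hl : ∀ s ∈ l, s.2 ∈ tab) (hk : l.length ≤ k) :
    (l.map fun s => atVar s.1 s.2).prod ∈ prods n tab k := by
  induction k generalizing l with
  | zero =>
    rw [Nat.le_zero, List.length_eq_zero_iff] at hk
    simp [hk, prods]
  | succ k ih =>
    rw [prods_succ]
    rcases l with _ | ⟨s, l⟩
    · exact List.mem_append_left _ (ih (by simp) (Nat.zero_le _))
    · refine List.mem_append_right _ (List.mem_flatMap.2 ⟨_, ih (l := l) (fun s hs => hl s (by simp [hs]))
        (Nat.succ_le_succ_iff.1 hk), List.mem_flatMap.2 ⟨s.1, List.mem_finRange _, List.mem_map.2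
        ⟨s.2, hl s (by simp), rfl⟩⟩⟩)

lemma totalDegree_prods_le {tab : List (MvPolynomial (Fin 1) ℚ)} {e : ℕ}
    (he : ∀ t ∈ tab, t.totalDegree ≤ e) : ∀ u ∈ prods n tab k, u.totalDegree ≤ k * e := by
  induction k with
  | zero => simp [prods]
  | succ k ih =>
    intro u hu
    rw [prods_succ] at hu
    rw [add_mul, one_mul]
    rcases List.mem_append.1 hu with hu | hu
    · exact (ih u hu).trans (Nat.le_add_right _ _)
    · simp only [List.mem_flatMap, List.mem_map] at hu
      obtain ⟨u', hu', i, -, t, ht, rfl⟩ := hu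
      refine (totalDegree_mul _ _).trans ?_
      rw [add_comm]
      exact add_le_add (ih u' hu') ((totalDegree_rename_le _ _).trans (he t ht))

end span

/-! ### The computed span contains the low-degree part of the combinatorial ideal. -/

section instances

variable {D : Finset ℚ} {Γ : ConstraintLanguage D} {n : ℕ}

/-- A polynomial of degree at most `k` that vanishes on `D ^ n` is a combination of multiples of
degree at most `k` of domain polynomials. -/
lemma mem_of_eval_eq_zero {W : Submodule ℚ (MvPolynomial (Fin n) ℚ)} {k : ℕ}
    (hD : ∀ _ : Fin n, D.Nonempty)
    (hW : ∀ i q, q.totalDegree ≤ k → q * domainPoly D i ∈ W) {p : MvPolynomial (Fin n) ℚ}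
    (hp : p.totalDegree ≤ k) (h0 : ∀ x : Fin n → D, eval (fun i => (x i : ℚ)) p = 0) : p ∈ W := by
  -- The combinatorial Nullstellensatz also bounds the degrees of the products, hence those of the
  -- cofactors. It requires a nonempty `D`, but only if there is a variable.
  obtain ⟨h, hdeg, rfl⟩ := combinatorial_nullstellensatz_exists_linearCombination (fun _ => D)
    hD p fun x hx => h0 fun i => ⟨x i, hx i⟩
  rw [Finsupp.linearCombination_apply]
  refine Submodule.sum_mem _ fun i _ => hW i _ ?_
  have hne : domainPoly D i ≠ 0 := Finset.prod_ne_zero_iff.2 fun ρ _ h0 => by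
    simpa using congrArg (eval fun _ => ρ + 1) h0
  rcases eq_or_ne (h i) 0 with hi | hi
  · simp [hi]
  · have h1 := (hdeg i).trans hp
    rw [show (∏ s ∈ D, (X i - C s)) = domainPoly D i from rfl,
      totalDegree_mul_of_isDomain hne hi] at h1
    omega

lemma CSPInstance.mem_ideal_iff (I : CSPInstance Γ n) {p : MvPolynomial (Fin n) ℚ} :
    p ∈ I.ideal ↔ ∀ φ ∈ I.sol, eval (fun i => (φ i : ℚ)) p = 0 := by
  simp [ideal, mem_vanishingIdeal_iff, aeval_eq_eval]

lemma CSPInstance.axiomList_subset (I : CSPInstance Γ n) (f : DefiningPolys Γ) :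
    ∀ p ∈ I.axiomList f, p ∈ I.ideal := by
  intro p hp
  rw [I.mem_ideal_iff]
  intro φ hφ
  simp only [axiomList, List.mem_append, List.mem_map] at hp
  rcases hp with ⟨c, hc, rfl⟩ | ⟨i, -, rfl⟩
  · rw [eval_rename]
    exact (f.eval_eq_zero_iff c.idx fun l => φ (c.scope l)).2 (hφ c hc)
  · rw [domainPoly, map_prod]
    exact Finset.prod_eq_zero (φ i).2 (by simp)

/-- A degree bound for the polynomials of the instances. -/
noncomputable def DefiningPolys.degreeBound (f : DefiningPolys Γ) : ℕ :=
  2 * D.card + 2 * ∑ j, Γ.arity j * D.card + ∑ j, (f.poly j).totalDegree + 1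

lemma DefiningPolys.totalDegree_le (f : DefiningPolys Γ) (j : Fin Γ.num) :
    (f.poly j).totalDegree ≤ ∑ j, (f.poly j).totalDegree :=
  Finset.single_le_sum (f := fun j => (f.poly j).totalDegree) (fun _ _ => Nat.zero_le _)
    (Finset.mem_univ j)

lemma CSPInstance.totalDegree_axiomList_le (I : CSPInstance Γ n) (f : DefiningPolys Γ) :
    ∀ p ∈ I.axiomList f, p.totalDegree ≤ f.degreeBound := by
  intro p hp
  simp only [axiomList, List.mem_append, List.mem_map] at hp
  rcases hp with ⟨c, hc, rfl⟩ | ⟨i, -, rfl⟩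
  · refine (totalDegree_rename_le _ _).trans ((f.totalDegree_le c.idx).trans ?_)
    rw [DefiningPolys.degreeBound]
    omega
  · have : (domainPoly D i).totalDegree ≤ D.card := by
      refine (totalDegree_finsetProd _ _).trans ((Finset.sum_le_card_nsmul _ _ 1 fun c _ => ?_).trans
        (by simp))
      exact (totalDegree_sub _ _).trans (by simp [totalDegree_C])
    rw [DefiningPolys.degreeBound]
    omega

/-- The algorithm finds all polynomials of degree at most `d` of the combinatorial ideal. -/
theorem CSPInstance.mem_span_saturate {A : Type} [SemilatticeInf A] [Fintype A] [DecidableEq A]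
    (e : A ≃ D) (hΓ : ∀ j, ∀ s t : Fin (Γ.arity j) → A, (fun l => e (s l)) ∈ Γ.rel j →
      (fun l => e (t l)) ∈ Γ.rel j → (fun l => e (s l ⊓ t l)) ∈ Γ.rel j)
    (f : DefiningPolys Γ) (I : CSPInstance Γ n) {d : ℕ} {p : MvPolynomial (Fin n) ℚ}
    (hp : p ∈ I.ideal) (hpd : p.totalDegree ≤ d) :
    p ∈ Submodule.span ℚ {b | b ∈ (saturate (I.axiomList f)
      (prods n (indicatorPolys fun a => (e a : ℚ)) (d + 1)) (f.degreeBound * (d + 1))).1} := by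
  set k := f.degreeBound * (d + 1)
  set U := prods n (indicatorPolys fun a => (e a : ℚ)) (d + 1)
  set V := Submodule.span ℚ {b | b ∈ (saturate (I.axiomList f) U k).1}
  have hdk : d ≤ k := by
    have : 1 ≤ f.degreeBound := Nat.le_add_left _ _
    exact (Nat.le_succ d).trans (Nat.le_mul_of_pos_left _ this)
  have hdom : ∀ i q, q.totalDegree ≤ k → q * domainPoly D i ∈ V := fun i q hq =>
    mul_mem_span_saturate (Or.inl (List.mem_append_right _ (List.mem_map_of_mem
      (List.mem_finRange i)))) hq
  by_cases hD : ∀ _ : Fin n, D.Nonempty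
  swap
  -- For empty `D` the domain polynomial of an existing variable is the empty product 1, so the span
  -- contains everything of degree at most `k`.
  · push Not at hD
    obtain ⟨i, rfl⟩ := hD
    have := hdom i p (hpd.trans hdk)
    rwa [domainPoly, Finset.prod_empty, mul_one] at this
  -- Splits off the term `(2 * d + 2) * D.card` required by `IsPropagated`, which explains the
  -- coefficient 2 of `D.card` in `degreeBound`.
  have hkD : k = (2 * d + 2) * D.card + (2 * ∑ j, Γ.arity j * D.card +
      ∑ j, (f.poly j).totalDegree + 1) * d.succ := by
    simp only [k, DefiningPolys.degreeBound, Nat.succ_eq_add_one]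
    ring
  have hcard : Fintype.card A = D.card := by
    rw [Fintype.card_congr e, Fintype.card_coe]
  let pc : Constraint Γ n → PolyConstraint A (fun a => (e a : ℚ)) n := fun c =>
    { arity := Γ.arity c.idx
      rel := {t | (fun l => e (t l)) ∈ Γ.rel c.idx}
      poly := f.poly c.idx
      scope := c.scope
      inf_mem := fun s hs t ht => hΓ c.idx s t hs ht
      eval_eq_zero_iff := fun t => f.eval_eq_zero_iff c.idx fun l => e (t l) }
  have hsol : ∀ φ : Fin n → A, (∀ c ∈ pc '' {c | c ∈ I.constraints},
      (fun l => φ (c.scope l)) ∈ c.rel) ↔ (fun i => e (φ i)) ∈ I.sol := fun φ => by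
    rw [Set.forall_mem_image]
    rfl
  have hprop : IsPropagated (fun a => (e a : ℚ)) (pc '' {c | c ∈ I.constraints}) d k V :=
    { injective := Subtype.val_injective.comp e.injective
      mem_of_evalAt_eq_zero := fun p hp h0 => mem_of_eval_eq_zero hD hdom hp fun x => by
        simpa only [evalAt, Equiv.apply_symm_apply] using h0 fun i => e.symm (x i)
      mul_constraint_mem := by
        rintro _ ⟨c, hc, rfl⟩ q hq
        exact mul_mem_span_saturate (Or.inl (List.mem_append_left _ (List.mem_map.2 ⟨c, hc, rfl⟩))) hq
      mul_mem := fun S hS i a hV q hq => by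
        refine mul_mem_span_saturate (Or.inr ⟨?_, hV⟩) hq
        have := prod_mem_prods (n := n) (k := d + 1) (tab := indicatorPolys fun a => (e a : ℚ))
          (l := (i, pointPoly (fun a => (e a : ℚ)) a) ::
            S.map fun s => (s.1, upperPoly (fun a => (e a : ℚ)) s.2)) (fun s hs => by
              rcases List.mem_cons.1 hs with rfl | hs
              · exact List.mem_append_left _ (List.mem_map_of_mem (by simp))
              · obtain ⟨s, -, rfl⟩ := List.mem_map.1 hs
                exact List.mem_append_right _ (List.mem_map_of_mem (by simp))) (by simpa using hS)
        rwa [List.map_cons, List.prod_cons, List.map_map] at this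
      evalAt_eq_zero := fun p hp φ hφ =>
        I.mem_ideal_iff.1 (span_saturate_subset (I.axiomList_subset f) hp) _ ((hsol φ).1 hφ)
      le_degree := by
        rintro _ ⟨c, hc, rfl⟩
        have h1 := f.totalDegree_le c.idx
        have h2 : Γ.arity c.idx * D.card ≤ ∑ j, Γ.arity j * D.card :=
          Finset.single_le_sum (f := fun j => Γ.arity j * D.card) (fun _ _ => Nat.zero_le _)
            (Finset.mem_univ _)
        rw [hcard]
        rw [hkD]
        have h3 := Nat.le_mul_of_pos_right (2 * ∑ j, Γ.arity j * D.card +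
          ∑ j, (f.poly j).totalDegree + 1) (Nat.succ_pos d)
        change _ + 2 * (Γ.arity c.idx * D.card) + (f.poly c.idx).totalDegree ≤ _
        omega
      le_degree' := by
        rw [hcard]
        rw [hkD]
        exact Nat.le_add_right _ _ }
  refine hprop.mem_of_forall_solution hpd hdk fun φ hφ => ?_
  exact I.mem_ideal_iff.1 hp _ ((hsol φ).1 hφ)

end instances

/-! ## Reduced Gröbner bases -/

section groebner

variable {n : ℕ} {J : Ideal (MvPolynomial (Fin n) ℚ)} {p q g h : MvPolynomial (Fin n) ℚ}
  {α β : Fin n →₀ ℕ}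

/-- The leading monomials of the nonzero elements of an ideal. -/
def leadingMonomials (J : Ideal (MvPolynomial (Fin n) ℚ)) : Set (Fin n →₀ ℕ) :=
  {α | ∃ p ∈ J, p ≠ 0 ∧ degLex.degree p = α}

lemma leadingMonomials_mono (hα : α ∈ leadingMonomials J) (hαβ : α ≤ β) :
    β ∈ leadingMonomials J := by
  obtain ⟨p, hp, h0, rfl⟩ := hα
  have h1 : (monomial (β - degLex.degree p) (1 : ℚ)) ≠ 0 := by simp
  refine ⟨monomial (β - degLex.degree p) 1 * p, J.mul_mem_left _ hp, mul_ne_zero h1 h0, ?_⟩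
  rw [MonomialOrder.degree_mul h1 h0, MonomialOrder.degree_monomial, if_neg one_ne_zero,
    tsub_add_cancel_of_le hαβ]

/-- The elements of the reduced Gröbner basis. -/
def reducedElements (J : Ideal (MvPolynomial (Fin n) ℚ)) : Set (MvPolynomial (Fin n) ℚ) :=
  {g | g ∈ J ∧ degLex.leadingCoeff g = 1 ∧
    (∀ α ∈ leadingMonomials J, α ≤ degLex.degree g → α = degLex.degree g) ∧
    ∀ α ∈ g.support, α ∈ leadingMonomials J → α = degLex.degree g}

lemma ne_zero_of_leadingCoeff_eq_one (hg : degLex.leadingCoeff g = 1) : g ≠ 0 := fun h0 => by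
  rw [h0, MonomialOrder.leadingCoeff_zero] at hg
  exact zero_ne_one hg

lemma degree_mem_leadingMonomials (hg : g ∈ reducedElements J) :
    degLex.degree g ∈ leadingMonomials J :=
  ⟨g, hg.1, ne_zero_of_leadingCoeff_eq_one hg.2.1, rfl⟩

/-- The leading monomial of a nonzero difference would occur in `g` or in `h` and belong to the
leading monomials of `J`. It would then be the common leading monomial, which cancels because both
are monic. -/
lemma eq_of_degree_eq (hg : g ∈ reducedElements J) (hh : h ∈ reducedElements J)
    (e : degLex.degree g = degLex.degree h) : g = h := by
  by_contra hne
  have h0 : g - h ≠ 0 := sub_ne_zero.2 hne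
  have h1 : degLex.degree (g - h) ∈ leadingMonomials J := ⟨_, J.sub_mem hg.1 hh.1, h0, rfl⟩
  have h2 : (g - h).coeff (degLex.degree (g - h)) ≠ 0 := MonomialOrder.coeff_degree_ne_zero_iff.2 h0
  have h3 : degLex.degree (g - h) ≠ degLex.degree g := fun e' => by
    have h4 : g.coeff (degLex.degree g) = 1 := hg.2.1
    have h5 : h.coeff (degLex.degree h) = 1 := hh.2.1
    rw [e', coeff_sub, h4, e, h5, sub_self] at h2
    exact h2 rfl
  rw [coeff_sub] at h2
  by_cases h4 : g.coeff (degLex.degree (g - h)) = 0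
  · refine h3 ((hh.2.2.2 _ (mem_support_iff.2 fun h5 => ?_) h1).trans e.symm)
    rw [h4, h5, sub_self] at h2
    exact h2 rfl
  · exact h3 (hg.2.2.2 _ (mem_support_iff.2 h4) h1)

/-- Dickson's lemma: the leading monomials form an antichain for divisibility and determine the
elements. -/
lemma finite_reducedElements (J : Ideal (MvPolynomial (Fin n) ℚ)) : (reducedElements J).Finite := by
  refine Set.Finite.of_finite_image (f := degLex.degree) ?_ fun g hg h hh e => eq_of_degree_eq hg hh e
  refine WellQuasiOrderedLE.finite_of_isAntichain ?_
  rintro _ ⟨g, hg, rfl⟩ _ ⟨h, hh, rfl⟩ hne hle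
  exact hne (hh.2.2.1 _ (degree_mem_leadingMonomials hg) hle)

/-- Take a minimal leading monomial `μ` dividing `α` and subtract from it its remainder modulo all
nonzero elements of `J`. The remainder contains no leading monomial of `J`, so only `μ` can be one
in the difference. -/
lemma exists_reducedElement (hα : α ∈ leadingMonomials J) :
    ∃ g ∈ reducedElements J, degLex.degree g ≤ α := by
  obtain ⟨μ, hμα, hμ⟩ := exists_minimal_le_of_wellFoundedLT (fun β => β ∈ leadingMonomials J) α hα
  have hB : ∀ b ∈ {b | b ∈ J ∧ b ≠ 0}, IsUnit (degLex.leadingCoeff b) := fun b hb =>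
    (MonomialOrder.leadingCoeff_ne_zero_iff.2 hb.2).isUnit
  obtain ⟨c, r, hr, hdeg, hrem⟩ := MonomialOrder.div_set hB (monomial μ (1 : ℚ))
  have hrJ : monomial μ 1 - r ∈ J := by
    rw [hr, add_sub_cancel_right, Finsupp.linearCombination_apply]
    exact Submodule.sum_mem _ fun b _ => J.smul_mem _ b.2.1
  have hrlm : ∀ β ∈ r.support, β ∉ leadingMonomials J := fun β hβ ⟨p, hp, h0, e⟩ =>
    hrem β hβ p ⟨hp, h0⟩ e.le
  have hμr : r.coeff μ = 0 := by
    by_contra h0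
    exact hrlm μ (mem_support_iff.2 h0) hμ.1
  have hdegμ : degLex.degree (monomial μ (1 : ℚ)) = μ := by
    rw [MonomialOrder.degree_monomial, if_neg one_ne_zero]
  have hcoeff : (monomial μ 1 - r).coeff μ = 1 := by
    rw [coeff_sub, hμr, coeff_monomial, if_pos rfl, sub_zero]
  have hle : degLex.degree (monomial μ 1 - r) ≼[degLex] μ := by
    rw [hr, add_sub_cancel_right, Finsupp.linearCombination_apply]
    refine (MonomialOrder.degree_sum_le).trans (Finset.sup_le fun b _ => ?_)
    have := hdeg b
    rwa [mul_comm, hdegμ] at this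
  have heq : degLex.degree (monomial μ 1 - r) = μ :=
    degLex.toSyn.injective (le_antisymm hle (MonomialOrder.le_degree (mem_support_iff.2
      (by rw [hcoeff]; exact one_ne_zero))))
  refine ⟨_, ⟨hrJ, ?_, fun β hβ hle' => ?_, fun β hβ hβJ => ?_⟩, heq.trans_le hμα⟩
  · rw [MonomialOrder.leadingCoeff, heq, hcoeff]
  · rw [heq] at hle' ⊢
    exact le_antisymm hle' (hμ.2 hβ hle')
  · rw [heq]
    by_contra hne
    rw [mem_support_iff, coeff_sub, coeff_monomial, if_neg (Ne.symm hne), zero_sub,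
      neg_ne_zero] at hβ
    exact hrlm β (mem_support_iff.2 hβ) hβJ

lemma isReducedGroebnerBasis_reducedElements (J : Ideal (MvPolynomial (Fin n) ℚ)) :
    IsReducedGroebnerBasis J (finite_reducedElements J).toFinset := by
  have hdvd : ∀ p ∈ J, p ≠ 0 → ∃ g ∈ (finite_reducedElements J).toFinset,
      degLex.degree g ≤ degLex.degree p := fun p hp h0 => by
    obtain ⟨g, hg, hle⟩ := exists_reducedElement (J := J) ⟨p, hp, h0, rfl⟩
    exact ⟨g, (Set.Finite.mem_toFinset _).2 hg, hle⟩
  refine ⟨le_antisymm (Ideal.span_le.2 fun g hg => ?_) fun p hp => ?_, hdvd, fun g hg => ?_,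
    fun g hg h hh hne α hα hle => ?_⟩
  · exact ((Set.Finite.mem_toFinset _).1 hg).1
  · have hB : ∀ b ∈ reducedElements J, IsUnit (degLex.leadingCoeff b) := fun b hb => by
      rw [hb.2.1]
      exact isUnit_one
    obtain ⟨c, r, hr, -, hrem⟩ := MonomialOrder.div_set hB p
    have hspan : Finsupp.linearCombination _ (fun b : reducedElements J => b.1) c ∈
        Ideal.span ((finite_reducedElements J).toFinset : Set (MvPolynomial (Fin n) ℚ)) := by
      rw [Finsupp.linearCombination_apply, Set.Finite.coe_toFinset]
      exact Submodule.sum_mem _ fun b _ => Ideal.mul_mem_left _ _ (Ideal.subset_span b.2)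
    have hr0 : r = 0 := by
      by_contra h0
      have hrJ : r ∈ J := by
        rw [← sub_eq_of_eq_add' hr]
        refine J.sub_mem hp ?_
        rw [Finsupp.linearCombination_apply]
        exact Submodule.sum_mem _ fun b _ => J.smul_mem _ b.2.1
      obtain ⟨g, hg, hle⟩ := hdvd r hrJ h0
      exact hrem _ (MonomialOrder.degree_mem_support h0) g ((Set.Finite.mem_toFinset _).1 hg) hle
    rw [hr, hr0, add_zero]
    exact hspan
  · exact ((Set.Finite.mem_toFinset _).1 hg).2.1
  · replace hg := (Set.Finite.mem_toFinset _).1 hg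
    replace hh := (Set.Finite.mem_toFinset _).1 hh
    have h1 := hg.2.2.2 α hα (leadingMonomials_mono (degree_mem_leadingMonomials hh) hle)
    rw [h1] at hle
    exact hne (eq_of_degree_eq hh hg (hg.2.2.1 _ (degree_mem_leadingMonomials hh) hle))

lemma sum_degree_eq_totalDegree (p : MvPolynomial (Fin n) ℚ) :
    (List.ofFn (degLex.degree p)).sum = p.totalDegree := by
  rw [List.sum_ofFn, ← MvPolynomial.degree_degLexDegree, Finsupp.degree_eq_sum]

lemma mem_filter_keep {B : List (MvPolynomial (Fin n) ℚ)} {d : ℕ} {b : MvPolynomial (Fin n) ℚ} :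
    b ∈ B.filter (keep d B) ↔ b ∈ B ∧ b.totalDegree ≤ d ∧
      ∀ b' ∈ B, degLex.degree b' ≤ degLex.degree b → b' = b := by
  rw [List.mem_filter, keep, Bool.and_eq_true, decide_eq_true_eq, sum_degree_eq_totalDegree,
    List.isEmpty_iff, List.filter_eq_nil_iff]
  simp

/-- A reduced echelon basis of a space that contains all elements of degree at most `d` of an ideal
gives the truncated reduced Gröbner basis. -/
theorem isTruncatedReducedGroebnerBasis_filter_keep {B : List (MvPolynomial (Fin n) ℚ)} {d : ℕ}
    (hB : IsEchelon B) (hJ : ∀ b ∈ B, b ∈ J)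
    (hd : ∀ p ∈ J, p.totalDegree ≤ d → p ∈ Submodule.span ℚ {b | b ∈ B}) :
    IsTruncatedReducedGroebnerBasis J d (B.filter (keep d B)) := by
  -- The order is graded, so a leading monomial of degree at most `d` comes from an element of
  -- degree at most `d`, which lies in the span of `B`.
  have hlm : ∀ α ∈ leadingMonomials J, α.degree ≤ d → ∃ b ∈ B, degLex.degree b = α := by
    rintro _ ⟨p, hp, h0, rfl⟩ hα
    rw [MvPolynomial.degree_degLexDegree] at hα
    exact hB.exists_degree_eq (hd p hp hα) h0
  refine ⟨hB.nodup.filter _, _, isReducedGroebnerBasis_reducedElements J, fun g => ?_⟩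
  rw [mem_filter_keep, Set.Finite.mem_toFinset]
  constructor
  · rintro ⟨hg, hgd, hmin⟩
    refine ⟨⟨hJ g hg, hB.monic g hg, fun α hα hle => ?_, fun α hα hαJ => ?_⟩, hgd⟩
    · obtain ⟨b, hb, rfl⟩ := hlm α hα ((Finsupp.degree_mono hle).trans
        ((MvPolynomial.degree_degLexDegree).le.trans hgd))
      rw [hmin b hb hle]
    -- Such a monomial is the leading monomial of some `b` in `B`. It occurs in `g`, so the echelon
    -- property forces `b = g`.
    · obtain ⟨b, hb, rfl⟩ := hlm α hαJ ((le_totalDegree hα).trans hgd)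
      by_contra hne
      refine mem_support_iff.1 hα (hB.coeff_eq_zero hg hb ?_)
      rintro rfl
      exact hne rfl
  · rintro ⟨hg, hgd⟩
    have hg0 := ne_zero_of_leadingCoeff_eq_one hg.2.1
    obtain ⟨b, hb, e⟩ := hB.exists_degree_eq (hd g hg.1 hgd) hg0
    have hbd : b.totalDegree ≤ d := by
      rw [← MvPolynomial.degree_degLexDegree, e, MvPolynomial.degree_degLexDegree]
      exact hgd
    -- Otherwise the leading monomial of `g - b` is that of some `c` in `B`. Since `c ≠ b`, it does
    -- not occur in `b`, hence it occurs in `g`. As `g` is reduced it must be the common leading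
    -- monomial of `g` and `b`, which does occur in `b`.
    have hgb : g = b := by
      by_contra hne
      have h0 : g - b ≠ 0 := sub_ne_zero.2 hne
      have hmem := J.sub_mem hg.1 (hJ b hb)
      have hdeg := (totalDegree_sub g b).trans (max_le hgd hbd)
      obtain ⟨c, hc, hce⟩ := hB.exists_degree_eq (hd _ hmem hdeg) h0
      have h1 : (g - b).coeff (degLex.degree c) ≠ 0 := by
        rw [hce]
        exact MonomialOrder.coeff_degree_ne_zero_iff.2 h0
      have hcb : b ≠ c := by
        rintro rfl
        have h2 : g.coeff (degLex.degree g) = 1 := hg.2.1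
        rw [coeff_sub, hB.coeff_degree hb, e, h2, sub_self] at h1
        exact h1 rfl
      have h3 := hB.coeff_eq_zero hb hc hcb
      rw [coeff_sub, h3, sub_zero] at h1
      have h4 := hg.2.2.2 _ (mem_support_iff.2 h1) ⟨g - b, hmem, h0, hce.symm⟩
      have h5 := hB.coeff_degree hb
      rw [e, ← h4, h3] at h5
      exact zero_ne_one h5
    subst hgb
    refine ⟨hb, hgd, fun b' hb' hle => ?_⟩
    have h1 := hg.2.2.1 _ ⟨b', hJ b' hb', hB.ne_zero hb', rfl⟩ hle
    by_contra hne
    have h2 := hB.coeff_eq_zero hb hb' (Ne.symm hne)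
    rw [h1, hB.coeff_degree hb] at h2
    exact one_ne_zero h2

end groebner

/-! ## Derivations -/

section derivations

variable {n m : ℕ} {F A : Set (MvPolynomial (Fin n) ℚ)} {l : List (MvPolynomial (Fin n) ℚ)}
  {p g : MvPolynomial (Fin n) ℚ}

/-- A combination with 0 is a multiple of the other premise, and the rule allows that premise to be
used twice with one coefficient 0; a nonzero multiple by a variable has a nonzero premise. -/
lemma PCStep.sdiff_zero (h : PCStep F m A p) (hp : p ≠ 0) : PCStep F m (A \ {0}) p := by
  rcases h with h | ⟨q, hq, r, hr, a, b, rfl⟩ | ⟨q, hq, ⟨v, rfl⟩, h⟩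
  · exact Or.inl h
  · rcases eq_or_ne q 0 with rfl | hq0
    · have hr0 : r ≠ 0 := by
        rintro rfl
        simp at hp
      exact .lincomb ⟨hr, hr0⟩ ⟨hr, hr0⟩ 0 b (by simp)
    · rcases eq_or_ne r 0 with rfl | hr0
      · exact .lincomb ⟨hq, hq0⟩ ⟨hq, hq0⟩ a 0 (by simp)
      · exact .lincomb ⟨hq, hq0⟩ ⟨hr, hr0⟩ a b rfl
  · exact Or.inr (Or.inr ⟨q, ⟨hq, right_ne_zero_of_mul hp⟩, ⟨v, rfl⟩, h⟩)

open scoped Classical in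
lemma PCLog.filter_ne_zero (h : PCLog F m A l) :
    PCLog F m (A \ {0}) (l.filter fun p => !decide (p = 0)) := by
  induction l generalizing A with
  | nil => trivial
  | cons p l ih =>
    have h1 := ih h.2
    rcases eq_or_ne p 0 with rfl | hp
    · rw [List.filter_cons_of_neg (by simp)]
      exact h1.mono (by
        rintro q ⟨rfl | hq, hq0⟩
        exacts [absurd rfl hq0, ⟨hq, hq0⟩])
    · rw [List.filter_cons_of_pos (by simpa using hp)]
      refine ⟨h.1.sdiff_zero hp, h1.mono ?_⟩
      rintro q ⟨rfl | hq, hq0⟩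
      exacts [Or.inl rfl, Or.inr ⟨hq, hq0⟩]

lemma PCLog.getElem (h : PCLog F m A l) (i : ℕ) (hi : i < l.length) :
    PCStep F m (A ∪ {p | ∃ (j : ℕ) (hj : j < l.length), j < i ∧ l[j] = p}) l[i] := by
  induction l generalizing A i with
  | nil => exact absurd hi (Nat.not_lt_zero _)
  | cons p l ih =>
    rcases i with _ | i
    · exact h.1.mono Set.subset_union_left
    · refine (ih h.2 i (Nat.lt_of_succ_lt_succ hi)).mono ?_
      rintro q ((rfl | hq) | ⟨j, hj, hji, rfl⟩)
      · exact Or.inr ⟨0, Nat.succ_pos _, Nat.succ_pos _, rfl⟩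
      · exact Or.inl hq
      · exact Or.inr ⟨j + 1, Nat.succ_lt_succ hj, Nat.succ_lt_succ hji, rfl⟩

lemma PCLog.isPCDerivation (h : PCLog F m ∅ l) (hg : l.getLast? = some g) :
    IsPCDerivation F l g := by
  refine ⟨hg, fun i => ?_⟩
  rcases h.getElem i.1 i.2 with h | ⟨q, hq, r, hr, a, b, h⟩ | ⟨q, hq, ⟨v, h⟩, -⟩
  · exact Or.inl h.1
  · rcases hq with hq | ⟨j, hj, hji, rfl⟩
    · exact absurd hq (Set.notMem_empty _)
    rcases hr with hr | ⟨j', hj', hji', rfl⟩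
    · exact absurd hr (Set.notMem_empty _)
    exact Or.inr (Or.inl ⟨⟨j, hj⟩, ⟨j', hj'⟩, hji, hji', a, b, h⟩)
  · rcases hq with hq | ⟨j, hj, hji, rfl⟩
    · exact absurd hq (Set.notMem_empty _)
    exact Or.inr (Or.inr ⟨⟨j, hj⟩, hji, v, h⟩)

open scoped Classical in
lemma PCLog.isPCDerivation_append (h : PCLog F m {0} l) (hg : g ∈ l) (hg0 : g ≠ 0) :
    IsPCDerivation F (l.filter (fun p => !decide (p = 0)) ++ [g]) g ∧
      ∀ r ∈ l.filter (fun p => !decide (p = 0)) ++ [g], r.totalDegree ≤ m := by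
  have h1 := h.filter_ne_zero
  rw [Set.sdiff_self] at h1
  have hg' : g ∈ l.filter fun p => !decide (p = 0) := List.mem_filter.2 ⟨hg, by simpa using hg0⟩
  -- The final copy of `g` is inferred from its earlier occurrence as `1 * g + 0 * g`.
  have h2 : PCLog F m ∅ (l.filter (fun p => !decide (p = 0)) ++ [g]) :=
    h1.append ⟨.lincomb (Or.inr hg') (Or.inr hg') 1 0 (by simp), trivial⟩
  exact ⟨h2.isPCDerivation (by simp), h2.totalDegree_le (by simp)⟩

end derivations

/-! ## The main theorem -/

/-- A polynomial in `max n 2 ^ max d 1` is bounded by a power of `max n 2` of exponent linear in `d`. -/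
lemma add_two_pow_le (n d c : ℕ) :
    (max n 2 ^ max d 1 + 2) ^ c ≤ max n 2 ^ (2 * c * max d 1) := by
  set t := max n 2 ^ max d 1
  have h1 : 2 ≤ t := (le_max_right n 2).trans (Nat.le_self_pow (by omega) _)
  calc (t + 2) ^ c ≤ (t ^ 2) ^ c := Nat.pow_le_pow_left (by nlinarith) _
    _ = _ := by rw [← pow_mul, ← pow_mul, mul_comm (max d 1)]

/-- The semilattice lives on a separate type `A`, because `D` also carries the numerical order of
the rationals. -/
theorem exists_program {D : Finset ℚ} {Γ : ConstraintLanguage D} (f : DefiningPolys Γ)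
    {A : Type} [SemilatticeInf A] [Fintype A] [DecidableEq A]
    (e : A ≃ D) (hΓ : ∀ j, ∀ s t : Fin (Γ.arity j) → A, (fun l => e (s l)) ∈ Γ.rel j →
      (fun l => e (t l)) ∈ Γ.rel j → (fun l => e (s l ⊓ t l)) ∈ Γ.rel j) :
    ∃ (P : Prog) (K : ℕ), ∀ (n d : ℕ) (I : CSPInstance Γ n),
      ∃ (out : List (MvPolynomial (Fin n) ℚ × List (MvPolynomial (Fin n) ℚ))) (t : ℕ),
        Runs P (I.encode d) (encodeOutput out) t ∧
        t ≤ max n 2 ^ (K * max d 1) ∧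
        IsTruncatedReducedGroebnerBasis I.ideal d (out.map Prod.fst) ∧
        ∀ e ∈ out,
          IsPCDerivation (I.axiomPolys f) e.2 e.1 ∧
          (∀ r ∈ e.2, r.totalDegree ≤ K * max d 1) ∧
          (encodePolyList e.2).size ≤ max n 2 ^ (K * max d 1) := by
  classical
  set tab := indicatorPolys fun a => (e a : ℚ)
  set E := f.degreeBound
  obtain ⟨P, τ, ⟨c, hτ⟩, hP⟩ := computes_output f tab E
  -- `2 * c` accounts for the running time and `4 * E` for the degree.
  refine ⟨P, 2 * c + 4 * E, fun n d I => ⟨output (I.axiomList f) (prods n tab (d + 1))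
    (E * (d + 1)) d, τ ⟨n, d, I⟩, hP ⟨n, d, I⟩, ?_, ?_, ?_⟩⟩
  all_goals
    have htime : τ ⟨n, d, I⟩ ≤ max n 2 ^ ((2 * c + 4 * E) * max d 1) :=
      (hτ ⟨n, d, I⟩).trans ((add_two_pow_le n d c).trans (Nat.pow_le_pow_right (by omega)
        (Nat.mul_le_mul_right _ (Nat.le_add_right _ _))))
    have hfst : (output (I.axiomList f) (prods n tab (d + 1)) (E * (d + 1)) d).map Prod.fst =
        (saturate (I.axiomList f) (prods n tab (d + 1)) (E * (d + 1))).1.filter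
          (keep d (saturate (I.axiomList f) (prods n tab (d + 1)) (E * (d + 1))).1) := by
      rw [output, List.map_map]
      exact List.map_id _
  · exact htime
  · rw [hfst]
    exact isTruncatedReducedGroebnerBasis_filter_keep (isEchelon_elim _)
      (fun b hb => span_saturate_subset (I.axiomList_subset f) (Submodule.subset_span hb))
      fun p hp hpd => I.mem_span_saturate e hΓ f hp hpd
  · intro o ho
    -- The derivation is part of the output, whose size is at most the running time.
    have hsize : (encodePolyList o.2).size ≤ τ ⟨n, d, I⟩ := by
      have h1 := Data.size_le_of_mem (List.mem_map_of_mem (f := fun e => Data.pair (encodePoly e.1)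
        (encodePolyList e.2)) ho)
      refine le_trans ?_ (h1.trans (hP ⟨n, d, I⟩).size_le.2)
      simp only [Data.size]
      omega
    obtain ⟨g, hg, rfl⟩ := List.mem_map.1 ho
    have hgS := (List.mem_filter.1 hg).1
    have hcard : Fintype.card A ≤ E := by
      rw [Fintype.card_congr e, Fintype.card_coe]
      simp only [E, DefiningPolys.degreeBound]
      omega
    -- Axioms and members of `U` have degree at most `E * (d + 1)`, and the monomial multipliers
    -- contribute the same again.
    obtain ⟨h1, h2⟩ := pcLog_saturate (F := I.axiomPolys f) (L := I.axiomList f)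
      (U := prods n tab (d + 1)) (d := E * (d + 1)) (k := E * (d + 1)) (m := 2 * (E * (d + 1)))
      (fun p hp => ⟨I.mem_axiomList f |>.1 hp, (I.totalDegree_axiomList_le f p hp).trans
        (Nat.le_mul_of_pos_right _ (Nat.succ_pos _))⟩)
      (fun u hu => (totalDegree_prods_le (fun t ht => totalDegree_indicatorPolys_le ht) u hu).trans
        (by rw [mul_comm]; exact Nat.mul_le_mul_right _ hcard)) (by omega)
    have hg0 := (isEchelon_elim _).ne_zero hgS
    have hgL := (h2 g hgS).resolve_left hg0
    obtain ⟨h3, h4⟩ := h1.isPCDerivation_append hgL hg0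
    refine ⟨h3, fun r hr => (h4 r hr).trans ?_, hsize.trans htime⟩
    have h5 : d + 1 ≤ 2 * max d 1 := by omega
    calc 2 * (E * (d + 1)) ≤ 2 * (E * (2 * max d 1)) := by gcongr
      _ = 4 * E * max d 1 := by ring
      _ ≤ _ := Nat.mul_le_mul_right _ (Nat.le_add_left _ _)

theorem mainTheorem7 (D : Finset ℚ) (Γ : ConstraintLanguage D) (f : DefiningPolys Γ)
    (hΓ : Γ.IsSemilatticeClosed) :
    ∃ (P : Prog) (K : ℕ), ∀ (n d : ℕ) (I : CSPInstance Γ n),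
      ∃ (out : List (MvPolynomial (Fin n) ℚ × List (MvPolynomial (Fin n) ℚ))) (t : ℕ),
        Runs P (I.encode d) (encodeOutput out) t ∧
        t ≤ max n 2 ^ (K * max d 1) ∧
        IsTruncatedReducedGroebnerBasis I.ideal d (out.map Prod.fst) ∧
        ∀ e ∈ out,
          IsPCDerivation (I.axiomPolys f) e.2 e.1 ∧
          (∀ r ∈ e.2, r.totalDegree ≤ K * max d 1) ∧
          (encodePolyList e.2).size ≤ max n 2 ^ (K * max d 1) := by
  obtain ⟨ψ, hψ, hpol⟩ := hΓ
  -- `ψ` becomes the meet and induces the order. The instance is passed explicitly so that the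
  -- numerical order on `D` is not chosen.
  exact @exists_program D Γ f D (@SemilatticeInf.mk' D ⟨ψ⟩ hψ.comm hψ.assoc hψ.idem) _ _
    (Equiv.refl D) fun j s t hs ht => hpol j s hs t ht
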